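/- Let $k=\overline{\mathbb Q}\subset\mathbb C$ be the field of complex algebraic numbers. An element $z\in k$ is given by finite data $(c,a,b,n)$, where $c$ is the list of integer coefficients of a nonzero polynomial, $a,b\in\mathbb Z$ and $n\in\mathbb N$ are such that $z$ is the only root of this polynomial in the open disc of centre $(a+b\sqrt{-1})/(n+1)$ and radius $1/(n+1)$. A polynomial over $k$ is given by a finite list of terms (a given coefficient together with the list of exponents) whose sum it is. A projective scheme $X\subset\mathbb P^{r-1}=\operatorname{Proj}k[x_1,\dots,x_r]$ is given by finitely many given homogeneous polynomials $f_1,\dots,f_l\in k[x_1,\dots,x_r]$ such that $X$ is the closed subscheme $\operatorname{Proj}k[x_1,\dots,x_r]/(f_1,\dots,f_l)$ of $\mathbb P^{r-1}$. Two closed subschemes $X,Y\subset\mathbb P^{r-1}$ are called projectively equivalent if there is $g\in\operatorname{GL}_r(k)$ such that $g(X)=Y$ as closed subschemes of $\mathbb P^{r-1}$. **Proposition 5.1.** It is decidable whether two projective schemes embedded in the same projective space are projectively equivalent: there is an algorithm (a total computable function) which, given an integer $r\ge 1$ and two projective schemes $X,Y\subset\mathbb P^{r-1}$ as above, outputs true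 if $X$ and $Y$ are projectively equivalent and false otherwise. -/

import Mathlib

namespace ProjEquiv

noncomputable section

open CategoryTheory AlgebraicGeometry HomogeneousIdeal

/-! ### Closed subschemes of `Proj` defined by homogeneous ideals -/

section Quotient

variable {k A : Type} [Field k] [CommRing A] [Algebra k A]
  (𝒜 : ℕ → Submodule k A) [GradedAlgebra 𝒜] (I : HomogeneousIdeal 𝒜)

/-- The grading of `A / I` for a homogeneous ideal `I`: the degree `n` part is the image of the
degree `n` part of `A`. -/
def quotientGrading (n : ℕ) : Submodule k (A ⧸ I.toIdeal) :=
  (𝒜 n).map (Ideal.Quotient.mkₐ k I.toIdeal).toLinearMap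

lemma mk_mem_quotientGrading {n : ℕ} {a : A} (ha : a ∈ 𝒜 n) :
    Ideal.Quotient.mkₐ k I.toIdeal a ∈ quotientGrading 𝒜 I n :=
  ⟨a, ha, rfl⟩

instance : SetLike.GradedMonoid (quotientGrading 𝒜 I) where
  one_mem := ⟨1, SetLike.GradedOne.one_mem, map_one (Ideal.Quotient.mkₐ k I.toIdeal)⟩
  mul_mem := by
    rintro i j _ _ ⟨a, ha, rfl⟩ ⟨b, hb, rfl⟩
    exact ⟨a * b, SetLike.GradedMul.mul_mem ha hb, map_mul (Ideal.Quotient.mkₐ k I.toIdeal) a b⟩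

/-- The degree `n` component of the projection `A → A / I`. -/
def quotientComponent (n : ℕ) : 𝒜 n →ₗ[k] quotientGrading 𝒜 I n :=
  ((Ideal.Quotient.mkₐ k I.toIdeal).toLinearMap.comp (𝒜 n).subtype).codRestrict _
    fun a ↦ mk_mem_quotientGrading 𝒜 I a.2

/-- The map `A → ⨁ (A / I)ₙ` which takes the homogeneous components modulo `I`. -/
def quotientDecomposeAux : A →ₐ[k] DirectSum ℕ fun n ↦ quotientGrading 𝒜 I n :=
  (DirectSum.toAlgebra k (fun n ↦ 𝒜 n)
    (fun n ↦ (DirectSum.lof k ℕ (fun n ↦ quotientGrading 𝒜 I n) n).comp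
      (quotientComponent 𝒜 I n)) (by
      rw [LinearMap.comp_apply, DirectSum.lof_eq_of]
      rfl)
    (by
      intro i j a b
      simp only [LinearMap.comp_apply, DirectSum.lof_eq_of]
      rw [DirectSum.of_mul_of]
      rfl)).comp (DirectSum.decomposeAlgEquiv 𝒜).toAlgHom

lemma quotientDecomposeAux_of_mem {n : ℕ} {a : A} (ha : a ∈ 𝒜 n) :
    quotientDecomposeAux 𝒜 I a =
      DirectSum.of (fun n ↦ quotientGrading 𝒜 I n) n ⟨_, mk_mem_quotientGrading 𝒜 I ha⟩ := by
  have h : DirectSum.decomposeAlgEquiv 𝒜 a = DirectSum.of (fun n ↦ 𝒜 n) n ⟨a, ha⟩ :=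
    DirectSum.decompose_of_mem 𝒜 ha
  simp only [quotientDecomposeAux, AlgHom.comp_apply, AlgEquiv.toAlgHom_apply, h]
  exact DirectSum.toModule_lof k n _

instance : GradedAlgebra (quotientGrading 𝒜 I) :=
  GradedAlgebra.ofAlgHom _
    (Ideal.Quotient.liftₐ I.toIdeal (quotientDecomposeAux 𝒜 I) (by
      classical
      intro a ha
      rw [← DirectSum.sum_support_decompose 𝒜 a, map_sum]
      refine Finset.sum_eq_zero fun n _ ↦ ?_
      rw [quotientDecomposeAux_of_mem 𝒜 I (SetLike.coe_mem _)]
      have h0 : Ideal.Quotient.mkₐ k I.toIdeal (DirectSum.decompose 𝒜 a n) = 0 :=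
        Ideal.Quotient.eq_zero_iff_mem.mpr (I.isHomogeneous n ha)
      convert map_zero (DirectSum.of (fun n ↦ quotientGrading 𝒜 I n) n) using 2
      exact Subtype.ext h0))
    (by
      classical
      refine Ideal.Quotient.algHom_ext k (AlgHom.ext fun a ↦ ?_)
      change DirectSum.coeAlgHom (quotientGrading 𝒜 I) (quotientDecomposeAux 𝒜 I a) =
        Ideal.Quotient.mkₐ k I.toIdeal a
      rw [← DirectSum.sum_support_decompose 𝒜 a, map_sum, map_sum, map_sum]
      refine Finset.sum_congr rfl fun n _ ↦ ?_
      rw [quotientDecomposeAux_of_mem 𝒜 I (SetLike.coe_mem _), DirectSum.coeAlgHom_of])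
    (by
      rintro i ⟨_, a, ha, rfl⟩
      exact quotientDecomposeAux_of_mem 𝒜 I ha)

/-- The projection `A → A / I` as a homomorphism of graded rings. -/
def quotientHom : 𝒜 →+*ᵍ quotientGrading 𝒜 I where
  __ := Ideal.Quotient.mk I.toIdeal
  map_mem ha := mk_mem_quotientGrading 𝒜 I ha

lemma irrelevant_le_map_of_surjective {B : Type} [CommRing B] [Algebra k B]
    {ℬ : ℕ → Submodule k B} [GradedAlgebra ℬ] (f : 𝒜 →+*ᵍ ℬ)
    (hf : ∀ n, ∀ b ∈ ℬ n, ∃ a ∈ 𝒜 n, f a = b) :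
    irrelevant ℬ ≤ (irrelevant 𝒜).map f := by
  rw [irrelevant_le]
  intro i hi b hb
  obtain ⟨a, ha, rfl⟩ := hf i b hb
  exact Ideal.mem_map_of_mem f (mem_irrelevant_of_mem 𝒜 hi ha)

/-- The closed subscheme `Proj (A / I)` of `Proj A`. -/
def closedSubscheme : Scheme := Proj (quotientGrading 𝒜 I)

/-- The closed immersion `Proj (A / I) ⟶ Proj A`. -/
def closedSubschemeι : closedSubscheme 𝒜 I ⟶ Proj 𝒜 :=
  Proj.map (quotientHom 𝒜 I) (irrelevant_le_map_of_surjective 𝒜 _ fun _ _ hb ↦ hb)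

end Quotient

/-! ### Projective space over the algebraic numbers and the action of `GL_r` -/

/-- The field of complex algebraic numbers. -/
abbrev QBar : Type := algebraicClosure ℚ ℂ

/-- The standard grading of `k[x_1, …, x_r]`, where `k` is the field of algebraic numbers. -/
abbrev polyGrading (r : ℕ) : ℕ → Submodule QBar (MvPolynomial (Fin r) QBar) :=
  MvPolynomial.homogeneousSubmodule (Fin r) QBar

instance (r : ℕ) : GradedAlgebra (polyGrading r) := MvPolynomial.gradedAlgebra

/-- The projective space `ℙ^{r-1} = Proj k[x_1, …, x_r]`. -/
abbrev PP (r : ℕ) : Scheme := Proj (polyGrading r)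

/-- The linear substitution `x_i ↦ ∑_j g_{ij} x_j`. -/
def linSubst {r : ℕ} (g : Matrix (Fin r) (Fin r) QBar) : polyGrading r →+*ᵍ polyGrading r where
  __ := (MvPolynomial.bind₁ fun i ↦
      ∑ j, MvPolynomial.C (g i j) * (MvPolynomial.X j : MvPolynomial (Fin r) QBar)).toRingHom
  map_mem := by
    intro n p hp
    have h := MvPolynomial.IsHomogeneous.eval₂ (m := n) (n := 1) (φ := p) hp MvPolynomial.C
      (fun i ↦ ∑ j, MvPolynomial.C (g i j) * (MvPolynomial.X j : MvPolynomial (Fin r) QBar))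
      (fun c ↦ MvPolynomial.isHomogeneous_C _ c)
      (fun i ↦ MvPolynomial.IsHomogeneous.sum _ _ _ fun j _ ↦ by
        simpa using (MvPolynomial.isHomogeneous_C (Fin r) (g i j)).mul
          (MvPolynomial.isHomogeneous_X QBar j))
    rw [one_mul] at h
    exact h

lemma linSubst_linSubst {r : ℕ} (g h : Matrix (Fin r) (Fin r) QBar) (hgh : g * h = 1)
    (p : MvPolynomial (Fin r) QBar) : linSubst h (linSubst g p) = p := by
  let φ (m : Matrix (Fin r) (Fin r) QBar) :
      MvPolynomial (Fin r) QBar →ₐ[QBar] MvPolynomial (Fin r) QBar :=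
    MvPolynomial.bind₁ fun i ↦
      ∑ j, MvPolynomial.C (m i j) * (MvPolynomial.X j : MvPolynomial (Fin r) QBar)
  suffices H : (φ h).comp (φ g) = AlgHom.id QBar _ from DFunLike.congr_fun H p
  ext1 i
  have hi (l : Fin r) := congrFun (congrFun hgh i) l
  simp only [Matrix.mul_apply] at hi
  simp only [φ, AlgHom.comp_apply, MvPolynomial.bind₁_X_right, map_sum, map_mul,
    MvPolynomial.algHom_C, MvPolynomial.algebraMap_eq, Finset.mul_sum, AlgHom.id_apply]
  rw [Finset.sum_comm]
  simp only [← mul_assoc, ← map_mul, ← Finset.sum_mul, ← map_sum, hi, Matrix.one_apply]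
  simp

/-- The automorphism of `ℙ^{r-1}` given by an invertible matrix `g`. On points with values in
the field of algebraic numbers it is `[a] ↦ [g a]`. -/
def glAction {r : ℕ} (g : GL (Fin r) QBar) : PP r ⟶ PP r :=
  Proj.map (linSubst g.val) (irrelevant_le_map_of_surjective _ _ fun _ b hb ↦
    ⟨linSubst g⁻¹.val b, (linSubst g⁻¹.val).map_mem hb,
      linSubst_linSubst _ _ g.inv_mul b⟩)

/-- The closed subschemes `X` and `Y` of `ℙ^{r-1}` defined by `I` and `J` are projectively
equivalent if `g(X) = Y` for some `g ∈ GL_r`, that is, if the closed immersions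
`X ⟶ ℙ^{r-1} ⟶ ℙ^{r-1}` (the inclusion followed by `g`) and `Y ⟶ ℙ^{r-1}`
are the same closed subscheme. -/
def ProjectivelyEquivalent {r : ℕ} (I J : HomogeneousIdeal (polyGrading r)) : Prop :=
  ∃ (g : GL (Fin r) QBar)
    (e : closedSubscheme (polyGrading r) I ≅ closedSubscheme (polyGrading r) J),
    e.hom ≫ closedSubschemeι (polyGrading r) J = closedSubschemeι (polyGrading r) I ≫ glAction g

/-! ### Finite data for algebraic numbers, polynomials and projective schemes -/

/-- Finite data for an algebraic number: the integer coefficients `c_0, c_1, …` of a polynomial,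
and `a, b, n` which stand for the open disc in `ℂ` with centre `(a + b i) / (n + 1)` and
radius `1 / (n + 1)`. -/
abbrev NumberCode : Type := List ℤ × ℤ × ℤ × ℕ

/-- The polynomial `c_0 + c_1 T + c_2 T ^ 2 + ⋯`. -/
def polyOfList (l : List ℤ) : Polynomial ℤ :=
  l.foldr (fun c p ↦ Polynomial.C c + Polynomial.X * p) 0

/-- The data `(c, a, b, n)` represent `z` if `z` is the only root in the disc of the nonzero
polynomial with coefficients `c`. -/
def NumberCode.Represents : NumberCode → QBar → Prop
  | (c, a, b, n), z => polyOfList c ≠ 0 ∧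
      ∀ w : ℂ, (Polynomial.aeval w (polyOfList c) = 0 ∧
        ‖w - (a + b * Complex.I) / (n + 1)‖ < 1 / (n + 1)) ↔ w = z

/-- Finite data for a term `z x_1 ^ {e_1} ⋯ x_r ^ {e_r}`: a code of `z`, and the list of the
exponents. -/
abbrev TermCode : Type := NumberCode × List ℕ

def TermCode.Represents (r : ℕ) (t : TermCode) (m : MvPolynomial (Fin r) QBar) : Prop :=
  t.2.length = r ∧ ∃ z : QBar, NumberCode.Represents t.1 z ∧
    m = MvPolynomial.C z * ∏ i : Fin r, MvPolynomial.X i ^ t.2.getD i 0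

/-- Finite data for a polynomial: a list of terms, whose sum it is. -/
abbrev PolyCode : Type := List TermCode

def PolyCode.Represents (r : ℕ) (c : PolyCode) (f : MvPolynomial (Fin r) QBar) : Prop :=
  ∃ ms : List (MvPolynomial (Fin r) QBar),
    List.Forall₂ (TermCode.Represents r) c ms ∧ f = ms.sum

/-- Finite data for a projective scheme in `ℙ^{r-1}`: a list of (codes of) homogeneous
polynomials. -/
abbrev SchemeCode : Type := List PolyCode

/-- The list `c` consists of codes of homogeneous polynomials `f_1, …, f_l` with
`I = (f_1, …, f_l)`. -/
def SchemeCode.Represents {r : ℕ} (c : SchemeCode) (I : HomogeneousIdeal (polyGrading r)) :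
    Prop :=
  ∃ fs : List (MvPolynomial (Fin r) QBar),
    List.Forall₂ (PolyCode.Represents r) c fs ∧
    (∀ f ∈ fs, ∃ d : ℕ, f.IsHomogeneous d) ∧
    I.toIdeal = Ideal.span {f | f ∈ fs}

end

end ProjEquiv

/-! Both projective equivalence and its negation have finite certificates which can be checked
mechanically. A parallel search for the two kinds is therefore a decision procedure; no degree
bounds and no Gröbner bases enter.

Closed subschemes of projective space agree iff their homogeneous ideals have the same saturation.
So, for ideals generated by `fs` and `hs`, equivalence means that some pair of mutually inverse
matrices carries `fs` into the saturation of `(hs)` and `hs` into the saturation of `(fs)`; this is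
`Good` (`projectivelyEquivalent_iff`, `projectivelyEquivalent_iff_good`). A positive certificate
consists of the two matrices and identities `x_k ^ N * f(g x) = ∑ a_j h_j`.

For the negation, membership in a saturation is expressed by linear equations. If `f` is not in the
saturation of `J`, the Nullstellensatz and Krull's intersection theorem give a point `p ≠ 0` and an
`n` such that `f` is not in `J + 𝔪_p ^ n`. Duality for the Gorenstein ring `K[x] / (x_i ^ (n + 1))`
then gives a multiplier `Λ` which annihilates `J`, translated to `p`, but not `f` (`exists_isTest`).
Conversely every such test vanishes on the saturation. Applied to `f(G x)` with a generic matrix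
`G`, the tests give polynomial equations in the entries of `G`, and the solutions of all of them are
the equivalences. By the Nullstellensatz there is no equivalence iff `1` is a finite combination of
these equations (`one_mem_of_not_good`, `not_good_of_one_mem`); this combination is the negative
certificate.

Finitely many algebraic numbers lie in `ℚ(θ, i)` with `θ` real, so all data are coded by rational
polynomials in `θ`, `i` and further variables. An equation is certified by cofactors with respect to
`h(θ)` and `i ^ 2 + 1`, where `h` is a rational polynomial with a change of sign
(`exists_theta_of_verify`, `exists_verify`). Such a certificate yields some real root `θ`, perhaps
not the intended one. Therefore the given numbers are pinned down by equations saying that they are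
roots in their discs; since `θ` is real, strict inequalities can be written with squares. A third
kind of certificate, for codes with no root in the disc, makes the search terminate on meaningless
input too. -/

namespace ProjEquiv
open CategoryTheory AlgebraicGeometry HomogeneousIdeal HomogeneousLocalization

/-! ### Morphisms of `Proj` on standard charts, and closed immersions. -/

section ProjMap
variable {k A B : Type} [Field k] [CommRing A] [Algebra k A] [CommRing B] [Algebra k B]
  {𝒜 : ℕ → Submodule k A} [GradedAlgebra 𝒜] {ℬ : ℕ → Submodule k B} [GradedAlgebra ℬ]
  (φ : 𝒜 →+*ᵍ ℬ) (hφ : irrelevant ℬ ≤ (irrelevant 𝒜).map φ)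

lemma awayToSection_bijective {i : ℕ} (hi : 0 < i) {s : A} (hs : s ∈ 𝒜 i) :
    Function.Bijective (Proj.awayToSection 𝒜 s).hom := by
  have h : (Proj.basicOpenIsoAway 𝒜 s hs hi).hom = Proj.awayToSection 𝒜 s :=
    Proj.basicOpenIsoAway_hom _ _ _ _
  rw [← h]
  exact ConcreteCategory.bijective_of_isIso (Proj.basicOpenIsoAway 𝒜 s hs hi).hom

lemma map_app_awayToSection {i : ℕ} {s : A} (hs : s ∈ 𝒜 i) (x : Away 𝒜 s) :
    ((Proj.map φ hφ).app (Proj.basicOpen 𝒜 s)).hom ((Proj.awayToSection 𝒜 s).hom x) =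
      (Proj.awayToSection ℬ (φ s)).hom (Away.map φ s x) := by
  have h := Proj.awayToSection_comp_appLE φ hφ hs
  have h2 := congr($(h).hom x)
  have h3 : Scheme.Hom.appLE (Proj.map φ hφ) (Proj.basicOpen 𝒜 s) (Proj.basicOpen ℬ (φ s)) le_rfl
    = (Proj.map φ hφ).app (Proj.basicOpen 𝒜 s) := Scheme.Hom.appLE_eq_app _
  rw [← h3]
  exact h2

lemma away_mk_eq_zero_iff {i : ℕ} {s : B} (hs : s ∈ ℬ i) (n : ℕ) (b : B) (hb : b ∈ ℬ (n • i)) :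
    Away.mk ℬ hs n b hb = 0 ↔ ∃ N : ℕ, s ^ N * b = 0 := by
  rw [← HomogeneousLocalization.val_injective _ |>.eq_iff, HomogeneousLocalization.val_zero,
    Away.val_mk, Localization.mk_eq_mk', IsLocalization.mk'_eq_zero_iff]
  constructor
  · rintro ⟨⟨_, N, rfl⟩, h⟩
    exact ⟨N, h⟩
  · rintro ⟨N, h⟩
    exact ⟨⟨_, N, rfl⟩, h⟩

/-- Sections over a basic open set are fractions `a / s ^ n`, so this describes the ideal sheaf of
the image on that chart. -/
lemma map_app_eq_zero_iff {i : ℕ} (hi : 0 < i) {s : A} (hs : s ∈ 𝒜 i) (n : ℕ) (a : A)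
    (ha : a ∈ 𝒜 (n • i)) :
    ((Proj.map φ hφ).app (Proj.basicOpen 𝒜 s)).hom
      ((Proj.awayToSection 𝒜 s).hom (Away.mk 𝒜 hs n a ha)) = 0 ↔
      ∃ N : ℕ, φ s ^ N * φ a = 0 := by
  rw [map_app_awayToSection φ hφ hs, Away.map_mk]
  exact (map_eq_zero_iff _ (awayToSection_bijective hi (φ.map_mem hs)).1).trans
    (away_mk_eq_zero_iff _ _ _ _)

/-- The question is local on the target. Over the affine open set of `s` the preimage is the affine
open set of `φ s`, and a fraction `b / φ(s) ^ n` lifts because `b` does. -/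
lemma isClosedImmersion_map (hsurj : ∀ n, ∀ b ∈ ℬ n, ∃ a ∈ 𝒜 n, φ a = b) :
    IsClosedImmersion (Proj.map φ hφ) := by
  let U : (Σ i : {i : ℕ // 0 < i}, 𝒜 i.1) → (Proj 𝒜).Opens := fun s => Proj.basicOpen 𝒜 s.2.1
  have hU : ⨆ s, U s = ⊤ := by
    refine Proj.iSup_basicOpen_eq_top 𝒜 (fun s : (Σ i : {i : ℕ // 0 < i}, 𝒜 i.1) => s.2.1) ?_
    rw [toIdeal_irrelevant_le]
    intro i hi x hx
    exact Ideal.subset_span ⟨⟨⟨i, hi⟩, ⟨x, hx⟩⟩, rfl⟩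
  rw [IsZariskiLocalAtTarget.iff_of_iSup_eq_top (P := @IsClosedImmersion) U hU]
  rintro ⟨⟨i, hi⟩, ⟨s, hs⟩⟩
  -- The restricted morphism has its global sections over the image of `⊤`, which equals the basic
  -- open set only propositionally; hence the variable `V`.
  have key : ∀ V, V = Proj.basicOpen 𝒜 s → Function.Surjective ((Proj.map φ hφ).app V).hom := by
    rintro V rfl y
    obtain ⟨z, rfl⟩ := (awayToSection_bijective hi (φ.map_mem hs)).2 y
    obtain ⟨n, b, hb, rfl⟩ := z.mk_surjective _ (φ.map_mem hs)
    obtain ⟨a, ha, rfl⟩ := hsurj _ b hb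
    exact ⟨(Proj.awayToSection 𝒜 s).hom (Away.mk 𝒜 hs n a ha), by
      rw [map_app_awayToSection φ hφ hs, Away.map_mk]; rfl⟩
  have a1 : IsAffine (Proj.basicOpen 𝒜 s).toScheme := Proj.isAffineOpen_basicOpen 𝒜 s hs hi
  have a2 : IsAffine (Proj.map φ hφ ⁻¹ᵁ Proj.basicOpen 𝒜 s).toScheme :=
    Proj.isAffineOpen_basicOpen ℬ (φ s) (φ.map_mem hs) hi
  refine IsClosedImmersion.of_surjective_of_isAffine (Proj.map φ hφ ∣_ Proj.basicOpen 𝒜 s) ?_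
  rw [morphismRestrict_appTop]
  intro y
  obtain ⟨x, hx⟩ := (ConcreteCategory.bijective_of_isIso ((Proj ℬ).presheaf.map (eqToHom
    (image_morphismRestrict_preimage (Proj.map φ hφ) (Proj.basicOpen 𝒜 s) ⊤)).op)).2 y
  obtain ⟨z, hz⟩ := key _ (Scheme.Opens.ι_image_top _) x
  exact ⟨z, by rw [← hx, ← hz]; rfl⟩
end ProjMap

/-! ### Equality of closed subschemes in terms of kernels. -/

section Compare
variable {k A B C : Type} [Field k] [CommRing A] [Algebra k A] [CommRing B] [Algebra k B]
  [CommRing C] [Algebra k C]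
  {𝒜 : ℕ → Submodule k A} [GradedAlgebra 𝒜] {ℬ : ℕ → Submodule k B} [GradedAlgebra ℬ]
  {𝒞 : ℕ → Submodule k C} [GradedAlgebra 𝒞]

/-- Closed subschemes of `Proj 𝒜` given by two graded quotients agree as soon as the kernels of the
quotient maps have the same saturation. -/
lemma exists_iso_map_iff {ι : Type} (x : ι → A) (hx : ∀ i, x i ∈ 𝒜 1)
    (hspan : (irrelevant 𝒜).toIdeal ≤ Ideal.span (Set.range x))
    (φ : 𝒜 →+*ᵍ ℬ) (hφ : irrelevant ℬ ≤ (irrelevant 𝒜).map φ)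
    (ψ : 𝒜 →+*ᵍ 𝒞) (hψ : irrelevant 𝒞 ≤ (irrelevant 𝒜).map ψ)
    (hφs : ∀ n, ∀ b ∈ ℬ n, ∃ a ∈ 𝒜 n, φ a = b) (hψs : ∀ n, ∀ b ∈ 𝒞 n, ∃ a ∈ 𝒜 n, ψ a = b) :
    (∃ e : Proj ℬ ≅ Proj 𝒞, e.hom ≫ Proj.map ψ hψ = Proj.map φ hφ) ↔
      ∀ i n, ∀ a ∈ 𝒜 n,
        (∃ N : ℕ, φ (x i) ^ N * φ a = 0) ↔ (∃ N : ℕ, ψ (x i) ^ N * ψ a = 0) := by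
  have h1 := isClosedImmersion_map φ hφ hφs
  have h2 := isClosedImmersion_map ψ hψ hψs
  constructor
  · rintro ⟨e, he⟩ i n a ha
    have ha' : a ∈ 𝒜 (n • 1) := by simpa using ha
    rw [← map_app_eq_zero_iff φ hφ one_pos (hx i) n a ha',
      ← map_app_eq_zero_iff ψ hψ one_pos (hx i) n a ha', ← RingHom.mem_ker, ← RingHom.mem_ker]
    -- An isomorphism over `Proj 𝒜` does not change the ideal sheaf, and on the chart of `x i` this
    -- sheaf is the stated condition.
    have hk : (Proj.map φ hφ).ker = (Proj.map ψ hψ).ker := by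
      rw [← he, Scheme.Hom.ker_comp_of_isIso]
    have h3 := congr(($hk).ideal
      ⟨Proj.basicOpen 𝒜 (x i), Proj.isAffineOpen_basicOpen 𝒜 _ (hx i) one_pos⟩)
    rw [Scheme.Hom.ker_apply, Scheme.Hom.ker_apply] at h3
    exact SetLike.ext_iff.mp h3 _
  · intro h
    have hk : (Proj.map φ hφ).ker = (Proj.map ψ hψ).ker := by
      refine Scheme.IdealSheafData.ext_of_iSup_eq_top
        (fun i => ⟨Proj.basicOpen 𝒜 (x i), Proj.isAffineOpen_basicOpen 𝒜 _ (hx i) one_pos⟩)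
        (Proj.iSup_basicOpen_eq_top 𝒜 x hspan) fun i => ?_
      ext y
      rw [Scheme.Hom.ker_apply, Scheme.Hom.ker_apply, RingHom.mem_ker, RingHom.mem_ker]
      obtain ⟨z, rfl⟩ := (awayToSection_bijective one_pos (hx i)).2 y
      obtain ⟨n, b, hb, rfl⟩ := z.mk_surjective _ (hx i)
      exact ((map_app_eq_zero_iff φ hφ one_pos (hx i) n b hb).trans
        (h i n b (by simpa using hb))).trans
        (map_app_eq_zero_iff ψ hψ one_pos (hx i) n b hb).symm
    -- Closed immersions with the same ideal sheaf factor through each other.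
    have := IsClosedImmersion.isIso_lift (Proj.map ψ hψ) (Proj.map φ hφ) hk.symm
    exact ⟨asIso (IsClosedImmersion.lift (Proj.map ψ hψ) (Proj.map φ hφ) hk.ge), by simp⟩
end Compare

/-! ### Projective equivalence as a statement on saturated ideals. -/

section Saturation
variable {r : ℕ}

/-- `f` vanishes on the closed subscheme of projective space defined by `J`: on every standard
chart a power of the coordinate multiplies `f` into `J`. -/
def MemSat {σ K : Type} [CommRing K] (J : Ideal (MvPolynomial σ K)) (f : MvPolynomial σ K) : Prop :=
  ∀ k, ∃ N : ℕ, MvPolynomial.X k ^ N * f ∈ J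

/-- The saturation of an ideal with respect to the variables. -/
def satIdeal {σ K : Type} [CommRing K] (J : Ideal (MvPolynomial σ K)) :
    Ideal (MvPolynomial σ K) where
  carrier := {f | MemSat J f}
  zero_mem' k := ⟨0, by simp⟩
  add_mem' {a b} ha hb k := by
    obtain ⟨N, hN⟩ := ha k
    obtain ⟨M, hM⟩ := hb k
    refine ⟨N + M, ?_⟩
    have : (MvPolynomial.X k : MvPolynomial σ K) ^ (N + M) * (a + b) =
      MvPolynomial.X k ^ M * (MvPolynomial.X k ^ N * a) +
      MvPolynomial.X k ^ N * (MvPolynomial.X k ^ M * b) := by ring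
    rw [this]
    exact J.add_mem (J.mul_mem_left _ hN) (J.mul_mem_left _ hM)
  smul_mem' c a ha k := by
    obtain ⟨N, hN⟩ := ha k
    exact ⟨N, by rw [smul_eq_mul, mul_left_comm]; exact J.mul_mem_left _ hN⟩

lemma mem_satIdeal {σ K : Type} [CommRing K] {J : Ideal (MvPolynomial σ K)}
    {f : MvPolynomial σ K} : f ∈ satIdeal J ↔ MemSat J f := Iff.rfl

/-- The linear substitution `x_i ↦ ∑_j g_{ij} x_j` as an algebra homomorphism. -/
noncomputable def substHom {K : Type} [CommRing K] (g : Matrix (Fin r) (Fin r) K) :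
    MvPolynomial (Fin r) K →ₐ[K] MvPolynomial (Fin r) K :=
  MvPolynomial.bind₁ fun i => ∑ j, MvPolynomial.C (g i j) * MvPolynomial.X j

lemma substHom_X {K : Type} [CommRing K] (g : Matrix (Fin r) (Fin r) K) (i : Fin r) :
    substHom g (MvPolynomial.X i) = ∑ j, MvPolynomial.C (g i j) * MvPolynomial.X j :=
  MvPolynomial.bind₁_X_right _ _

lemma substHom_substHom (g h : Matrix (Fin r) (Fin r) QBar) (hgh : g * h = 1)
    (p : MvPolynomial (Fin r) QBar) : substHom h (substHom g p) = p :=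
  linSubst_linSubst g h hgh p

/-- In this form the admissible `a` visibly form an ideal, so that linear combinations of admissible
forms are admissible. -/
lemma exists_pow_mul_mem_iff {S : Type} [CommRing S] (J : Ideal S) (a f : S) :
    (∃ N : ℕ, a ^ N * f ∈ J) ↔ a ∈ (J.colon {f}).radical := by
  simp only [Ideal.mem_radical_iff, Submodule.mem_colon_singleton, smul_eq_mul]

lemma memSat_iff_X_mem {K σ : Type} [CommRing K] (J : Ideal (MvPolynomial σ K))
    (f : MvPolynomial σ K) :
    MemSat J f ↔ ∀ k, MvPolynomial.X k ∈ (J.colon {f}).radical :=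
  forall_congr' fun _ => exists_pow_mul_mem_iff _ _ _

/-- Saturation does not depend on the linear coordinates: for an invertible matrix the forms
`substHom g (X k)` and the variables are linear combinations of each other, and the admissible
multipliers form an ideal. -/
lemma memSat_iff_substHom_X_mem (g h : Matrix (Fin r) (Fin r) QBar) (hhg : h * g = 1)
    (J : Ideal (MvPolynomial (Fin r) QBar)) (f : MvPolynomial (Fin r) QBar) :
    MemSat J f ↔ ∀ k, ∃ N : ℕ, substHom g (MvPolynomial.X k) ^ N * f ∈ J := by
  simp only [exists_pow_mul_mem_iff, memSat_iff_X_mem]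
  constructor
  · intro H k
    rw [substHom_X]
    exact Ideal.sum_mem _ fun j _ => Ideal.mul_mem_left _ _ (H j)
  · intro H k
    rw [← substHom_substHom h g hhg (MvPolynomial.X k), substHom_X, map_sum]
    exact Ideal.sum_mem _ fun j _ => by
      rw [map_mul]
      exact Ideal.mul_mem_left _ _ (H j)

lemma quotientHom_eq_zero_iff (I : HomogeneousIdeal (polyGrading r))
    (a : MvPolynomial (Fin r) QBar) : quotientHom (polyGrading r) I a = 0 ↔ a ∈ I.toIdeal :=
  Ideal.Quotient.eq_zero_iff_mem

lemma irrelevant_polyGrading_le_span :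
    (irrelevant (polyGrading r)).toIdeal ≤
      Ideal.span (Set.range (MvPolynomial.X : Fin r → MvPolynomial (Fin r) QBar)) := by
  rw [toIdeal_irrelevant_le]
  intro n hn p hp
  have hp' : p.IsHomogeneous n := hp
  change p ∈ Ideal.span _
  rw [← Set.image_univ, MvPolynomial.mem_ideal_span_X_image]
  intro m hm
  have h1 := hp' (MvPolynomial.mem_support_iff.mp hm)
  by_contra hcon
  push Not at hcon
  have : m = 0 := by
    ext i
    simpa using hcon i
  subst this
  simp at h1
  omega

/-- Both embeddings are `Proj` of a graded homomorphism out of `k[x]`: the quotient by `J`, and the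
substitution of `g` followed by the quotient by `I`. Comparing kernels up to saturation gives two
inclusions, each of which needs to be tested on generators only. -/
lemma projectivelyEquivalent_iff (I J : HomogeneousIdeal (polyGrading r)) :
    ProjectivelyEquivalent I J ↔ ∃ g g' : Matrix (Fin r) (Fin r) QBar, g * g' = 1 ∧ g' * g = 1 ∧
      (∀ f ∈ I.toIdeal, MemSat J.toIdeal (substHom g' f)) ∧
      (∀ f ∈ J.toIdeal, MemSat I.toIdeal (substHom g f)) := by
  have hX : ∀ i, (MvPolynomial.X i : MvPolynomial (Fin r) QBar) ∈ polyGrading r 1 :=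
    fun i => MvPolynomial.isHomogeneous_X _ _
  have key (g : GL (Fin r) QBar) : (∃ e : closedSubscheme (polyGrading r) I ≅
      closedSubscheme (polyGrading r) J, e.hom ≫ closedSubschemeι (polyGrading r) J =
        closedSubschemeι (polyGrading r) I ≫ glAction g) ↔
      ∀ i n, ∀ a ∈ polyGrading r n,
        (∃ N : ℕ, substHom g.val (MvPolynomial.X i) ^ N * substHom g.val a ∈ I.toIdeal) ↔
        (∃ N : ℕ, (MvPolynomial.X i) ^ N * a ∈ J.toIdeal) := by
    have hsurj : ∀ n, ∀ b ∈ polyGrading r n, ∃ a ∈ polyGrading r n, linSubst g.val a = b :=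
      fun _ b hb ↦ ⟨linSubst g⁻¹.val b, (linSubst g⁻¹.val).map_mem hb,
        linSubst_linSubst _ _ g.inv_mul b⟩
    have hirr : irrelevant (polyGrading r) ≤ (irrelevant (polyGrading r)).map (linSubst g.val) :=
      irrelevant_le_map_of_surjective _ _ hsurj
    have hirr' (I : HomogeneousIdeal (polyGrading r)) :
        irrelevant (quotientGrading (polyGrading r) I) ≤
          (irrelevant (polyGrading r)).map (quotientHom (polyGrading r) I) :=
      irrelevant_le_map_of_surjective _ _ fun _ _ hb ↦ hb
    change (∃ e : Proj (quotientGrading (polyGrading r) I) ≅ Proj (quotientGrading (polyGrading r) J),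
      e.hom ≫ Proj.map (quotientHom (polyGrading r) J) (hirr' J) =
        Proj.map (quotientHom (polyGrading r) I) (hirr' I) ≫ Proj.map (linSubst g.val) hirr) ↔ _
    rw [← Proj.map_comp]
    refine (exists_iso_map_iff (MvPolynomial.X : Fin r → MvPolynomial (Fin r) QBar) hX
      irrelevant_polyGrading_le_span _ _ _ _ ?_ ?_).trans ?_
    · rintro n _ ⟨b, hb, rfl⟩
      obtain ⟨a, ha, rfl⟩ := hsurj n b hb
      exact ⟨a, ha, rfl⟩
    · rintro n _ ⟨b, hb, rfl⟩
      exact ⟨b, hb, rfl⟩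
    · refine forall_congr' fun i => forall_congr' fun n => forall₂_congr fun a ha => ?_
      refine iff_congr (exists_congr fun N => ?_) (exists_congr fun N => ?_)
      · rw [← quotientHom_eq_zero_iff, map_mul, map_pow]
        rfl
      · rw [← quotientHom_eq_zero_iff, map_mul, map_pow]
  -- The comparison of kernels speaks of homogeneous elements only; a homogeneous ideal is the sum
  -- of its homogeneous parts.
  have hcomp (I : HomogeneousIdeal (polyGrading r)) (L : Ideal (MvPolynomial (Fin r) QBar))
      (hL : ∀ n, ∀ f ∈ polyGrading r n, f ∈ I.toIdeal → f ∈ L) : ∀ f ∈ I.toIdeal, f ∈ L := by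
    classical
    intro f hf
    rw [← DirectSum.sum_support_decompose (polyGrading r) f]
    exact L.sum_mem fun n _ => hL n _ (SetLike.coe_mem _) (I.isHomogeneous n hf)
  unfold ProjectivelyEquivalent
  simp only [key]
  constructor
  · rintro ⟨g, hg⟩
    refine ⟨g.val, g⁻¹.val, g.mul_inv, g.inv_mul,
      hcomp I ((satIdeal J.toIdeal).comap (substHom g⁻¹.val)) fun n f hf hfI => ?_,
      hcomp J ((satIdeal I.toIdeal).comap (substHom g.val)) fun n f hf hfJ => ?_⟩
    · intro i
      -- The criterion is applied to `g⁻¹ f`, whose image under `g` is `f ∈ I`, so the exponent `0`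
      -- works.
      refine (hg i n (substHom g⁻¹.val f) ((linSubst g⁻¹.val).map_mem hf)).mp ⟨0, ?_⟩
      rw [substHom_substHom _ _ g.inv_mul]
      simpa using hfI
    · rw [Ideal.mem_comap, mem_satIdeal, memSat_iff_substHom_X_mem _ _ g.inv_mul]
      intro i
      exact (hg i n f hf).mpr ⟨0, by simpa using hfJ⟩
  · rintro ⟨g, g', h1, h2, hI, hJ⟩
    refine ⟨⟨g, g', h1, h2⟩, fun i n a ha => ⟨?_, ?_⟩⟩
    · rintro ⟨N, hN⟩
      have h3 := hI _ hN
      simp only [map_mul, map_pow, substHom_substHom _ _ h1] at h3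
      obtain ⟨M, hM⟩ := h3 i
      exact ⟨M + N, by rwa [pow_add, mul_assoc]⟩
    · rintro ⟨N, hN⟩
      have h3 := hJ _ hN
      rw [memSat_iff_substHom_X_mem _ _ h2] at h3
      obtain ⟨M, hM⟩ := h3 i
      exact ⟨M + N, by simpa [pow_add, mul_assoc] using hM⟩
end Saturation
end ProjEquiv

namespace ProjEquiv
open MvPolynomial

/-! ### Tests which detect membership in a saturation. -/

section Duality
variable {σ K : Type} [Field K]

/-- The ideal `(x_i ^ (n + 1))_i`, described by the vanishing of coefficients. -/
def lowIdeal (σ K : Type) [CommRing K] (n : ℕ) : Ideal (MvPolynomial σ K) where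
  carrier := {h | ∀ γ : σ →₀ ℕ, (∀ i, γ i ≤ n) → coeff γ h = 0}
  zero_mem' := by simp
  add_mem' {a b} ha hb γ hγ := by rw [coeff_add, ha γ hγ, hb γ hγ, add_zero]
  smul_mem' c h hh γ hγ := by
    classical
    rw [smul_eq_mul, coeff_mul]
    refine Finset.sum_eq_zero fun x hx => ?_
    rw [hh x.2 fun i => le_trans ?_ (hγ i), mul_zero]
    have h1 := Finset.HasAntidiagonal.mem_antidiagonal.mp hx
    rw [← h1]
    simp

lemma X_pow_mem_lowIdeal {R : Type} [CommRing R] (n : ℕ) (i : σ) :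
    (X i : MvPolynomial σ R) ^ (n + 1) ∈ lowIdeal σ R n := by
  classical
  intro γ hγ
  rw [coeff_X_pow, if_neg]
  rintro rfl
  simpa using hγ i

lemma lowIdeal_le {R : Type} [CommRing R] {n : ℕ} {𝔞 : Ideal (MvPolynomial σ R)}
    (h𝔞 : ∀ i, (X i : MvPolynomial σ R) ^ (n + 1) ∈ 𝔞) : lowIdeal σ R n ≤ 𝔞 := by
  classical
  intro h hh
  rw [h.as_sum]
  refine 𝔞.sum_mem fun γ hγ => ?_
  obtain ⟨i, hi⟩ : ∃ i, n < γ i := by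
    by_contra hcon
    push Not at hcon
    exact mem_support_iff.mp hγ (hh γ hcon)
  have : monomial γ (coeff γ h) =
      monomial (γ - Finsupp.single i (n + 1)) (coeff γ h) * X i ^ (n + 1) := by
    rw [X_pow_eq_monomial, monomial_mul, mul_one, tsub_add_cancel_of_le]
    exact Finsupp.single_le_iff.mpr hi
  rw [this]
  exact 𝔞.mul_mem_left _ (h𝔞 i)

/-- The translation `f(x) ↦ f(p + x)`. -/
noncomputable def translate {R : Type} [CommRing R] (p : σ → R) :
    MvPolynomial σ R →ₐ[R] MvPolynomial σ R :=
  bind₁ fun i => C (p i) + X i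

lemma translate_X {R : Type} [CommRing R] (p : σ → R) (i : σ) :
    translate p (X i) = C (p i) + X i := bind₁_X_right _ _

lemma translate_neg_translate (p : σ → K) (f : MvPolynomial σ K) :
    translate (-p) (translate p f) = f := by
  suffices H : (translate (-p)).comp (translate p) = AlgHom.id K _ from DFunLike.congr_fun H f
  ext1 i
  simp [translate_X, algHom_C, algebraMap_eq]

/-- `Λ`, placed at the point `p`, annihilates `J` modulo `(x_i ^ (n + 1))_i`. -/
def IsTest (J : Ideal (MvPolynomial σ K)) (p : σ → K) (n : ℕ) (Λ : MvPolynomial σ K) : Prop :=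
  (∃ k, p k ≠ 0) ∧ ∀ f ∈ J, Λ * translate p f ∈ lowIdeal σ K n

/-- Translation turns `x_k` into `p_k + x_k` with `p_k ≠ 0`. This is a unit modulo the nilpotent
element `x_k`, so the powers of `x_k` allowed by saturation can be cancelled. -/
lemma IsTest.mul_translate_mem {J : Ideal (MvPolynomial σ K)} {p : σ → K} {n : ℕ}
    {Λ : MvPolynomial σ K} (h : IsTest J p n Λ) {f : MvPolynomial σ K} (hf : MemSat J f) :
    Λ * translate p f ∈ lowIdeal σ K n := by
  obtain ⟨⟨k, hk⟩, hJ⟩ := h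
  obtain ⟨N, hN⟩ := hf k
  have h1 := hJ _ hN
  rw [map_mul, map_pow, translate_X] at h1
  have hu : IsUnit (C (p k) : MvPolynomial σ K) := (isUnit_iff_ne_zero.mpr hk).map C
  have hco : IsCoprime ((X k : MvPolynomial σ K) ^ (n + 1)) ((C (p k) + X k) ^ N) := by
    refine IsCoprime.pow ?_
    obtain ⟨u, hu'⟩ := hu.exists_left_inv
    exact ⟨-u, u, by linear_combination hu'⟩
  obtain ⟨a, b, hab⟩ := hco
  have : Λ * translate p f = (a * Λ * translate p f) * X k ^ (n + 1) +
      b * (Λ * ((C (p k) + X k) ^ N * translate p f)) := by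
    linear_combination (-(Λ * translate p f)) * hab
  rw [this]
  exact Ideal.add_mem _ (Ideal.mul_mem_left _ _ (X_pow_mem_lowIdeal n k))
    (Ideal.mul_mem_left _ _ h1)

/-- The duality of the Gorenstein ring `K[x] / (x_i ^ (n + 1))_i`: an element outside an ideal is
separated from it by a multiplier. -/
lemma exists_multiplier [Finite σ] {n : ℕ} {𝔞 : Ideal (MvPolynomial σ K)}
    (h𝔞 : lowIdeal σ K n ≤ 𝔞) {f : MvPolynomial σ K} (hf : f ∉ 𝔞) :
    ∃ Λ : MvPolynomial σ K, (∀ h ∈ 𝔞, Λ * h ∈ lowIdeal σ K n) ∧ Λ * f ∉ lowIdeal σ K n := by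
  classical
  have := Fintype.ofFinite σ
  obtain ⟨l, hlf, hl⟩ := Submodule.exists_le_ker_of_notMem
    (p := 𝔞.restrictScalars K) (v := f) hf
  let N : σ →₀ ℕ := Finsupp.equivFunOnFinite.symm fun _ => n
  have hN : ∀ i, N i = n := fun _ => rfl
  -- `l` is a functional which kills `𝔞` but not `f`. The polynomial `Λ` represents it through the
  -- socle: the coefficient of `x ^ N` in `Λ * h` is `l h`. The general form is `key`.
  let Λ : MvPolynomial σ K := ∑ β ∈ Finset.Iic N, monomial (N - β) (l (monomial β 1))
  have hΛ : ∀ γ ≤ N, coeff γ Λ = l (monomial (N - γ) 1) := by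
    intro γ hγ
    simp only [Λ, coeff_sum, coeff_monomial]
    rw [Finset.sum_eq_single (N - γ)]
    · rw [if_pos (tsub_tsub_cancel_of_le hγ)]
    · intro β hβ hne
      rw [if_neg]
      rintro rfl
      exact hne (tsub_tsub_cancel_of_le (Finset.mem_Iic.mp hβ)).symm
    · intro hcon
      exact absurd (Finset.mem_Iic.mpr tsub_le_self) hcon
  have key : ∀ γ ≤ N, ∀ h, coeff γ (Λ * h) = l (monomial (N - γ) 1 * h) := by
    intro γ hγ h
    induction h using MvPolynomial.induction_on' with
    | monomial δ c =>
      rw [coeff_mul_monomial', monomial_mul, one_mul]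
      split_ifs with hδ
      · rw [hΛ _ (tsub_le_self.trans hγ)]
        have h1 : N - (γ - δ) = N - γ + δ := by
          ext i
          have := hγ i
          have := hδ i
          simp only [Finsupp.coe_tsub, Pi.sub_apply, Finsupp.coe_add, Pi.add_apply]
          omega
        have h2 : monomial (N - γ + δ) c = c • monomial (N - γ + δ) (1 : K) := by
          rw [smul_monomial, smul_eq_mul, mul_one]
        rw [h1, h2, map_smul, smul_eq_mul, mul_comm]
      -- If `δ ≤ γ` fails, some exponent of `N - γ + δ` exceeds `n`, so the monomial lies in
      -- `lowIdeal` and is killed by `l`; the coefficient on the left is zero.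
      · refine (LinearMap.mem_ker.mp (hl (h𝔞 ?_))).symm
        intro ε hε
        rw [coeff_monomial, if_neg]
        rintro rfl
        refine hδ fun i => ?_
        have := hε i
        have := hγ i
        simp only [Finsupp.coe_tsub, Pi.sub_apply, Finsupp.coe_add, Pi.add_apply, hN] at *
        omega
    | add a b ha hb => rw [mul_add, mul_add, coeff_add, map_add, ha, hb]
  refine ⟨Λ, fun h hh γ hγ => ?_, fun hcon => hlf ?_⟩
  · rw [key γ (fun i => hγ i)]
    exact hl (𝔞.mul_mem_left _ hh)
  · have h1 := hcon N fun i => le_rfl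
    rw [key N le_rfl, tsub_self] at h1
    simpa using h1

/-- Polynomials outside the saturation are detected by tests. -/
lemma exists_isTest [Finite σ] [IsAlgClosed K] {J : Ideal (MvPolynomial σ K)}
    {f : MvPolynomial σ K} (hf : ¬ MemSat J f) :
    ∃ (p : σ → K) (n : ℕ) (Λ : MvPolynomial σ K), IsTest J p n Λ ∧
      Λ * translate p f ∉ lowIdeal σ K n := by
  unfold MemSat at hf
  push Not at hf
  obtain ⟨k, hk⟩ := hf
  -- The annihilator of `f` modulo `J` after inverting `x_k`. It contains no power of `x_k`, so the
  -- Nullstellensatz gives a zero `p` of it with `p_k ≠ 0`.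
  let 𝔮 : Ideal (MvPolynomial σ K) :=
    { carrier := {a | ∃ N : ℕ, X k ^ N * (a * f) ∈ J}
      zero_mem' := ⟨0, by simp⟩
      add_mem' := by
        rintro a b ⟨N, hN⟩ ⟨M, hM⟩
        refine ⟨N + M, ?_⟩
        have : (X k : MvPolynomial σ K) ^ (N + M) * ((a + b) * f) =
          X k ^ M * (X k ^ N * (a * f)) + X k ^ N * (X k ^ M * (b * f)) := by ring
        rw [this]
        exact J.add_mem (J.mul_mem_left _ hN) (J.mul_mem_left _ hM)
      smul_mem' := by
        rintro c a ⟨N, hN⟩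
        refine ⟨N, ?_⟩
        rw [smul_eq_mul, mul_assoc, mul_left_comm]
        exact J.mul_mem_left _ hN }
  have hXk : X k ∉ 𝔮.radical := by
    rintro ⟨s, N, h⟩
    exact hk (N + s) (by rwa [pow_add, mul_assoc])
  rw [← vanishingIdeal_zeroLocus_eq_radical (K := K), mem_vanishingIdeal_iff] at hXk
  push Not at hXk
  obtain ⟨p, hp, hpk⟩ := hXk
  rw [aeval_X] at hpk
  let 𝔪 : Ideal (MvPolynomial σ K) := RingHom.ker (eval p)
  -- Otherwise Krull's intersection theorem gives `a ∈ 𝔪` with `(1 - a) * f ∈ J`. Then `1 - a` is in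
  -- `𝔮`, although its value at `p` is `1`.
  have hn : ∃ n, f ∉ J ⊔ 𝔪 ^ n := by
    by_contra hcon
    push Not at hcon
    have h1 : Ideal.Quotient.mk J f ∈ (⨅ i : ℕ, (𝔪.map (Ideal.Quotient.mk J)) ^ i •
        (⊤ : Submodule (MvPolynomial σ K ⧸ J) (MvPolynomial σ K ⧸ J))) := by
      rw [Submodule.mem_iInf]
      intro i
      rw [smul_eq_mul, Ideal.mul_top, ← Ideal.map_pow]
      have h2 := Ideal.mem_map_of_mem (Ideal.Quotient.mk J) (hcon i)
      rwa [Ideal.map_sup, Ideal.map_quotient_self, bot_sup_eq] at h2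
    obtain ⟨⟨r, hr⟩, hrf⟩ := (Ideal.mem_iInf_smul_pow_eq_bot_iff _ _).mp h1
    obtain ⟨a, ha, rfl⟩ := (Ideal.mem_map_iff_of_surjective _ Ideal.Quotient.mk_surjective).mp hr
    have h3 : (1 - a) ∈ 𝔮 := by
      refine ⟨0, ?_⟩
      rw [pow_zero, one_mul, ← Ideal.Quotient.eq_zero_iff_mem, map_mul, map_sub, map_one, sub_mul,
        one_mul, sub_eq_zero]
      exact hrf.symm
    have h4 := hp _ h3
    have h5 : eval p a = 0 := ha
    rw [aeval_eq_eval, map_sub, map_one] at h4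
    simp [h5] at h4
  obtain ⟨n, hn⟩ := hn
  -- The ideal moved from `p` to the origin, where it contains all `x_i ^ (n + 1)`.
  let 𝔞 := (J ⊔ 𝔪 ^ n).comap (translate (-p))
  have h1 : lowIdeal σ K n ≤ 𝔞 := by
    refine lowIdeal_le fun i => ?_
    rw [Ideal.mem_comap, map_pow, translate_X, pow_succ]
    refine Ideal.mul_mem_right _ _ (Ideal.mem_sup_right (Ideal.pow_mem_pow ?_ n))
    simp [𝔪, RingHom.mem_ker]
  have h2 : translate p f ∉ 𝔞 := by
    rwa [Ideal.mem_comap, translate_neg_translate]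
  obtain ⟨Λ, hΛ, hΛf⟩ := exists_multiplier h1 h2
  refine ⟨p, n, Λ, ⟨⟨k, hpk⟩, fun h hh => hΛ _ ?_⟩, hΛf⟩
  rw [Ideal.mem_comap, translate_neg_translate]
  exact Ideal.mem_sup_left hh
end Duality
end ProjEquiv

namespace ProjEquiv
open MvPolynomial

/-! ### Compositional forms of primitive recursiveness -/

attribute [fun_prop] Primrec

section PrimrecRules
variable {α β γ σ : Type} [Primcodable α] [Primcodable β] [Primcodable γ] [Primcodable σ]

@[fun_prop] theorem pr_id : Primrec (fun a : α => a) := Primrec.id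

@[fun_prop] theorem pr_const (c : σ) : Primrec (fun _ : α => c) := Primrec.const c

@[fun_prop] theorem pr_fst {f : α → β × γ} (hf : Primrec f) : Primrec (fun a => (f a).1) :=
  Primrec.fst.comp hf

@[fun_prop] theorem pr_snd {f : α → β × γ} (hf : Primrec f) : Primrec (fun a => (f a).2) :=
  Primrec.snd.comp hf

@[fun_prop] theorem pr_pair {f : α → β} {g : α → γ} (hf : Primrec f) (hg : Primrec g) :
    Primrec (fun a => (f a, g a)) := hf.pair hg

@[fun_prop] theorem pr_add {f g : α → ℕ} (hf : Primrec f) (hg : Primrec g) :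
    Primrec (fun a => f a + g a) := Primrec.nat_add.comp hf hg

@[fun_prop] theorem pr_mul {f g : α → ℕ} (hf : Primrec f) (hg : Primrec g) :
    Primrec (fun a => f a * g a) := Primrec.nat_mul.comp hf hg

@[fun_prop] theorem pr_max {f g : α → ℕ} (hf : Primrec f) (hg : Primrec g) :
    Primrec (fun a => max (f a) (g a)) := Primrec.nat_max.comp hf hg

@[fun_prop] theorem pr_natPair {f g : α → ℕ} (hf : Primrec f) (hg : Primrec g) :
    Primrec (fun a => Nat.pair (f a) (g a)) := Primrec₂.natPair.comp hf hg

@[fun_prop] theorem pr_and {f g : α → Bool} (hf : Primrec f) (hg : Primrec g) :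
    Primrec (fun a => f a && g a) := Primrec.and.comp hf hg

@[fun_prop] theorem pr_or {f g : α → Bool} (hf : Primrec f) (hg : Primrec g) :
    Primrec (fun a => f a || g a) := Primrec.or.comp hf hg

@[fun_prop] theorem pr_cond {c : α → Bool} {f g : α → σ} (hc : Primrec c) (hf : Primrec f)
    (hg : Primrec g) : Primrec (fun a => bif c a then f a else g a) := Primrec.cond hc hf hg

@[fun_prop] theorem pr_decide_eq [DecidableEq β] {f g : α → β} (hf : Primrec f)
    (hg : Primrec g) : Primrec (fun a => decide (f a = g a)) :=
  PrimrecPred.decide (Primrec.eq.comp hf hg)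

@[fun_prop] theorem pr_decide_lt {f g : α → ℕ} (hf : Primrec f)
    (hg : Primrec g) : Primrec (fun a => decide (f a < g a)) :=
  PrimrecPred.decide (Primrec.nat_lt.comp hf hg)

@[fun_prop] theorem pr_decide_le {f g : α → ℕ} (hf : Primrec f)
    (hg : Primrec g) : Primrec (fun a => decide (f a ≤ g a)) :=
  PrimrecPred.decide (Primrec.nat_le.comp hf hg)

@[fun_prop] theorem pr_cons {f : α → β} {g : α → List β} (hf : Primrec f) (hg : Primrec g) :
    Primrec (fun a => f a :: g a) := Primrec.list_cons.comp hf hg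

@[fun_prop] theorem pr_append {f g : α → List β} (hf : Primrec f) (hg : Primrec g) :
    Primrec (fun a => f a ++ g a) := Primrec.list_append.comp hf hg

@[fun_prop] theorem pr_flatten {f : α → List (List β)} (hf : Primrec f) :
    Primrec (fun a => (f a).flatten) := Primrec.list_flatten.comp hf

@[fun_prop] theorem pr_length {f : α → List β} (hf : Primrec f) :
    Primrec (fun a => (f a).length) := Primrec.list_length.comp hf

@[fun_prop] theorem pr_map {f : α → List β} {g : α → β → σ}
    (hg : Primrec (fun p : α × β => g p.1 p.2)) (hf : Primrec f) :
    Primrec (fun a => (f a).map (g a)) := Primrec.list_map hf hg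

@[fun_prop] theorem pr_flatMap {f : α → List β} {g : α → β → List σ} (hf : Primrec f)
    (hg : Primrec (fun p : α × β => g p.1 p.2)) :
    Primrec (fun a => (f a).flatMap (g a)) := Primrec.list_flatMap hf hg

@[fun_prop] theorem pr_range {f : α → ℕ} (hf : Primrec f) :
    Primrec (fun a => List.range (f a)) := Primrec.list_range.comp hf

@[fun_prop] theorem pr_getD {f : α → List β} {g : α → ℕ} {h : α → β} (hf : Primrec f)
    (hg : Primrec g) (hh : Primrec h) : Primrec (fun a => (f a).getD (g a) (h a)) := by
  simp only [List.getD_eq_getElem?_getD]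
  exact Primrec.option_getD.comp (Primrec.list_getElem?.comp hf hg) hh

@[fun_prop] theorem pr_foldr {f : α → List β} {g : α → σ} {h : α → β → σ → σ}
    (hh : Primrec (fun p : α × β × σ => h p.1 p.2.1 p.2.2)) (hg : Primrec g) (hf : Primrec f) :
    Primrec (fun a => (f a).foldr (h a) (g a)) :=
  Primrec.list_foldr (h := fun a p => h a p.1 p.2) hf hg hh

/-- Boolean bounded quantification over the members of a list. -/
def lall {β : Type} (l : List β) (p : β → Bool) : Bool := l.foldr (fun b acc => p b && acc) true

lemma lall_iff {β : Type} (l : List β) (p : β → Bool) : lall l p = true ↔ ∀ b ∈ l, p b = true := by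
  induction l with
  | nil => simp [lall]
  | cons a l ih =>
    have : lall (a :: l) p = (p a && lall l p) := rfl
    simp [this, ih]

@[fun_prop] theorem pr_lall {f : α → List β} {g : α → β → Bool} (hf : Primrec f)
    (hg : Primrec (fun p : α × β => g p.1 p.2)) : Primrec (fun a => lall (f a) (g a)) := by
  unfold lall
  have h : Primrec (fun p : α × β × Bool => g p.1 p.2.1 && p.2.2) :=
    Primrec.and.comp (hg.comp (Primrec.fst.pair (Primrec.fst.comp Primrec.snd)))
      (Primrec.snd.comp Primrec.snd)
  exact pr_foldr h (Primrec.const true) hf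

end PrimrecRules

/-! ### Codes of rational numbers -/

/-- The code `(a, b, c)` stands for the rational number `(a - b) / (c + 1)`. -/
abbrev RatCode : Type := ℕ × ℕ × ℕ

def toQ (x : RatCode) : ℚ := ((x.1 : ℚ) - x.2.1) / (x.2.2 + 1)

/-- The last entry is the denominator minus one: `(c + 1) * (c' + 1) = (c * c' + c + c') + 1`. Codes
are not reduced; a rational number has many of them. -/
def qadd (x y : RatCode) : RatCode :=
  (x.1 * (y.2.2 + 1) + y.1 * (x.2.2 + 1), x.2.1 * (y.2.2 + 1) + y.2.1 * (x.2.2 + 1),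
    x.2.2 * y.2.2 + x.2.2 + y.2.2)

def qmul (x y : RatCode) : RatCode :=
  (x.1 * y.1 + x.2.1 * y.2.1, x.1 * y.2.1 + x.2.1 * y.1, x.2.2 * y.2.2 + x.2.2 + y.2.2)

def qneg (x : RatCode) : RatCode := (x.2.1, x.1, x.2.2)

def qnat (n : ℕ) : RatCode := (n, 0, 0)

lemma toQ_qadd (x y : RatCode) : toQ (qadd x y) = toQ x + toQ y := by
  have h1 : (x.2.2 : ℚ) + 1 ≠ 0 := by positivity
  have h2 : (y.2.2 : ℚ) + 1 ≠ 0 := by positivity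
  have h3 : ((x.2.2 * y.2.2 + x.2.2 + y.2.2 : ℕ) : ℚ) + 1 = (x.2.2 + 1) * (y.2.2 + 1) := by
    push_cast; ring
  simp only [toQ, qadd, h3]
  push_cast
  field_simp
  ring

lemma toQ_qmul (x y : RatCode) : toQ (qmul x y) = toQ x * toQ y := by
  have h1 : (x.2.2 : ℚ) + 1 ≠ 0 := by positivity
  have h2 : (y.2.2 : ℚ) + 1 ≠ 0 := by positivity
  have h3 : ((x.2.2 * y.2.2 + x.2.2 + y.2.2 : ℕ) : ℚ) + 1 = (x.2.2 + 1) * (y.2.2 + 1) := by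
    push_cast; ring
  simp only [toQ, qmul, h3]
  push_cast
  field_simp
  ring

lemma toQ_qneg (x : RatCode) : toQ (qneg x) = - toQ x := by
  simp only [toQ, qneg]
  ring

lemma toQ_qnat (n : ℕ) : toQ (qnat n) = n := by simp [toQ, qnat]

lemma toQ_surjective : Function.Surjective toQ := by
  intro q
  refine ⟨(q.num.toNat, (-q.num).toNat, q.den - 1), ?_⟩
  have h1 : ((q.den - 1 : ℕ) : ℚ) + 1 = q.den := by
    have := q.den_pos
    rw [Nat.cast_sub (by omega)]
    simp
  have h2 : ((q.num.toNat : ℤ) - ((-q.num).toNat : ℤ)) = q.num := by omega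
  have h3 : ((q.num.toNat : ℚ) - ((-q.num).toNat : ℚ)) = q.num := by exact_mod_cast h2
  simp only [toQ, h1, h3]
  exact q.num_div_den

lemma toQ_eq_zero_iff (x : RatCode) : toQ x = 0 ↔ x.1 = x.2.1 := by
  have h1 : (x.2.2 : ℚ) + 1 ≠ 0 := by positivity
  simp [toQ, h1, sub_eq_zero]

lemma toQ_neg_iff (x : RatCode) : toQ x < 0 ↔ x.1 < x.2.1 := by
  have h1 : (0 : ℚ) < (x.2.2 : ℚ) + 1 := by positivity
  simp [toQ, div_neg_iff, h1, h1.not_gt]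

/-- The code of an integer. -/
def qint (z : ℤ) : RatCode := (z.toNat, (-z).toNat, 0)

lemma toQ_qint (z : ℤ) : toQ (qint z) = z := by
  have h2 : ((z.toNat : ℤ) - ((-z).toNat : ℤ)) = z := by omega
  have h3 : ((z.toNat : ℚ) - ((-z).toNat : ℚ)) = z := by exact_mod_cast h2
  simp [toQ, qint, h3]

lemma primrec_qint : Primrec qint := by
  -- The numerical code of an integer is `2 * m` for `m` and `2 * m + 1` for `-m - 1`, so parity
  -- decides the sign.
  have h : Primrec (fun n : ℕ =>
      bif n.bodd then ((0, n.div2 + 1, 0) : RatCode) else (n.div2, 0, 0)) :=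
    Primrec.cond Primrec.nat_bodd
      ((Primrec.const 0).pair ((Primrec.succ.comp Primrec.nat_div2).pair (Primrec.const 0)))
      (Primrec.nat_div2.pair (Primrec.const _))
  refine (h.comp (Primrec.encode (α := ℤ))).of_eq fun z => ?_
  cases z with
  | ofNat m =>
    have h1 : Encodable.encode (Int.ofNat m) = 2 * m := rfl
    rw [h1]
    simp [qint]
  | negSucc m =>
    have h1 : Encodable.encode (Int.negSucc m) = 2 * m + 1 := rfl
    rw [h1]
    simp [qint, Nat.div2_val]

section
variable {α : Type} [Primcodable α]

@[fun_prop] theorem pr_qint {f : α → ℤ} (hf : Primrec f) : Primrec (fun a => qint (f a)) :=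
  primrec_qint.comp hf

-- As in the later rules of this kind, the operation is treated as a function of one tuple, where
-- unfolding leaves projections only, and is then composed with the arguments.
@[fun_prop] theorem pr_qadd {f g : α → RatCode} (hf : Primrec f) (hg : Primrec g) :
    Primrec (fun a => qadd (f a) (g a)) := by
  have h : Primrec (fun p : RatCode × RatCode => qadd p.1 p.2) := by unfold qadd; fun_prop
  exact h.comp (hf.pair hg)

@[fun_prop] theorem pr_qmul {f g : α → RatCode} (hf : Primrec f) (hg : Primrec g) :
    Primrec (fun a => qmul (f a) (g a)) := by
  have h : Primrec (fun p : RatCode × RatCode => qmul p.1 p.2) := by unfold qmul; fun_prop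
  exact h.comp (hf.pair hg)

@[fun_prop] theorem pr_qneg {f : α → RatCode} (hf : Primrec f) :
    Primrec (fun a => qneg (f a)) := by
  unfold qneg; fun_prop

@[fun_prop] theorem pr_qnat {f : α → ℕ} (hf : Primrec f) :
    Primrec (fun a => qnat (f a)) := by
  unfold qnat; fun_prop
end

/-! ### Codes of polynomials -/

/-- Codes of polynomials with rational coefficients in the variables `0, 1, 2, …`: lists of terms,
each with a coefficient and a list of exponents. -/
abbrev MPoly : Type := List (RatCode × List ℕ)

/-- The exponents of a monomial code. -/
def monO (l : List ℕ) : ℕ →₀ ℕ := l.toFinsupp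

lemma monO_apply (l : List ℕ) (i : ℕ) : monO l i = l.getD i 0 := rfl

noncomputable def sem (p : MPoly) : MvPolynomial ℕ ℚ :=
  (p.map fun t => monomial (monO t.2) (toQ t.1)).sum

lemma sem_nil : sem [] = 0 := rfl

lemma sem_cons (t : RatCode × List ℕ) (p : MPoly) :
    sem (t :: p) = monomial (monO t.2) (toQ t.1) + sem p := by
  simp [sem]

lemma sem_append (p q : MPoly) : sem (p ++ q) = sem p + sem q := by
  simp [sem]

def mmul (l m : List ℕ) : List ℕ :=
  (List.range (max l.length m.length)).map fun i => l.getD i 0 + m.getD i 0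

lemma monO_mmul (l m : List ℕ) : monO (mmul l m) = monO l + monO m := by
  ext i
  rw [Finsupp.add_apply, monO_apply, monO_apply, monO_apply]
  by_cases hi : i < max l.length m.length
  · simp [mmul, List.getD_eq_getElem?_getD, hi]
  · have h1 : l.length ≤ i := by omega
    have h2 : m.length ≤ i := by omega
    rw [List.getD_eq_default _ _ (by simpa [mmul] using ⟨h1, h2⟩), List.getD_eq_default _ _ h1,
      List.getD_eq_default _ _ h2]

/-- Equality of monomials: comparison after padding. -/
def meq (l m : List ℕ) : Bool :=
  decide (mmul l (m.map fun _ => 0) = mmul m (l.map fun _ => 0))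

lemma meq_iff (l m : List ℕ) : meq l m = true ↔ monO l = monO m := by
  have h0 (l : List ℕ) : monO (l.map fun _ => 0) = 0 := by
    ext i
    rw [monO_apply]
    simp [List.getD_eq_getElem?_getD]
  rw [meq, decide_eq_true_iff]
  constructor
  · intro h
    have := congrArg monO h
    rwa [monO_mmul, monO_mmul, h0, h0, add_zero, add_zero] at this
  · intro h
    have h1 : ∀ i, l.getD i 0 = m.getD i 0 := fun i => DFunLike.congr_fun h i
    refine List.ext_getElem (by simp [mmul, max_comm]) fun i hi hi' => ?_
    simp only [mmul, List.length_map, List.length_range] at hi hi'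
    have h2 : ∀ l : List ℕ, (l.map fun _ => 0).getD i 0 = 0 := fun l => by
      have := DFunLike.congr_fun (h0 l) i
      rwa [monO_apply] at this
    simp only [mmul, List.getElem_map, List.getElem_range, h2, add_zero]
    exact h1 i

def pneg (p : MPoly) : MPoly := p.map fun t => (qneg t.1, t.2)

def psub (p q : MPoly) : MPoly := p ++ pneg q

def pmul (p q : MPoly) : MPoly := p.flatMap fun s => q.map fun t => (qmul s.1 t.1, mmul s.2 t.2)

def pconst (c : RatCode) : MPoly := [(c, [])]

def pvar (i : ℕ) : MPoly := [(qnat 1, (List.range i).map (fun _ => 0) ++ [1])]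

def pprod (l : List MPoly) : MPoly := l.foldr pmul (pconst (qnat 1))

def ppow (p : MPoly) (n : ℕ) : MPoly := pprod ((List.range n).map fun _ => p)

def psum (l : List MPoly) : MPoly := l.flatten

/-- The coefficient of a monomial. -/
def pcoeff (p : MPoly) (m : List ℕ) : RatCode :=
  p.foldr (fun t acc => bif meq t.2 m then qadd t.1 acc else acc) (qnat 0)

/-- Terms with the same monomial may be repeated, so total coefficients are compared with zero. Only
monomials which occur in the list matter. -/
def isZero (p : MPoly) : Bool :=
  lall p fun t => decide ((pcoeff p t.2).1 = (pcoeff p t.2).2.1)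

lemma sem_pneg (p : MPoly) : sem (pneg p) = - sem p := by
  induction p with
  | nil => simp [pneg, sem]
  | cons t p ih =>
    have : pneg (t :: p) = (qneg t.1, t.2) :: pneg p := rfl
    rw [this, sem_cons, sem_cons, ih, toQ_qneg, map_neg]
    ring

lemma sem_psub (p q : MPoly) : sem (psub p q) = sem p - sem q := by
  rw [psub, sem_append, sem_pneg, sub_eq_add_neg]

lemma sem_pmul (p q : MPoly) : sem (pmul p q) = sem p * sem q := by
  have h (s : RatCode × List ℕ) : sem (q.map fun t => (qmul s.1 t.1, mmul s.2 t.2)) =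
      monomial (monO s.2) (toQ s.1) * sem q := by
    induction q with
    | nil => simp [sem]
    | cons t q ih =>
      rw [List.map_cons, sem_cons, sem_cons, ih, toQ_qmul, monO_mmul, mul_add, monomial_mul]
  induction p with
  | nil => simp [pmul, sem]
  | cons s p ih =>
    have : pmul (s :: p) q = (q.map fun t => (qmul s.1 t.1, mmul s.2 t.2)) ++ pmul p q := rfl
    rw [this, sem_append, ih, h, sem_cons, add_mul]

lemma sem_pconst (c : RatCode) : sem (pconst c) = C (toQ c) := by
  have h : monO [] = 0 := by ext i; simp [monO_apply]
  rw [pconst, sem_cons, sem_nil, add_zero, h]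
  rfl

lemma sem_pvar (i : ℕ) : sem (pvar i) = X i := by
  have h : monO ((List.range i).map (fun _ => 0) ++ [1]) = Finsupp.single i 1 := by
    ext j
    rw [monO_apply, Finsupp.single_apply, List.getD_eq_getElem?_getD]
    rcases lt_trichotomy j i with hj | hj | hj
    · rw [List.getElem?_append_left (by simpa using hj), if_neg (by omega)]
      simp [hj]
    · subst hj
      rw [List.getElem?_append_right (by simp)]
      simp
    · rw [List.getElem?_append_right (by simp; omega), if_neg (by omega), List.getElem?_eq_none]
      · rfl
      · simp; omega
  rw [pvar, sem_cons, sem_nil, add_zero, h, toQ_qnat, Nat.cast_one]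
  rfl

lemma sem_pprod (l : List MPoly) : sem (pprod l) = (l.map sem).prod := by
  induction l with
  | nil => simp [pprod, sem_pconst, toQ_qnat]
  | cons a l ih =>
    have : pprod (a :: l) = pmul a (pprod l) := rfl
    rw [this, sem_pmul, ih, List.map_cons, List.prod_cons]

lemma sem_ppow (p : MPoly) (n : ℕ) : sem (ppow p n) = sem p ^ n := by
  rw [ppow, sem_pprod, List.map_map]
  have : (sem ∘ fun _ : ℕ => p) = fun _ => sem p := rfl
  rw [this, List.map_const', List.prod_replicate, List.length_range]

lemma sem_psum (l : List MPoly) : sem (psum l) = (l.map sem).sum := by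
  induction l with
  | nil => simp [psum, sem_nil]
  | cons a l ih =>
    have : psum (a :: l) = a ++ psum l := rfl
    rw [this, sem_append, ih, List.map_cons, List.sum_cons]

lemma toQ_pcoeff (p : MPoly) (m : List ℕ) : toQ (pcoeff p m) = coeff (monO m) (sem p) := by
  induction p with
  | nil => simp [pcoeff, toQ_qnat, sem_nil]
  | cons t p ih =>
    have : pcoeff (t :: p) m = bif meq t.2 m then qadd t.1 (pcoeff p m) else pcoeff p m := rfl
    rw [this, sem_cons, coeff_add, coeff_monomial, ← ih]
    by_cases h : monO t.2 = monO m
    · rw [(meq_iff _ _).mpr h, if_pos h]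
      exact toQ_qadd _ _
    · rw [Bool.eq_false_iff.mpr fun h' => h ((meq_iff _ _).mp h'), if_neg h, zero_add]
      rfl

lemma isZero_iff (p : MPoly) : isZero p = true ↔ sem p = 0 := by
  simp only [isZero, lall_iff, decide_eq_true_iff, ← toQ_eq_zero_iff, toQ_pcoeff]
  constructor
  · intro h
    ext m
    by_contra hm
    rw [coeff_zero] at hm
    obtain ⟨t, ht, rfl⟩ : ∃ t ∈ p, monO t.2 = m := by
      by_contra hcon
      push Not at hcon
      apply hm
      clear h hm
      induction p with
      | nil => simp [sem_nil]
      | cons t p ih =>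
        rw [sem_cons, coeff_add, coeff_monomial, if_neg (hcon t (by simp)), zero_add]
        exact ih fun t ht => hcon t (by simp [ht])
    exact hm (h t ht)
  · intro h t _
    rw [h, coeff_zero]

lemma sem_surjective : Function.Surjective sem := by
  intro f
  induction f using MvPolynomial.induction_on with
  | C a =>
    obtain ⟨c, rfl⟩ := toQ_surjective a
    exact ⟨pconst c, sem_pconst c⟩
  | add p q hp hq =>
    obtain ⟨p', rfl⟩ := hp
    obtain ⟨q', rfl⟩ := hq
    exact ⟨p' ++ q', sem_append _ _⟩
  | mul_X p i hp =>
    obtain ⟨p', rfl⟩ := hp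
    exact ⟨pmul p' (pvar i), by rw [sem_pmul, sem_pvar]⟩

section
variable {α : Type} [Primcodable α]

@[fun_prop] theorem pr_mmul {f g : α → List ℕ} (hf : Primrec f) (hg : Primrec g) :
    Primrec (fun a => mmul (f a) (g a)) := by
  have h : Primrec (fun p : List ℕ × List ℕ => mmul p.1 p.2) := by unfold mmul; fun_prop
  exact h.comp (hf.pair hg)

@[fun_prop] theorem pr_meq {f g : α → List ℕ} (hf : Primrec f) (hg : Primrec g) :
    Primrec (fun a => meq (f a) (g a)) := by
  have h : Primrec (fun p : List ℕ × List ℕ => meq p.1 p.2) := by unfold meq; fun_prop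
  exact h.comp (hf.pair hg)

@[fun_prop] theorem pr_psub {f g : α → MPoly} (hf : Primrec f) (hg : Primrec g) :
    Primrec (fun a => psub (f a) (g a)) := by
  have h : Primrec (fun p : MPoly × MPoly => psub p.1 p.2) := by unfold psub pneg; fun_prop
  exact h.comp (hf.pair hg)

@[fun_prop] theorem pr_pmul {f g : α → MPoly} (hf : Primrec f) (hg : Primrec g) :
    Primrec (fun a => pmul (f a) (g a)) := by
  have h : Primrec (fun p : MPoly × MPoly => pmul p.1 p.2) := by unfold pmul; fun_prop
  exact h.comp (hf.pair hg)

@[fun_prop] theorem pr_pconst {f : α → RatCode} (hf : Primrec f) :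
    Primrec (fun a => pconst (f a)) := by
  have h : Primrec (fun p : RatCode => pconst p) := by unfold pconst; fun_prop
  exact h.comp hf

@[fun_prop] theorem pr_pvar {f : α → ℕ} (hf : Primrec f) : Primrec (fun a => pvar (f a)) := by
  have h : Primrec (fun p : ℕ => pvar p) := by unfold pvar; fun_prop
  exact h.comp hf

@[fun_prop] theorem pr_pprod {f : α → List MPoly} (hf : Primrec f) :
    Primrec (fun a => pprod (f a)) := by
  have h : Primrec (fun p : List MPoly => pprod p) := by unfold pprod; fun_prop
  exact h.comp hf

@[fun_prop] theorem pr_ppow {f : α → MPoly} {g : α → ℕ} (hf : Primrec f) (hg : Primrec g) :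
    Primrec (fun a => ppow (f a) (g a)) := by
  have h : Primrec (fun p : MPoly × ℕ => ppow p.1 p.2) := by unfold ppow; fun_prop
  exact h.comp (hf.pair hg)

@[fun_prop] theorem pr_psum {f : α → List MPoly} (hf : Primrec f) :
    Primrec (fun a => psum (f a)) := by
  unfold psum; fun_prop

@[fun_prop] theorem pr_isZero {f : α → MPoly} (hf : Primrec f) :
    Primrec (fun a => isZero (f a)) := by
  have h1 : Primrec (fun p : MPoly × List ℕ => pcoeff p.1 p.2) := by unfold pcoeff; fun_prop
  have h2 : Primrec (fun p : MPoly × (RatCode × List ℕ) => pcoeff p.1 p.2.2) :=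
    h1.comp (Primrec.fst.pair (Primrec.snd.comp Primrec.snd))
  have h : Primrec (fun p : MPoly => isZero p) := by unfold isZero; fun_prop
  exact h.comp hf

end
end ProjEquiv

namespace ProjEquiv
open MvPolynomial

/-! ### Number fields inside the algebraic numbers -/

/-- The imaginary unit as an algebraic number. -/
noncomputable def imUnit : QBar :=
  ⟨Complex.I, mem_algebraicClosure_iff.mpr
    ⟨Polynomial.X ^ 2 + 1, by
      intro h
      have := congrArg (Polynomial.eval 0) h
      simp at this, by simp⟩⟩

lemma coe_imUnit : (imUnit : ℂ) = Complex.I := rfl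

lemma imUnit_sq : imUnit ^ 2 = -1 := by
  apply Subtype.ext
  simp [coe_imUnit]

/-- Algebraic numbers which are real. -/
def IsRealAlg (z : QBar) : Prop := ((z : ℂ)).im = 0

lemma IsRealAlg.aeval {θ : QBar} (h : IsRealAlg θ) (f : Polynomial ℚ) :
    IsRealAlg (Polynomial.aeval θ f) := by
  have h1 : (θ : ℂ) = (((θ : ℂ).re : ℝ) : ℂ) := Complex.ext rfl (by simpa [IsRealAlg] using h)
  have h2 : ((Polynomial.aeval θ f : QBar) : ℂ) = Polynomial.aeval (θ : ℂ) f :=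
    (Polynomial.aeval_algebraMap_apply ℂ θ f).symm
  have h3 : Polynomial.aeval (((θ : ℂ).re : ℝ) : ℂ) f =
      ((Polynomial.aeval ((θ : ℂ).re) f : ℝ) : ℂ) :=
    Polynomial.aeval_algebraMap_apply ℂ ((θ : ℂ).re) f
  rw [IsRealAlg, h2, h1, h3, Complex.ofReal_im]

lemma add_imUnit_mul_eq_zero {a b : QBar} (ha : IsRealAlg a) (hb : IsRealAlg b)
    (h : a + imUnit * b = 0) : a = 0 ∧ b = 0 := by
  have h1 : (a : ℂ) + Complex.I * (b : ℂ) = 0 := congrArg Subtype.val h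
  have h2 := congrArg Complex.re h1
  have h3 := congrArg Complex.im h1
  simp only [Complex.add_re, Complex.mul_re, Complex.I_re, Complex.I_im, Complex.add_im,
    Complex.mul_im, Complex.zero_re, Complex.zero_im, IsRealAlg] at h2 h3 ha hb
  constructor
  · exact Subtype.ext (Complex.ext (by simpa [hb] using h2) (by simpa using ha))
  · exact Subtype.ext (Complex.ext (by simpa [ha] using h3) (by simpa using hb))

/-- Evaluation of the variable `0` at `θ` and of the variable `1` at the imaginary unit; the other
variables are shifted. -/
noncomputable def specialize (θ : QBar) : MvPolynomial ℕ ℚ →ₐ[ℚ] MvPolynomial ℕ QBar :=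
  aeval fun n => match n with
    | 0 => C θ
    | 1 => C imUnit
    | n + 2 => X n

/-! ### The relations between `θ` and the imaginary unit. -/

section Kernel
variable (θ : QBar)

noncomputable def evalPair : Polynomial (Polynomial ℚ) →+* QBar :=
  Polynomial.eval₂RingHom (Polynomial.aeval θ : Polynomial ℚ →ₐ[ℚ] QBar).toRingHom imUnit

/-- Division by `i ^ 2 + 1` leaves a remainder `α + β i`. Since `θ` is real, `α(θ)` and `β(θ)`
vanish separately, and `h` divides both. -/
lemma mem_span_of_evalPair_eq_zero {h : Polynomial ℚ} (hθ : IsRealAlg θ)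
    (hmin : ∀ f : Polynomial ℚ, Polynomial.aeval θ f = 0 → h ∣ f)
    {q : Polynomial (Polynomial ℚ)} (hq : evalPair θ q = 0) :
    q ∈ Ideal.span {Polynomial.C h, Polynomial.X ^ 2 + 1} := by
  let m : Polynomial (Polynomial ℚ) := Polynomial.X ^ 2 + 1
  have hm : m.Monic := by
    have : m = Polynomial.X ^ 2 + Polynomial.C 1 := by simp [m]
    rw [this]
    exact Polynomial.monic_X_pow_add_C _ two_ne_zero
  have hdeg : m.natDegree = 2 := by
    have : m = Polynomial.X ^ 2 + Polynomial.C 1 := by simp [m]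
    rw [this, Polynomial.natDegree_X_pow_add_C]
  have h1 := Polynomial.modByMonic_add_div q m
  have h2 : (q %ₘ m).natDegree ≤ 1 := by
    have := Polynomial.natDegree_modByMonic_lt q hm (by
      intro h; rw [h] at hdeg; simp at hdeg)
    omega
  obtain ⟨β, α, hαβ⟩ := Polynomial.exists_eq_X_add_C_of_natDegree_le_one h2
  have h3 : evalPair θ m = 0 := by
    simp [evalPair, m, imUnit_sq]
  have h4 : Polynomial.aeval θ α + imUnit * Polynomial.aeval θ β = 0 := by
    rw [← h1, map_add, map_mul, h3, zero_mul, add_zero, hαβ] at hq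
    simp only [evalPair, map_add, map_mul, Polynomial.coe_eval₂RingHom, Polynomial.eval₂_C,
      Polynomial.eval₂_X] at hq
    rw [← hq]
    change _ = (Polynomial.aeval θ) β * imUnit + (Polynomial.aeval θ) α
    ring
  obtain ⟨h5, h6⟩ := add_imUnit_mul_eq_zero (hθ.aeval α) (hθ.aeval β) h4
  obtain ⟨a, rfl⟩ := hmin _ h5
  obtain ⟨b, rfl⟩ := hmin _ h6
  rw [Ideal.mem_span_pair]
  refine ⟨Polynomial.C b * Polynomial.X + Polynomial.C a, q /ₘ m, ?_⟩
  conv_rhs => rw [← h1, hαβ]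
  simp only [map_mul, m]
  ring

/-- Regarded as a polynomial in the free variables with coefficients in `ℚ[θ][i]`, `F` is
specialized coefficient by coefficient, and the previous lemma applies to each coefficient. -/
lemma mem_span_of_specialize_eq_zero {h : Polynomial ℚ} (hθ : IsRealAlg θ)
    (hmin : ∀ f : Polynomial ℚ, Polynomial.aeval θ f = 0 → h ∣ f)
    {F : MvPolynomial ℕ ℚ} (hF : specialize θ F = 0) :
    F ∈ Ideal.span {Polynomial.aeval (X 0 : MvPolynomial ℕ ℚ) h, X 1 ^ 2 + 1} := by
  let τ : MvPolynomial ℕ ℚ →ₐ[ℚ] MvPolynomial ℕ (Polynomial (Polynomial ℚ)) :=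
    aeval fun n => match n with
      | 0 => C (Polynomial.C Polynomial.X)
      | 1 => C Polynomial.X
      | n + 2 => X n
  let κ : Polynomial (Polynomial ℚ) →+* MvPolynomial ℕ ℚ :=
    Polynomial.eval₂RingHom
      (Polynomial.aeval (X 0 : MvPolynomial ℕ ℚ) : Polynomial ℚ →ₐ[ℚ] _).toRingHom (X 1)
  let ρ : MvPolynomial ℕ (Polynomial (Polynomial ℚ)) →+* MvPolynomial ℕ ℚ :=
    eval₂Hom κ fun n => X (n + 2)
  -- `ρ` undoes the regrouping `τ`. On constants there is nothing to compute, because ring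
  -- homomorphisms out of `ℚ` are unique.
  have h1 : ρ.comp τ.toRingHom = RingHom.id _ := by
    refine MvPolynomial.ringHom_ext (fun c => ?_) fun n => ?_
    · exact congr($(Subsingleton.elim ((ρ.comp τ.toRingHom).comp C) C) c)
    · rcases n with _ | _ | n
      · simp [ρ, τ, κ]
      · simp [ρ, τ, κ]
      · simp [ρ, τ]
  have h2 : (map (evalPair θ)).comp τ.toRingHom = (specialize θ).toRingHom := by
    refine MvPolynomial.ringHom_ext (fun c => ?_) fun n => ?_
    · exact congr($(Subsingleton.elim (((map (evalPair θ)).comp τ.toRingHom).comp C)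
        ((specialize θ).toRingHom.comp C)) c)
    · rcases n with _ | _ | n
      · simp [τ, evalPair, specialize]
      · simp [τ, evalPair, specialize]
      · simp [τ, specialize]
  have h3 : map (evalPair θ) (τ F) = 0 := by
    rw [← hF]
    exact congr($h2 F)
  have h4 : τ F ∈ (Ideal.span {Polynomial.C h, Polynomial.X ^ 2 + 1}).map
      (C : Polynomial (Polynomial ℚ) →+* MvPolynomial ℕ (Polynomial (Polynomial ℚ))) := by
    rw [mem_map_C_iff]
    intro m
    refine mem_span_of_evalPair_eq_zero θ hθ hmin ?_
    rw [← coeff_map, h3, coeff_zero]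
  have h5 := Ideal.mem_map_of_mem ρ h4
  have h6 : ρ (τ F) = F := congr($h1 F)
  have h7 : ρ.comp C = κ := by ext <;> simp [ρ]
  rw [h6, Ideal.map_map, h7, Ideal.map_span, Set.image_pair] at h5
  simpa [κ] using h5
end Kernel

/-! ### Real primitive elements and changes of sign. -/

section PrimitiveElement

lemma isAlgebraic_re_im (z : QBar) :
    IsAlgebraic ℚ ((z : ℂ).re) ∧ IsAlgebraic ℚ ((z : ℂ).im) := by
  have hz : IsAlgebraic ℚ (z : ℂ) := mem_algebraicClosure_iff.mp z.2
  have hc : IsAlgebraic ℚ ((starRingEnd ℂ) (z : ℂ)) :=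
    hz.algHom (Complex.conjAe.toAlgHom.restrictScalars ℚ)
  have hI : IsAlgebraic ℚ Complex.I := mem_algebraicClosure_iff.mp imUnit.2
  have h2 : IsAlgebraic ℚ (2⁻¹ : ℂ) := by
    have := isAlgebraic_algebraMap (R := ℚ) (A := ℂ) (2⁻¹)
    simpa using this
  have hre : IsAlgebraic ℚ (((z : ℂ).re : ℝ) : ℂ) := by
    have : (((z : ℂ).re : ℝ) : ℂ) = 2⁻¹ * ((z : ℂ) + (starRingEnd ℂ) (z : ℂ)) := by
      rw [Complex.add_conj]; push_cast; ring
    rw [this]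
    exact h2.mul (hz.add hc)
  have him : IsAlgebraic ℚ (((z : ℂ).im : ℝ) : ℂ) := by
    have : (((z : ℂ).im : ℝ) : ℂ) = 2⁻¹ * ((starRingEnd ℂ) (z : ℂ) - (z : ℂ)) * Complex.I := by
      have := Complex.sub_conj (z : ℂ)
      rw [← neg_sub (z : ℂ), this]
      push_cast
      linear_combination (((z : ℂ).im : ℝ) : ℂ) * Complex.I_mul_I
    rw [this]
    exact (h2.mul (hc.sub hz)).mul hI
  exact ⟨(isAlgebraic_algebraMap_iff (algebraMap ℝ ℂ).injective).mp hre,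
    (isAlgebraic_algebraMap_iff (algebraMap ℝ ℂ).injective).mp him⟩

/-- A simple real root of a rational polynomial is surrounded by a sign change. -/
lemma exists_eval_neg_pos {f : Polynomial ℚ} {t : ℝ} (ht : Polynomial.aeval t f = 0)
    (ht' : Polynomial.aeval t f.derivative ≠ 0) :
    (∃ a : ℚ, f.eval a < 0) ∧ ∃ b : ℚ, 0 < f.eval b := by
  have key (f : Polynomial ℚ) (ht : Polynomial.aeval t f = 0)
      (ht' : Polynomial.aeval t f.derivative ≠ 0) : ∃ a : ℚ, f.eval a < 0 := by
    -- If `f` were nonnegative at all rational points, it would be so on `ℝ` by density. Then the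
    -- root `t` would be a minimum and the derivative would vanish there.
    by_contra hcon
    push Not at hcon
    have h1 : ∀ x : ℝ, 0 ≤ Polynomial.aeval x f := by
      have hcl : IsClosed {x : ℝ | 0 ≤ Polynomial.aeval x f} :=
        isClosed_le continuous_const (Polynomial.continuous_aeval f)
      have hd : Dense {x : ℝ | 0 ≤ Polynomial.aeval x f} := by
        refine Rat.denseRange_cast.mono ?_
        rintro _ ⟨q, rfl⟩
        have h2 : Polynomial.aeval (q : ℝ) f = ((f.eval q : ℚ) : ℝ) :=
          Polynomial.aeval_algebraMap_apply_eq_algebraMap_eval q f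
        rw [Set.mem_ofPred_eq, h2]
        exact_mod_cast hcon q
      intro x
      have h3 : x ∈ closure {x : ℝ | 0 ≤ Polynomial.aeval x f} := hd x
      rwa [hcl.closure_eq] at h3
    have hmin : IsLocalMin (fun x : ℝ => Polynomial.aeval x f) t := by
      filter_upwards with x
      rw [ht]
      exact h1 x
    exact ht' (hmin.hasDerivAt_eq_zero (Polynomial.hasDerivAt_aeval f t))
  refine ⟨key f ht ht', ?_⟩
  obtain ⟨b, hb⟩ := key (-f) (by simp [ht]) (by simpa using ht')
  exact ⟨b, by simpa using hb⟩

/-- Finitely many algebraic numbers lie in `ℚ(θ, i)` for a real algebraic number `θ`. -/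
lemma exists_primitive_real {S : Set QBar} (hS : S.Finite) :
    ∃ θ : QBar, IsRealAlg θ ∧ ∀ z ∈ S, ∃ α β : Polynomial ℚ,
      z = Polynomial.aeval θ α + imUnit * Polynomial.aeval θ β := by
  -- Adjoining real and imaginary parts inside `ℝ`, instead of the numbers themselves, makes the
  -- primitive element real.
  let S' : Set ℝ := (fun z : QBar => (z : ℂ).re) '' S ∪ (fun z : QBar => (z : ℂ).im) '' S
  have hS' : S'.Finite := (hS.image _).union (hS.image _)
  let F := IntermediateField.adjoin ℚ S'
  have hfin : FiniteDimensional ℚ F := by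
    have : Finite S' := hS'
    refine IntermediateField.finiteDimensional_adjoin fun x hx => ?_
    rcases hx with ⟨z, -, rfl⟩ | ⟨z, -, rfl⟩
    · exact (isAlgebraic_re_im z).1.isIntegral
    · exact (isAlgebraic_re_im z).2.isIntegral
  obtain ⟨t, ht⟩ := Field.exists_primitive_element ℚ F
  have htint : IsIntegral ℚ t := Algebra.IsIntegral.isIntegral t
  have hgen : ∀ s ∈ S', ∃ α : Polynomial ℚ, Polynomial.aeval (t : ℝ) α = s := by
    intro s hs
    have h1 : (⟨s, IntermediateField.subset_adjoin ℚ S' hs⟩ : F) ∈ IntermediateField.adjoin ℚ {t} := by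
      rw [ht]; trivial
    rw [← IntermediateField.mem_toSubalgebra,
      IntermediateField.adjoin_simple_toSubalgebra_of_isAlgebraic htint.isAlgebraic,
      Algebra.adjoin_singleton_eq_range_aeval] at h1
    obtain ⟨α, hα⟩ := h1
    refine ⟨α, ?_⟩
    have := congrArg Subtype.val hα
    exact (Polynomial.aeval_algebraMap_apply ℝ t α).trans this
  have htint' : IsIntegral ℚ (t : ℝ) := htint.map F.val
  let θ : QBar := ⟨((t : ℝ) : ℂ), mem_algebraicClosure_iff.mpr
    (htint'.isAlgebraic.algebraMap (A := ℂ))⟩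
  have hθ (f : Polynomial ℚ) : ((Polynomial.aeval θ f : QBar) : ℂ) =
      ((Polynomial.aeval (t : ℝ) f : ℝ) : ℂ) := by
    rw [show ((Polynomial.aeval θ f : QBar) : ℂ) = Polynomial.aeval (θ : ℂ) f from
      (Polynomial.aeval_algebraMap_apply ℂ θ f).symm]
    exact Polynomial.aeval_algebraMap_apply ℂ (t : ℝ) f
  refine ⟨θ, ?_, ?_⟩
  · simp [IsRealAlg, θ]
  · intro z hz
    obtain ⟨α, hα⟩ := hgen _ (Or.inl ⟨z, hz, rfl⟩)
    obtain ⟨β, hβ⟩ := hgen _ (Or.inr ⟨z, hz, rfl⟩)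
    refine ⟨α, β, Subtype.ext ?_⟩
    have : ((Polynomial.aeval θ α + imUnit * Polynomial.aeval θ β : QBar) : ℂ) =
      ((Polynomial.aeval θ α : QBar) : ℂ) + Complex.I * ((Polynomial.aeval θ β : QBar) : ℂ) := rfl
    rw [this, hθ, hθ, hα, hβ, mul_comm]
    exact (Complex.re_add_im _).symm
end PrimitiveElement
end ProjEquiv

namespace ProjEquiv
open MvPolynomial

/-! ### Evaluation of codes and certified equations -/

/-- The polynomial over the algebraic numbers given by a code, where the variable `0` of the code
stands for `θ` and the variable `1` for the imaginary unit. -/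
noncomputable def ev (θ : QBar) (p : MPoly) : MvPolynomial ℕ QBar := specialize θ (sem p)

section Eval
variable (θ : QBar)

lemma ev_nil : ev θ [] = 0 := by rw [ev, sem_nil, map_zero]

lemma ev_append (p q : MPoly) : ev θ (p ++ q) = ev θ p + ev θ q := by
  rw [ev, sem_append, map_add]; rfl

lemma ev_psub (p q : MPoly) : ev θ (psub p q) = ev θ p - ev θ q := by
  rw [ev, sem_psub, map_sub]; rfl

lemma ev_pmul (p q : MPoly) : ev θ (pmul p q) = ev θ p * ev θ q := by
  rw [ev, sem_pmul, map_mul]; rfl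

lemma ev_pconst (c : RatCode) : ev θ (pconst c) = C ((toQ c : ℚ) : QBar) := by
  rw [ev, sem_pconst, specialize, aeval_C]
  rfl

lemma ev_pvar_one : ev θ (pvar 1) = C imUnit := by
  rw [ev, sem_pvar, specialize, aeval_X]

lemma ev_pvar_add_two (n : ℕ) : ev θ (pvar (n + 2)) = X n := by
  rw [ev, sem_pvar, specialize, aeval_X]

lemma ev_pprod (l : List MPoly) : ev θ (pprod l) = (l.map (ev θ)).prod := by
  rw [ev, sem_pprod, map_list_prod, List.map_map]; rfl

lemma ev_ppow (p : MPoly) (n : ℕ) : ev θ (ppow p n) = ev θ p ^ n := by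
  rw [ev, sem_ppow, map_pow]; rfl

lemma ev_psum (l : List MPoly) : ev θ (psum l) = (l.map (ev θ)).sum := by
  rw [ev, sem_psum, map_list_sum, List.map_map]; rfl

/-- Lists of rational numbers, which stand for polynomials in `θ`. -/
abbrev RealCode : Type := List RatCode

noncomputable def rpoly (l : RealCode) : Polynomial ℚ :=
  l.foldr (fun c acc => Polynomial.C (toQ c) + Polynomial.X * acc) 0

lemma rpoly_nil : rpoly [] = 0 := rfl

lemma rpoly_cons (c : RatCode) (l : RealCode) :
    rpoly (c :: l) = Polynomial.C (toQ c) + Polynomial.X * rpoly l := rfl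

lemma rpoly_surjective : Function.Surjective rpoly := by
  intro f
  suffices h : ∀ n, ∀ f : Polynomial ℚ, f.natDegree < n → ∃ l, rpoly l = f from
    h _ f (Nat.lt_succ_self _)
  intro n
  induction n with
  | zero => intro f hf; omega
  | succ n ih =>
    intro f hf
    obtain ⟨c, hc⟩ := toQ_surjective (f.coeff 0)
    rcases Nat.eq_zero_or_pos n with rfl | hn
    · refine ⟨[c], ?_⟩
      rw [rpoly_cons, rpoly_nil, mul_zero, add_zero, hc]
      exact (Polynomial.eq_C_of_natDegree_le_zero (by omega)).symm
    · obtain ⟨l, hl⟩ := ih f.divX (by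
        rw [Polynomial.natDegree_divX_eq_natDegree_tsub_one]; omega)
      exact ⟨c :: l, by rw [rpoly_cons, hl, hc, add_comm]; exact Polynomial.X_mul_divX_add f⟩

/-- The real number given by a code. -/
noncomputable def rval (l : RealCode) : QBar := Polynomial.aeval θ (rpoly l)

/-- The code of a polynomial in the variable `0`. -/
def rp (l : RealCode) : MPoly := l.foldr (fun c acc => pconst c ++ pmul (pvar 0) acc) []

lemma sem_rp (l : RealCode) : sem (rp l) = Polynomial.aeval (X 0) (rpoly l) := by
  induction l with
  | nil => simp [rp, sem_nil, rpoly_nil]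
  | cons c l ih =>
    have : rp (c :: l) = pconst c ++ pmul (pvar 0) (rp l) := rfl
    rw [this, sem_append, sem_pmul, ih, sem_pconst, sem_pvar, rpoly_cons]
    simp [MvPolynomial.algebraMap_eq]

lemma ev_rp (l : RealCode) : ev θ (rp l) = C (rval θ l) := by
  have h : specialize θ (X 0) = algebraMap QBar (MvPolynomial ℕ QBar) θ := by
    rw [specialize, aeval_X]; rfl
  rw [ev, sem_rp, ← Polynomial.aeval_algHom_apply, h, Polynomial.aeval_algebraMap_apply]
  rfl

lemma isRealAlg_rval {θ : QBar} (h : IsRealAlg θ) (l : RealCode) : IsRealAlg (rval θ l) :=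
  h.aeval _

/-- Codes of complex numbers: the real and the imaginary part. -/
abbrev CNum : Type := RealCode × RealCode

noncomputable def cval (z : CNum) : QBar := rval θ z.1 + imUnit * rval θ z.2

/-- The code of a constant. -/
def num (z : CNum) : MPoly := rp z.1 ++ pmul (pvar 1) (rp z.2)

lemma ev_num (z : CNum) : ev θ (num z) = C (cval θ z) := by
  rw [num, ev_append, ev_pmul, ev_rp, ev_rp, ev_pvar_one, cval, map_add, map_mul]

/-- The value of an integer polynomial, given by its coefficients, at a code. -/
def cev (c : List ℤ) (p : MPoly) : MPoly :=
  c.foldr (fun a acc => pconst (qint a) ++ pmul p acc) []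

lemma ev_cev (c : List ℤ) (p : MPoly) :
    ev θ (cev c p) = Polynomial.aeval (ev θ p) (polyOfList c) := by
  induction c with
  | nil => simp [cev, polyOfList, ev_nil]
  | cons a c ih =>
    have h1 : cev (a :: c) p = pconst (qint a) ++ pmul p (cev c p) := rfl
    have h2 : polyOfList (a :: c) = Polynomial.C a + Polynomial.X * polyOfList c := rfl
    rw [h1, h2, ev_append, ev_pmul, ih, ev_pconst, toQ_qint]
    simp

end Eval

section
variable {α : Type} [Primcodable α]

@[fun_prop] theorem pr_rp {f : α → RealCode} (hf : Primrec f) : Primrec (fun a => rp (f a)) := by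
  have h : Primrec (fun p : RealCode => rp p) := by unfold rp; fun_prop
  exact h.comp hf

@[fun_prop] theorem pr_num {f : α → CNum} (hf : Primrec f) : Primrec (fun a => num (f a)) := by
  unfold num; fun_prop

@[fun_prop] theorem pr_cev {f : α → List ℤ} {g : α → MPoly} (hf : Primrec f) (hg : Primrec g) :
    Primrec (fun a => cev (f a) (g a)) := by
  have h : Primrec (fun p : List ℤ × MPoly => cev p.1 p.2) := by unfold cev; fun_prop
  exact h.comp (hf.pair hg)
end

/-! ### Certificates that codes vanish for a common real `θ`. -/

/-- The value of a rational polynomial at a rational number. -/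
def qeval (l : RealCode) (x : RatCode) : RatCode :=
  l.foldr (fun c acc => qadd c (qmul x acc)) (qnat 0)

lemma toQ_qeval (l : RealCode) (x : RatCode) : toQ (qeval l x) = (rpoly l).eval (toQ x) := by
  induction l with
  | nil => simp [qeval, rpoly_nil, toQ_qnat]
  | cons c l ih =>
    have : qeval (c :: l) x = qadd c (qmul x (qeval l x)) := rfl
    rw [this, toQ_qadd, toQ_qmul, ih, rpoly_cons]
    simp

/-- A certificate that given codes vanish for some real `θ`: a rational polynomial with a change
of sign, and the cofactors of the codes with respect to this polynomial and `i ^ 2 + 1`. -/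
abbrev Certificate : Type := (RealCode × RatCode × RatCode) × List (MPoly × MPoly)

def qnegative (x : RatCode) : Bool := decide (x.1 < x.2.1)

/-- The combination of `l` and `i ^ 2 + 1` with given cofactors. -/
def combination (l : RealCode) (c : MPoly × MPoly) : MPoly :=
  pmul (rp l) c.1 ++ pmul (ppow (pvar 1) 2 ++ pconst (qnat 1)) c.2

/-- The real root itself is not recorded: two rational points with values of opposite sign guarantee
one. The cofactor identities are checked as identities over `ℚ`. -/
def verify (b : Certificate) (eqs : List MPoly) : Bool :=
  (qnegative (qeval b.1.1 b.1.2.1) && qnegative (qneg (qeval b.1.1 b.1.2.2))) &&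
  lall (List.range eqs.length) fun k =>
    isZero (psub (eqs.getD k []) (combination b.1.1 (b.2.getD k ([], []))))

lemma exists_real_root {h : Polynomial ℚ} {a b : ℚ} (ha : h.eval a < 0) (hb : 0 < h.eval b) :
    ∃ θ : QBar, IsRealAlg θ ∧ Polynomial.aeval θ h = 0 := by
  have hev (q : ℚ) : Polynomial.aeval (q : ℝ) h = ((h.eval q : ℚ) : ℝ) :=
    Polynomial.aeval_algebraMap_apply_eq_algebraMap_eval q h
  obtain ⟨t, ht⟩ := mem_range_of_exists_le_of_exists_ge
    (f := fun x : ℝ => Polynomial.aeval x h) (c := 0) (Polynomial.continuous_aeval h)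
    ⟨(a : ℝ), by rw [hev]; exact_mod_cast ha.le⟩ ⟨(b : ℝ), by rw [hev]; exact_mod_cast hb.le⟩
  have ht : Polynomial.aeval t h = 0 := ht
  have h0 : h ≠ 0 := by rintro rfl; simp at ha
  have halg : IsAlgebraic ℚ (t : ℂ) := IsAlgebraic.algebraMap (A := ℂ) ⟨h, h0, ht⟩
  refine ⟨⟨(t : ℂ), mem_algebraicClosure_iff.mpr halg⟩, by simp [IsRealAlg], ?_⟩
  apply Subtype.ext
  change algebraMap QBar ℂ _ = _
  rw [← Polynomial.aeval_algebraMap_apply]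
  change Polynomial.aeval (algebraMap ℝ ℂ t) h = _
  rw [Polynomial.aeval_algebraMap_apply, ht]
  simp

/-- `θ` is any root provided by the intermediate value theorem. The recorded polynomial need not be
irreducible, so `θ` may differ from the number for which the certificate was made; later systems of
equations have to determine their values by themselves. -/
lemma exists_theta_of_verify {b : Certificate} {eqs : List MPoly} (hv : verify b eqs = true) :
    ∃ θ, IsRealAlg θ ∧ ∀ e ∈ eqs, ev θ e = 0 := by
  simp only [verify, qnegative, combination, Bool.and_eq_true, decide_eq_true_eq, lall_iff, List.mem_range, isZero_iff,
    ← toQ_neg_iff, toQ_qneg, neg_lt_zero, toQ_qeval] at hv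
  obtain ⟨⟨ha, hb⟩, hz⟩ := hv
  obtain ⟨θ, hθ, hroot⟩ := exists_real_root ha hb
  refine ⟨θ, hθ, fun e he => ?_⟩
  obtain ⟨k, hk, rfl⟩ := List.getElem_of_mem he
  have h1 := congrArg (specialize θ) (hz k hk)
  change ev θ _ = _ at h1
  rw [map_zero, ev_psub, ev_append, ev_pmul, ev_pmul, ev_rp, rval, hroot, ev_append, ev_ppow,
    ev_pvar_one, ev_pconst, toQ_qnat, ← map_pow, imUnit_sq, List.getD_eq_getElem _ _ hk] at h1
  simpa using h1

/-- The minimal polynomial is separable, so its real root `θ` is simple and there is a change of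
sign. -/
lemma exists_minimal {θ : QBar} (hθ : IsRealAlg θ) : ∃ h : Polynomial ℚ,
    (∀ f : Polynomial ℚ, Polynomial.aeval θ f = 0 → h ∣ f) ∧
    (∃ a : ℚ, h.eval a < 0) ∧ (∃ b : ℚ, 0 < h.eval b) := by
  let t : ℝ := (θ : ℂ).re
  have h1 : (θ : ℂ) = (t : ℂ) := Complex.ext rfl (by simpa [IsRealAlg] using hθ)
  have halg : IsAlgebraic ℚ t := (isAlgebraic_re_im θ).1
  have hint := halg.isIntegral
  have hroot : Polynomial.aeval t (minpoly ℚ t) = 0 := minpoly.aeval _ _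
  have hder : Polynomial.aeval t (minpoly ℚ t).derivative ≠ 0 :=
    (minpoly.irreducible hint).separable.aeval_derivative_ne_zero hroot
  obtain ⟨ha, hb⟩ := exists_eval_neg_pos hroot hder
  refine ⟨minpoly ℚ t, fun f hf => minpoly.dvd _ _ ?_, ha, hb⟩
  have h2 : ((Polynomial.aeval θ f : QBar) : ℂ) = ((Polynomial.aeval t f : ℝ) : ℂ) := by
    rw [show ((Polynomial.aeval θ f : QBar) : ℂ) = Polynomial.aeval (θ : ℂ) f from
      (Polynomial.aeval_algebraMap_apply ℂ θ f).symm, h1]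
    exact Polynomial.aeval_algebraMap_apply ℂ t f
  rw [hf] at h2
  exact Complex.ofReal_eq_zero.mp h2.symm

lemma exists_verify {θ : QBar} (hθ : IsRealAlg θ) {eqs : List MPoly}
    (heqs : ∀ e ∈ eqs, ev θ e = 0) : ∃ b, verify b eqs = true := by
  obtain ⟨h, hmin, ⟨a, ha⟩, ⟨b, hb⟩⟩ := exists_minimal hθ
  obtain ⟨l, rfl⟩ := rpoly_surjective h
  obtain ⟨a, rfl⟩ := toQ_surjective a
  obtain ⟨b, rfl⟩ := toQ_surjective b
  have hcof : ∀ e ∈ eqs, ∃ uv : MPoly × MPoly, sem (psub e (pmul (rp l) uv.1 ++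
      pmul (ppow (pvar 1) 2 ++ pconst (qnat 1)) uv.2)) = 0 := by
    intro e he
    obtain ⟨u, v, huv⟩ := Ideal.mem_span_pair.mp
      (mem_span_of_specialize_eq_zero θ hθ hmin (heqs e he))
    obtain ⟨u, rfl⟩ := sem_surjective u
    obtain ⟨v, rfl⟩ := sem_surjective v
    refine ⟨(u, v), ?_⟩
    rw [sem_psub, ← huv, sem_append, sem_pmul, sem_pmul, sem_append, sem_ppow, sem_pvar,
      sem_pconst, sem_rp, toQ_qnat]
    simp
    ring
  choose! uv huv using hcof
  refine ⟨((l, a, b), eqs.map uv), ?_⟩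
  simp only [verify, qnegative, combination, Bool.and_eq_true, decide_eq_true_eq, lall_iff, List.mem_range, isZero_iff,
    ← toQ_neg_iff, toQ_qneg, neg_lt_zero, toQ_qeval]
  refine ⟨⟨ha, hb⟩, fun k hk => ?_⟩
  rw [List.getD_eq_getElem _ _ hk, List.getD_eq_getElem _ _ (by simpa using hk), List.getElem_map]
  exact huv _ (List.getElem_mem hk)

section
variable {α : Type} [Primcodable α]

@[fun_prop] theorem pr_qeval {f : α → RealCode} {g : α → RatCode} (hf : Primrec f)
    (hg : Primrec g) : Primrec (fun a => qeval (f a) (g a)) := by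
  have h : Primrec (fun p : RealCode × RatCode => qeval p.1 p.2) := by unfold qeval; fun_prop
  exact h.comp (hf.pair hg)

@[fun_prop] theorem pr_qnegative {f : α → RatCode} (hf : Primrec f) :
    Primrec (fun a => qnegative (f a)) := by
  have h : Primrec (fun p : RatCode => qnegative p) := by unfold qnegative; fun_prop
  exact h.comp hf

@[fun_prop] theorem pr_combination {f : α → RealCode} {g : α → MPoly × MPoly} (hf : Primrec f)
    (hg : Primrec g) : Primrec (fun a => combination (f a) (g a)) := by
  have h : Primrec (fun p : RealCode × MPoly × MPoly => combination p.1 p.2) := by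
    unfold combination; fun_prop
  exact h.comp (hf.pair hg)

@[fun_prop] theorem pr_verify {f : α → Certificate} {g : α → List MPoly} (hf : Primrec f)
    (hg : Primrec g) : Primrec (fun a => verify (f a) (g a)) := by
  have h1 : Primrec (fun p : (Certificate × List MPoly) × ℕ =>
      isZero (psub (p.1.2.getD p.2 []) (combination p.1.1.1.1 (p.1.1.2.getD p.2 ([], []))))) := by
    refine pr_isZero (pr_psub ?_ (pr_combination ?_ ?_))
    · fun_prop
    · fun_prop
    · exact pr_getD (by fun_prop) (by fun_prop) (Primrec.const _)
  have h2 : Primrec (fun p : Certificate × List MPoly =>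
      qnegative (qeval p.1.1.1 p.1.1.2.1)) := by fun_prop
  have h3 : Primrec (fun p : Certificate × List MPoly =>
      qnegative (qneg (qeval p.1.1.1 p.1.1.2.2))) := by fun_prop
  have h : Primrec (fun p : Certificate × List MPoly => verify p.1 p.2) :=
    pr_and (pr_and h2 h3) (pr_lall (pr_range (pr_length (by fun_prop))) h1)
  have h4 := h.comp (hf.pair hg)
  exact h4
end

/-! ### Semidecision by search, and separation. -/

/-- Solvability of a system of certified equations, with side conditions, is semidecidable. -/
theorem exists_primrec_semidecision {α β : Type} [Primcodable α] [Primcodable β]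
    {side : α × β → Bool} {eqs : α × β → List MPoly} (hside : Primrec side) (heqs : Primrec eqs) :
    ∃ chk : α × ℕ → Bool, Primrec chk ∧ ∀ a, (∃ k, chk (a, k) = true) ↔
      ∃ θ, IsRealAlg θ ∧ ∃ d, side (a, d) = true ∧ ∀ e ∈ eqs (a, d), ev θ e = 0 := by
  let body : (α × ℕ) × β × Certificate → Bool := fun p =>
    side (p.1.1, p.2.1) && verify p.2.2 (eqs (p.1.1, p.2.1))
  have hbody : Primrec body := by
    have h1 : Primrec fun p : (α × ℕ) × β × Certificate => side (p.1.1, p.2.1) :=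
      hside.comp (by fun_prop)
    have h2 : Primrec fun p : (α × ℕ) × β × Certificate => eqs (p.1.1, p.2.1) :=
      heqs.comp (by fun_prop)
    exact pr_and h1 (pr_verify (by fun_prop) h2)
  -- The search index codes the unknown data together with a certificate; an index which decodes to
  -- nothing fails the check.
  refine ⟨fun p => ((Encodable.decode (α := β × Certificate) p.2).map fun c => body (p, c)).getD
    false, ?_, fun a => ⟨?_, ?_⟩⟩
  · exact Primrec.option_getD.comp
      (Primrec.option_map (Primrec.decode.comp Primrec.snd) hbody) (Primrec.const false)
  · rintro ⟨k, hk⟩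
    cases hd : Encodable.decode (α := β × Certificate) k with
    | none => simp [hd] at hk
    | some c =>
      simp only [hd, Option.map_some, Option.getD_some, body, Bool.and_eq_true] at hk
      obtain ⟨θ, hθ, h⟩ := exists_theta_of_verify hk.2
      exact ⟨θ, hθ, c.1, hk.1, h⟩
  · rintro ⟨θ, hθ, d, hd, h⟩
    obtain ⟨b, hb⟩ := exists_verify hθ h
    exact ⟨Encodable.encode (d, b), by
      simp only [Encodable.encodek, Option.map_some, Option.getD_some, body, hd, hb, Bool.and_self]⟩

/-- Two semidecidable predicates which cover everything are separated by a computable function. -/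
theorem exists_computable_separation {α : Type} [Primcodable α] {chk chk' : α × ℕ → Bool}
    (h : Primrec chk) (h' : Primrec chk')
    (hc : ∀ a, (∃ k, chk (a, k) = true) ∨ ∃ k, chk' (a, k) = true) :
    ∃ f : α → Bool, Computable f ∧ ∀ a, (f a = true → ∃ k, chk (a, k) = true) ∧
      (f a = false → ∃ k, chk' (a, k) = true) := by
  -- The search stops at the first index where one of the checks succeeds. If both succeed there,
  -- the answer is `true`.
  let s : α → ℕ → Option Bool := fun a k =>
    bif chk (a, k) then some true else bif chk' (a, k) then some false else none
  have hs : Primrec₂ s := Primrec.cond h (Primrec.const _)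
    (Primrec.cond h' (Primrec.const _) (Primrec.const _))
  have hp : Partrec fun a => Nat.rfindOpt (s a) := Partrec.rfindOpt hs.to_comp
  have hdom : ∀ a, (Nat.rfindOpt (s a)).Dom := by
    intro a
    rw [Nat.rfindOpt_dom]
    rcases hc a with ⟨k, hk⟩ | ⟨k, hk⟩
    · exact ⟨k, true, by simp [s, hk]⟩
    · cases hk' : chk (a, k)
      · exact ⟨k, false, by simp [s, hk, hk']⟩
      · exact ⟨k, true, by simp [s, hk']⟩
  refine ⟨fun a => (Nat.rfindOpt (s a)).get (hdom a), ?_, fun a => ?_⟩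
  · refine hp.of_eq fun a => ?_
    exact Part.ext' (iff_of_true (hdom a) trivial) fun _ _ => rfl
  · obtain ⟨k, hk⟩ := Nat.rfindOpt_spec (Part.get_mem (hdom a))
    constructor
    · intro ht
      change (Nat.rfindOpt (s a)).get (hdom a) = _ at ht
      rw [ht] at hk
      refine ⟨k, ?_⟩
      cases h1 : chk (a, k)
      · cases h2 : chk' (a, k) <;> simp [s, h1, h2] at hk
      · rfl
    · intro ht
      change (Nat.rfindOpt (s a)).get (hdom a) = _ at ht
      rw [ht] at hk
      refine ⟨k, ?_⟩
      cases h1 : chk (a, k)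
      · cases h2 : chk' (a, k)
        · simp [s, h1, h2] at hk
        · rfl
      · simp [s, h1] at hk

end ProjEquiv

namespace ProjEquiv
open MvPolynomial

/-! ### The elimination theoretic alternative -/

section Alternative
variable {r : ℕ} {K : Type} [Field K]

/-- `g` carries the projective scheme defined by `fs` to the one defined by `hs`, expressed by the
equations. -/
def Good (fs hs : List (MvPolynomial (Fin r) K)) : Prop :=
  ∃ g g' : Matrix (Fin r) (Fin r) K, g * g' = 1 ∧ g' * g = 1 ∧
    (∀ f ∈ fs, MemSat (Ideal.span {h | h ∈ hs}) (substHom g f)) ∧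
    (∀ f ∈ hs, MemSat (Ideal.span {h | h ∈ fs}) (substHom g' f))

/-- The index of the variable which stands for an entry of the first (`o = 0`) or the second
(`o = 1`) generic matrix. The coordinates are the variables `3 * j`. -/
def gvar (o j l : ℕ) : ℕ := 3 * Nat.pair j l + (o + 1)

/-- The coordinates, translated by `p`. -/
noncomputable def shiftArgs (p : Fin r → K) (l : Fin r) : MvPolynomial ℕ K := C (p l) + X (3 * (l : ℕ))

/-- The image of a vector under a generic matrix. -/
noncomputable def linArgs (o : ℕ) (a : Fin r → MvPolynomial ℕ K) (j : Fin r) : MvPolynomial ℕ K :=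
  ∑ l : Fin r, X (gvar o j l) * a l

/-- The polynomial `c` in the entries of a generic matrix is a coefficient of the result of
the substitution of this matrix in an element of `fs`, followed by a test for `hs`. -/
def Witness (fs hs : List (MvPolynomial (Fin r) K)) (o : ℕ) (c : MvPolynomial ℕ K) : Prop :=
  ∃ (p : Fin r → K) (n : ℕ) (Λ : MvPolynomial ℕ K) (γ : Fin r → ℕ) (Z : MvPolynomial ℕ K),
    (∃ k, p k ≠ 0) ∧
    (∀ h ∈ hs, ∀ m ∈ (Λ * aeval (shiftArgs p) h).support, ∃ j : Fin r, n < m (3 * j)) ∧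
    (∀ j, γ j ≤ n) ∧
    (∃ f ∈ fs, Λ * aeval (linArgs o (shiftArgs p)) f = c * ∏ j : Fin r, X (3 * (j : ℕ)) ^ γ j + Z) ∧
    ∀ m ∈ Z.support, ∃ j : Fin r, m (3 * j) ≠ γ j

/-- An entry of `G * G' - 1` for the generic matrices `G` and `G'`. -/
noncomputable def relation (r : ℕ) (K : Type) [Field K] (i j : Fin r) : MvPolynomial ℕ K :=
  ∑ l : Fin r, X (gvar 0 i l) * X (gvar 1 l j) - C ((1 : Matrix (Fin r) (Fin r) K) i j)

/-- The generators of the ideal in the coordinates of a generic matrix and its inverse which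
defines the set of the matrices which carry one scheme to the other. -/
def obstruction (fs hs : List (MvPolynomial (Fin r) K)) : Set (MvPolynomial ℕ K) :=
  {c | ∃ i j, c = relation r K i j} ∪ ({c | Witness fs hs 0 c} ∪ {c | Witness hs fs 1 c})

/-- The coordinate part of an exponent. -/
noncomputable def xexp (r : ℕ) (m : ℕ →₀ ℕ) : Fin r →₀ ℕ :=
  Finsupp.equivFunOnFinite.symm fun j => m (3 * j)

lemma xexp_apply (m : ℕ →₀ ℕ) (j : Fin r) : xexp r m j = m (3 * j) := rfl

lemma xexp_add (m m' : ℕ →₀ ℕ) : xexp r (m + m') = xexp r m + xexp r m' := by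
  ext j; simp [xexp_apply]

/-- Evaluation of the generic matrices at given matrices. -/
noncomputable def vhom (g : ℕ → Matrix (Fin r) (Fin r) K) :
    MvPolynomial ℕ K →ₐ[K] MvPolynomial (Fin r) K :=
  -- Residue `0` modulo 3 marks a coordinate, residues `1` and `2` the entries of the two matrices.
  -- Variables with indices out of range go to `0`.
  aeval fun i => if i % 3 = 0 then (if h : i / 3 < r then X ⟨i / 3, h⟩ else 0) else
    (if h : (Nat.unpair (i / 3)).1 < r ∧ (Nat.unpair (i / 3)).2 < r then
      C (g (i % 3 - 1) ⟨_, h.1⟩ ⟨_, h.2⟩) else 0)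

lemma vhom_X (g : ℕ → Matrix (Fin r) (Fin r) K) (j : Fin r) : vhom g (X (3 * (j : ℕ))) = X j := by
  rw [vhom, aeval_X]
  simp

lemma vhom_gvar (g : ℕ → Matrix (Fin r) (Fin r) K) {o : ℕ} (ho : o < 2) (j l : Fin r) :
    vhom g (X (gvar o j l)) = C (g o j l) := by
  have h1 : gvar o j l % 3 = o + 1 := by unfold gvar; omega
  have h2 : gvar o j l / 3 = Nat.pair j l := by unfold gvar; omega
  rw [vhom, aeval_X]
  simp [h1, h2]

/-- Evaluating the matrices affects coefficients but not the exponents of the coordinates. Hence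
conditions on supports before the evaluation control coefficients after it. -/
lemma exists_vhom_monomial (g : ℕ → Matrix (Fin r) (Fin r) K) (m : ℕ →₀ ℕ) (c : K) :
    ∃ a, vhom g (monomial m c) = monomial (xexp r m) a := by
  classical
  induction m using Finsupp.induction_linear generalizing c with
  | zero =>
    refine ⟨c, ?_⟩
    have : xexp r 0 = 0 := by ext; simp [xexp_apply]
    rw [this]
    exact algHom_C _ _
  | add m m' h h' =>
    obtain ⟨a, ha⟩ := h 1
    obtain ⟨b, hb⟩ := h' c
    exact ⟨a * b, by
      rw [← one_mul c, ← monomial_mul, map_mul, ha, hb, monomial_mul, xexp_add]⟩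
  | single i k =>
    rw [← C_mul_X_pow_eq_monomial, map_mul, map_pow, algHom_C, algebraMap_eq]
    by_cases h0 : i % 3 = 0
    · obtain ⟨q, rfl⟩ : ∃ q, i = 3 * q := ⟨i / 3, by omega⟩
      by_cases hq : q < r
      · refine ⟨c, ?_⟩
        have := vhom_X g ⟨q, hq⟩
        simp only at this
        have hx : xexp r (Finsupp.single (3 * q) k) = Finsupp.single ⟨q, hq⟩ k := by
          ext j
          rw [xexp_apply, Finsupp.single_apply, Finsupp.single_apply]
          simp [Fin.ext_iff]
        rw [this, C_mul_X_pow_eq_monomial, hx]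
      -- A coordinate beyond the `r`-th is sent to `0`, so the monomial survives only with exponent
      -- zero.
      · refine ⟨if k = 0 then c else 0, ?_⟩
        have h1 : vhom g (X (3 * q)) = 0 := by
          rw [vhom, aeval_X]
          simp [hq]
        have h2 : xexp r (Finsupp.single (3 * q) k) = 0 := by
          ext j
          rw [xexp_apply, Finsupp.single_apply, if_neg]
          · rfl
          · have := j.2
            omega
        rw [h1, h2]
        split_ifs with hk
        · subst hk
          simp
        · simp [hk]
    · have h2 : xexp r (Finsupp.single i k) = 0 := by
        ext j
        rw [xexp_apply, Finsupp.single_apply, if_neg]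
        · rfl
        · omega
      rw [h2]
      obtain ⟨d, hd⟩ : ∃ d, vhom g (X i) = C d := by
        rw [vhom, aeval_X, if_neg h0]
        split_ifs
        · exact ⟨_, rfl⟩
        · exact ⟨0, by simp⟩
      refine ⟨c * d ^ k, ?_⟩
      rw [hd, ← map_pow, ← map_mul]
      rfl

lemma coeff_vhom_eq_zero (g : ℕ → Matrix (Fin r) (Fin r) K) {F : MvPolynomial ℕ K}
    {γ : Fin r →₀ ℕ} (hF : ∀ m ∈ F.support, ∃ j : Fin r, m (3 * j) ≠ γ j) :
    coeff γ (vhom g F) = 0 := by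
  classical
  rw [F.as_sum, map_sum, coeff_sum]
  refine Finset.sum_eq_zero fun m hm => ?_
  obtain ⟨a, ha⟩ := exists_vhom_monomial g m (coeff m F)
  obtain ⟨j, hj⟩ := hF m hm
  rw [ha, coeff_monomial, if_neg]
  rintro rfl
  exact hj rfl

lemma vhom_shiftArgs (g : ℕ → Matrix (Fin r) (Fin r) K) (p : Fin r → K)
    (h : MvPolynomial (Fin r) K) : vhom g (aeval (shiftArgs p) h) = translate p h := by
  suffices H : (vhom g).comp (aeval (shiftArgs p)) = translate p from DFunLike.congr_fun H h
  ext1 i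
  rw [AlgHom.comp_apply, aeval_X, shiftArgs, map_add, vhom_X, algHom_C, translate_X]
  rfl

lemma vhom_linArgs (g : ℕ → Matrix (Fin r) (Fin r) K) (p : Fin r → K) {o : ℕ} (ho : o < 2)
    (f : MvPolynomial (Fin r) K) :
    vhom g (aeval (linArgs o (shiftArgs p)) f) = translate p (substHom (g o) f) := by
  suffices H : (vhom g).comp (aeval (linArgs o (shiftArgs p))) =
    (translate p).comp (substHom (g o)) from DFunLike.congr_fun H f
  ext1 i
  rw [AlgHom.comp_apply, aeval_X, linArgs, map_sum, AlgHom.comp_apply, substHom_X, map_sum]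
  refine Finset.sum_congr rfl fun l _ => ?_
  rw [map_mul, map_mul, vhom_gvar g ho, shiftArgs, map_add, vhom_X, algHom_C, algHom_C,
    translate_X]
  rfl

/-- After evaluation `Λ` is a test for `hs`, so it annihilates the image of `f`. The coefficient of
`x ^ γ` in `c * x ^ γ` is the constant coefficient of `c`; thus `c` vanishes at the given matrices.
Neither `c` nor `Λ` is required to be free of the other variables. -/
lemma Witness.constantCoeff_eq_zero {fs hs : List (MvPolynomial (Fin r) K)} {o : ℕ}
    {c : MvPolynomial ℕ K} (hc : Witness fs hs o c) (ho : o < 2)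
    {g : ℕ → Matrix (Fin r) (Fin r) K}
    (hg : ∀ f ∈ fs, MemSat (Ideal.span {h | h ∈ hs}) (substHom (g o) f)) :
    constantCoeff (vhom g c) = 0 := by
  classical
  obtain ⟨p, n, Λ, γ, Z, hp, htest, hγ, ⟨f, hf, heq⟩, hZ⟩ := hc
  have h1 : IsTest (Ideal.span {h | h ∈ hs}) p n (vhom g Λ) := by
    refine ⟨hp, fun f hf => ?_⟩
    induction hf using Submodule.span_induction with
    | mem h hh =>
      rw [← vhom_shiftArgs g, ← map_mul]
      intro δ hδ
      refine coeff_vhom_eq_zero g fun m hm => ?_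
      obtain ⟨j, hj⟩ := htest h hh m hm
      exact ⟨j, fun h => by have := hδ j; omega⟩
    | zero => simp
    | add a b _ _ ha hb => rw [map_add, mul_add]; exact Ideal.add_mem _ ha hb
    | smul a b _ hb =>
      rw [smul_eq_mul, map_mul, mul_left_comm]
      exact Ideal.mul_mem_left _ _ hb
  have h2 := h1.mul_translate_mem (hg f hf) (Finsupp.equivFunOnFinite.symm γ) hγ
  rw [← vhom_linArgs g p ho, ← map_mul, heq, map_add, coeff_add,
    coeff_vhom_eq_zero g (F := Z) hZ, add_zero, map_mul, map_prod] at h2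
  have h3 : ∏ j : Fin r, vhom g (X (3 * (j : ℕ)) ^ γ j) =
      monomial (Finsupp.equivFunOnFinite.symm γ) 1 := by
    simp_rw [map_pow, vhom_X]
    rw [monomial_eq, map_one, one_mul, Finsupp.prod_fintype _ _ fun _ => pow_zero _]
    rfl
  rw [h3] at h2
  have h4 := coeff_mul_monomial 0 (Finsupp.equivFunOnFinite.symm γ) 1 (vhom g c)
  rw [zero_add, h2, mul_one] at h4
  exact h4.symm

/-- An equivalence is a point where all generators vanish, while `1` does not. -/
lemma not_good_of_one_mem {fs hs : List (MvPolynomial (Fin r) K)}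
    (h1 : 1 ∈ Ideal.span (obstruction fs hs)) : ¬ Good fs hs := by
  rintro ⟨g, g', hgg', -, hfs, hhs⟩
  let G : ℕ → Matrix (Fin r) (Fin r) K := fun o => if o = 0 then g else g'
  let w : MvPolynomial ℕ K →+* K := constantCoeff.comp (vhom G).toRingHom
  have h2 : Ideal.span (obstruction fs hs) ≤ RingHom.ker w := by
    rw [Ideal.span_le]
    rintro c (⟨i, j, rfl⟩ | hc | hc)
    · change constantCoeff (vhom G _) = 0
      rw [relation, map_sub, map_sum, algHom_C]
      simp only [map_mul, vhom_gvar G (show 0 < 2 by omega), vhom_gvar G (show 1 < 2 by omega)]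
      rw [map_sub, map_sum]
      have h3 := congrFun (congrFun hgg' i) j
      rw [Matrix.mul_apply] at h3
      simp [G, h3]
    · exact hc.constantCoeff_eq_zero (by omega) hfs
    · exact hc.constantCoeff_eq_zero (by omega) hhs
  have h3 : w 1 = 0 := h2 h1
  rw [map_one] at h3
  exact one_ne_zero h3

/-! ### Polynomials in the coordinates over the ring of generic matrices. -/

/-- The entries of the two generic matrices. -/
abbrev EntryIdx (r : ℕ) : Type := Fin 2 × Fin r × Fin r

/-- Entries of generic matrices as variables of the large polynomial ring. -/
noncomputable def entryHom : MvPolynomial (EntryIdx r) K →ₐ[K] MvPolynomial ℕ K :=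
  aeval fun e => X (gvar e.1 e.2.1 e.2.2)

/-- The inclusion of the polynomials in the coordinates over the ring of the generic matrices in
the large polynomial ring. -/
noncomputable def flattenHom :
    MvPolynomial (Fin r) (MvPolynomial (EntryIdx r) K) →+* MvPolynomial ℕ K :=
  eval₂Hom entryHom.toRingHom fun l => X (3 * (l : ℕ))

lemma support_entryHom (c : MvPolynomial (EntryIdx r) K) :
    ∀ m ∈ (entryHom c).support, ∀ j : Fin r, m (3 * j) = 0 := by
  classical
  induction c using MvPolynomial.induction_on with
  | C a =>
    intro m hm j
    rw [algHom_C, algebraMap_eq] at hm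
    have := support_monomial_subset hm
    simp only [Finset.mem_singleton] at this
    subst this
    rfl
  | add p q hp hq =>
    intro m hm j
    rw [map_add] at hm
    rcases Finset.mem_union.mp (support_add hm) with h | h
    · exact hp m h j
    · exact hq m h j
  | mul_X p e hp =>
    intro m hm j
    rw [map_mul, entryHom, aeval_X, support_mul_X, Finset.mem_map] at hm
    obtain ⟨m', hm', rfl⟩ := hm
    have h1 := hp m' hm' j
    simp only [addRightEmbedding_apply, Finsupp.add_apply, h1, zero_add]
    rw [Finsupp.single_apply, if_neg]
    have := e.1.2
    unfold gvar
    omega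

lemma support_flattenHom (F : MvPolynomial (Fin r) (MvPolynomial (EntryIdx r) K)) :
    ∀ m ∈ (flattenHom F).support, ∃ δ ∈ F.support, ∀ j : Fin r, m (3 * j) = δ j := by
  classical
  intro m hm
  have h1 : flattenHom F = ∑ δ ∈ F.support,
      entryHom (coeff δ F) * monomial (Finsupp.mapDomain (fun j : Fin r => 3 * (j : ℕ)) δ) 1 := by
    conv_lhs => rw [F.as_sum, map_sum]
    refine Finset.sum_congr rfl fun δ _ => ?_
    rw [flattenHom, coe_eval₂Hom, eval₂_monomial]
    congr 1
    rw [monomial_eq, map_one, one_mul, Finsupp.prod_mapDomain_index (fun _ => pow_zero _)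
      fun _ _ _ => pow_add _ _ _]
  rw [h1] at hm
  obtain ⟨δ, hδ, hm⟩ := Finset.mem_biUnion.mp (support_sum hm)
  refine ⟨δ, hδ, fun j => ?_⟩
  have h2 := support_mul _ _ hm
  obtain ⟨m1, hm1, m2, hm2, rfl⟩ := Finset.mem_add.mp h2
  have h3 := support_monomial_subset hm2
  simp only [Finset.mem_singleton] at h3
  subst h3
  have hinj : Function.Injective fun j : Fin r => 3 * (j : ℕ) := by
    intro a b h
    ext
    simpa using h
  rw [Finsupp.add_apply, support_entryHom _ m1 hm1 j, zero_add]
  exact Finsupp.mapDomain_apply hinj δ j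

/-- The substitution of a generic matrix, followed by a translation. -/
noncomputable def genericSubst (o : Fin 2) (p : Fin r → K) :
    MvPolynomial (Fin r) K →+* MvPolynomial (Fin r) (MvPolynomial (EntryIdx r) K) :=
  eval₂Hom (C.comp C) fun j => ∑ l : Fin r, C (X (o, j, l)) * (C (C (p l)) + X l)

lemma flattenHom_genericSubst (o : Fin 2) (p : Fin r → K) (f : MvPolynomial (Fin r) K) :
    flattenHom (genericSubst o p f) = aeval (linArgs o (shiftArgs p)) f := by
  suffices H : (flattenHom).comp (genericSubst o p) =
    (aeval (linArgs (o : ℕ) (shiftArgs p)) : _ →ₐ[K] _).toRingHom from DFunLike.congr_fun H f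
  refine MvPolynomial.ringHom_ext (fun c => ?_) fun j => ?_
  · simp [genericSubst, flattenHom, entryHom, algebraMap_eq]
  · simp [genericSubst, flattenHom, entryHom, linArgs, shiftArgs, algebraMap_eq]

lemma flattenHom_map_C (f : MvPolynomial (Fin r) K) :
    flattenHom (map C f) = (rename (fun j : Fin r => 3 * (j : ℕ)) f : MvPolynomial ℕ K) := by
  suffices H : (flattenHom).comp (map C) =
    (rename (fun j : Fin r => 3 * (j : ℕ)) : _ →ₐ[K] _).toRingHom from DFunLike.congr_fun H f
  refine MvPolynomial.ringHom_ext (fun c => ?_) fun j => ?_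
  · simp [flattenHom, entryHom, algebraMap_eq]
  · simp [flattenHom]

lemma rename_translate (p : Fin r → K) (f : MvPolynomial (Fin r) K) :
    rename (fun j : Fin r => 3 * (j : ℕ)) (translate p f) = aeval (shiftArgs p) f := by
  suffices H : (rename (fun j : Fin r => 3 * (j : ℕ))).comp (translate p) =
    (aeval (shiftArgs p) : _ →ₐ[K] _) from DFunLike.congr_fun H f
  ext1 i
  simp [translate_X, shiftArgs]

lemma map_eval_genericSubst (P : EntryIdx r → K) (o : Fin 2) (p : Fin r → K)
    (f : MvPolynomial (Fin r) K) : map (eval P) (genericSubst o p f) =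
      translate p (substHom (Matrix.of fun j l => P (o, j, l)) f) := by
  suffices H : (map (eval P)).comp (genericSubst o p) =
    ((translate p).comp (substHom (Matrix.of fun j l => P (o, j, l)))).toRingHom from DFunLike.congr_fun H f
  refine MvPolynomial.ringHom_ext (fun c => ?_) fun j => ?_
  · simp [genericSubst, algHom_C, algebraMap_eq]
  · change _ = translate p (substHom _ (X j))
    rw [substHom_X]
    simp [genericSubst, translate_X, algHom_C, algebraMap_eq]

/-- The equation in the matrix entries is the coefficient of `x ^ γ` in `Λ * f(G (p + x))`; the
remaining terms form `Z`. Both are transported to the ring with variables in `ℕ` by `flattenHom`. -/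
lemma witness_of_isTest {fs hs : List (MvPolynomial (Fin r) K)} (o : Fin 2) {p : Fin r → K}
    {n : ℕ} {Λ : MvPolynomial (Fin r) K} (h : IsTest (Ideal.span {h | h ∈ hs}) p n Λ)
    {f : MvPolynomial (Fin r) K} (hf : f ∈ fs) {γ : Fin r →₀ ℕ} (hγ : ∀ i, γ i ≤ n) :
    Witness fs hs o (entryHom (coeff γ (map C Λ * genericSubst o p f))) := by
  classical
  set F := map C Λ * genericSubst o p f with hF
  have h1 : flattenHom F = entryHom (coeff γ F) * ∏ j : Fin r, X (3 * (j : ℕ)) ^ γ j +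
      flattenHom (F - monomial γ (coeff γ F)) := by
    rw [map_sub, flattenHom, coe_eval₂Hom, eval₂_monomial,
      Finsupp.prod_fintype _ _ fun _ => pow_zero _]
    exact (add_sub_cancel _ _).symm
  refine ⟨p, n, rename (fun j : Fin r => 3 * (j : ℕ)) Λ, γ,
    flattenHom (F - monomial γ (coeff γ F)), h.1, fun q hq m hm => ?_, hγ, ⟨f, hf, ?_⟩,
    fun m hm => ?_⟩
  · rw [← rename_translate, ← map_mul, ← flattenHom_map_C] at hm
    obtain ⟨δ, hδ, hδm⟩ := support_flattenHom _ m hm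
    by_contra hcon
    push Not at hcon
    refine mem_support_iff.mp hδ ?_
    rw [coeff_map, h.2 q (Ideal.subset_span hq) δ fun i => by rw [← hδm]; exact hcon i, map_zero]
  · rw [← h1, hF, map_mul, flattenHom_map_C, flattenHom_genericSubst]
  · obtain ⟨δ, hδ, hδm⟩ := support_flattenHom _ m hm
    by_contra hcon
    push Not at hcon
    have : δ = γ := by ext j; rw [← hδm, hcon]
    subst this
    exact mem_support_iff.mp hδ (by simp)

/-- If `1` is not in the ideal, the Nullstellensatz gives a common zero, that is, a pair of inverse
matrices which satisfies all tests. By `exists_isTest` it carries the schemes to each other. -/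
lemma one_mem_of_not_good [IsAlgClosed K] {fs hs : List (MvPolynomial (Fin r) K)}
    (hng : ¬ Good fs hs) : 1 ∈ Ideal.span (obstruction fs hs) := by
  classical
  -- The Nullstellensatz is applied with finitely many variables, the matrix entries. The set of
  -- generators may be infinite.
  let T : Ideal (MvPolynomial (EntryIdx r) K) := Ideal.span {c | entryHom c ∈ obstruction fs hs}
  suffices hT : (1 : MvPolynomial (EntryIdx r) K) ∈ T by
    have h1 := Ideal.mem_map_of_mem (entryHom (K := K) (r := r)) hT
    rw [map_one, Ideal.map_span] at h1
    refine Ideal.span_mono ?_ h1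
    rintro _ ⟨c, hc, rfl⟩
    exact hc
  rw [← Ideal.eq_top_iff_one]
  by_contra hne
  have hne' : (zeroLocus K T).Nonempty := by
    by_contra hcon
    rw [Set.not_nonempty_iff_eq_empty] at hcon
    have h2 := vanishingIdeal_zeroLocus_eq_radical (K := K) T
    rw [hcon] at h2
    have h3 : (1 : MvPolynomial (EntryIdx r) K) ∈ T.radical := by
      rw [← h2, mem_vanishingIdeal_iff]
      simp
    obtain ⟨N, hN⟩ := h3
    rw [one_pow] at hN
    exact hne ((Ideal.eq_top_iff_one _).mpr hN)
  obtain ⟨P, hP⟩ := hne'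
  have hP' : ∀ c, entryHom c ∈ obstruction fs hs → eval P c = 0 := by
    intro c hc
    have := hP c (Ideal.subset_span hc)
    rwa [aeval_eq_eval] at this
  let g (o : Fin 2) : Matrix (Fin r) (Fin r) K := Matrix.of fun j l => P (o, j, l)
  have hgg : g 0 * g 1 = 1 := by
    ext i j
    have h1 := hP' (∑ l : Fin r, X (0, i, l) * X (1, l, j) -
      C ((1 : Matrix (Fin r) (Fin r) K) i j)) (Or.inl ⟨i, j, by
        simp [entryHom, relation, algebraMap_eq]⟩)
    rw [Matrix.mul_apply]
    simp only [map_sub, map_sum, map_mul, eval_X, eval_C] at h1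
    exact sub_eq_zero.mp h1
  have key (fs hs : List (MvPolynomial (Fin r) K)) (o : Fin 2)
      (hw : ∀ c, Witness fs hs o (entryHom c) → eval P c = 0) :
      ∀ f ∈ fs, MemSat (Ideal.span {h | h ∈ hs}) (substHom (g o) f) := by
    intro f hf
    by_contra hcon
    obtain ⟨p, n, Λ, htest, hΛ⟩ := exists_isTest hcon
    refine hΛ fun γ hγ => ?_
    have h1 := hw _ (witness_of_isTest o htest hf hγ)
    rw [← coeff_map, map_mul, map_eval_genericSubst, map_map] at h1
    have h2 : (eval P).comp (C : K →+* MvPolynomial (EntryIdx r) K) = RingHom.id K := by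
      ext; simp
    rw [h2, map_id] at h1
    exact h1
  exact hng ⟨g 0, g 1, hgg, mul_eq_one_comm.mp hgg,
    key fs hs 0 fun c hc => hP' c (Or.inr (Or.inl hc)),
    key hs fs 1 fun c hc => hP' c (Or.inr (Or.inr hc))⟩

end Alternative
end ProjEquiv

namespace ProjEquiv
open MvPolynomial Filter

/-! ### Representing given numbers and polynomials by codes -/

/-- The filter of the real algebraic numbers `θ` for which `ℚ(θ, i)` is sufficiently large. -/
noncomputable def large : Filter QBar :=
  ⨅ S : Finset QBar, 𝓟 {θ | IsRealAlg θ ∧ ∀ z ∈ S, ∃ c, cval θ c = z}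

/-- The sets form a directed family under unions of `S`, and each is nonempty by
`exists_primitive_real`. Thus finitely many demands on the field `ℚ(θ, i)` are met by one `θ`,
without naming a common field. -/
instance large_neBot : large.NeBot := by
  refine iInf_neBot_of_directed' ?_ fun S => ?_
  · intro S T
    classical
    refine ⟨S ∪ T, ?_, ?_⟩ <;> refine principal_mono.mpr fun θ hθ => ⟨hθ.1, fun z hz => hθ.2 z ?_⟩
    · exact Finset.mem_union_left _ hz
    · exact Finset.mem_union_right _ hz
  · rw [principal_neBot_iff]
    obtain ⟨θ, hθ, hS⟩ := exists_primitive_real S.finite_toSet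
    refine ⟨θ, hθ, fun z hz => ?_⟩
    obtain ⟨α, β, h⟩ := hS z hz
    obtain ⟨α, rfl⟩ := rpoly_surjective α
    obtain ⟨β, rfl⟩ := rpoly_surjective β
    exact ⟨(α, β), h.symm⟩

lemma eventually_large (z : QBar) : ∀ᶠ θ in large, IsRealAlg θ ∧ ∃ c, cval θ c = z :=
  mem_iInf_of_mem {z} fun _ hθ => ⟨hθ.1, hθ.2 z (Finset.mem_singleton_self z)⟩

lemma eventually_isRealAlg : ∀ᶠ θ in large, IsRealAlg θ :=
  (eventually_large 0).mono fun _ h => h.1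

lemma eventually_cval (z : QBar) : ∀ᶠ θ in large, ∃ c, cval θ c = z :=
  (eventually_large z).mono fun _ h => h.2

/-- The value of a code of a real number is unchanged when its imaginary part is dropped. -/
lemma eventually_rval {z : QBar} (hz : IsRealAlg z) : ∀ᶠ θ in large, ∃ l, rval θ l = z := by
  filter_upwards [eventually_large z] with θ hθ
  obtain ⟨hθ, c, hc⟩ := hθ
  refine ⟨c.1, ?_⟩
  have h1 : IsRealAlg (rval θ c.1 - z) := by
    have := isRealAlg_rval hθ c.1
    simp only [IsRealAlg] at this hz ⊢
    simp [this, hz]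
  refine sub_eq_zero.mp (add_imUnit_mul_eq_zero h1 (isRealAlg_rval hθ c.2) ?_).1
  rw [← hc, cval]
  ring

/-- All terms of a code have the exponents `m`, up to the first two variables. -/
def HasExponent (q : MPoly) (m : ℕ →₀ ℕ) : Prop := ∀ t ∈ q, ∀ i, t.2.getD (i + 2) 0 = m i

lemma HasExponent.append {q q' : MPoly} {m : ℕ →₀ ℕ} (h : HasExponent q m)
    (h' : HasExponent q' m) : HasExponent (q ++ q') m := by
  intro t ht
  rcases List.mem_append.mp ht with ht | ht
  · exact h t ht
  · exact h' t ht

lemma HasExponent.mul {q q' : MPoly} {m m' : ℕ →₀ ℕ} (h : HasExponent q m)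
    (h' : HasExponent q' m') : HasExponent (pmul q q') (m + m') := by
  intro t ht i
  simp only [pmul, List.mem_flatMap, List.mem_map] at ht
  obtain ⟨s, hs, s', hs', rfl⟩ := ht
  rw [← monO_apply, monO_mmul, Finsupp.add_apply, Finsupp.add_apply, monO_apply, monO_apply,
    h s hs i, h' s' hs' i]

lemma hasExponent_pconst (c : RatCode) : HasExponent (pconst c) 0 := by
  intro t ht i
  simp only [pconst, List.mem_singleton] at ht
  subst ht
  rfl

lemma hasExponent_of_pvar {i : ℕ} {m : ℕ →₀ ℕ} (h : ∀ j, Finsupp.single i 1 (j + 2) = m j) :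
    HasExponent (pvar i) m := by
  intro t ht j
  have h1 : monO t.2 = Finsupp.single i 1 := by
    have h2 := sem_pvar i
    have ht' := ht
    simp only [pvar, List.mem_singleton] at ht
    rw [pvar, sem_cons, sem_nil, add_zero, toQ_qnat, Nat.cast_one] at h2
    subst ht
    exact monomial_left_injective (one_ne_zero (α := ℚ)) h2
  rw [← h, ← h1, monO_apply]

lemma hasExponent_rp (l : RealCode) : HasExponent (rp l) 0 := by
  induction l with
  | nil => intro t ht; simp [rp] at ht
  | cons c l ih =>
    have : rp (c :: l) = pconst c ++ pmul (pvar 0) (rp l) := rfl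
    rw [this]
    refine (hasExponent_pconst c).append ?_
    rw [← add_zero (0 : ℕ →₀ ℕ)]
    exact (hasExponent_of_pvar fun j => by simp).mul ih

lemma hasExponent_num (z : CNum) : HasExponent (num z) 0 := by
  refine (hasExponent_rp _).append ?_
  rw [← add_zero (0 : ℕ →₀ ℕ)]
  exact (hasExponent_of_pvar fun j => by simp).mul (hasExponent_rp _)

/-- Exponents of individual terms are recorded because `avoids` and `exceeds` inspect the terms of a
list, including those which would cancel in the sum. -/
lemma exists_code_monomial (θ : QBar) (m : ℕ →₀ ℕ) :
    ∃ q, ev θ q = monomial m 1 ∧ HasExponent q m := by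
  induction m using Finsupp.induction_linear with
  | zero => exact ⟨pconst (qnat 1), by rw [ev_pconst, toQ_qnat]; simp, hasExponent_pconst _⟩
  | add m m' h h' =>
    obtain ⟨q, hq, he⟩ := h
    obtain ⟨q', hq', he'⟩ := h'
    exact ⟨pmul q q', by rw [ev_pmul, hq, hq', monomial_mul, one_mul], he.mul he'⟩
  | single i k =>
    induction k with
    | zero =>
      rw [Finsupp.single_zero]
      exact ⟨pconst (qnat 1), by rw [ev_pconst, toQ_qnat]; simp, hasExponent_pconst _⟩
    | succ k ih =>
      obtain ⟨q, hq, he⟩ := ih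
      refine ⟨pmul q (pvar (i + 2)), ?_, ?_⟩
      · rw [ev_pmul, hq, ev_pvar_add_two, X, monomial_mul, Finsupp.single_add, one_mul]
      · rw [Finsupp.single_add]
        exact he.mul (hasExponent_of_pvar fun j => by simp [Finsupp.single_apply])

/-- Every polynomial is represented by a code without superfluous terms. -/
lemma eventually_ev (F : MvPolynomial ℕ QBar) : ∀ᶠ θ in large, ∃ q, ev θ q = F ∧
    ∀ t ∈ q, ∃ m ∈ F.support, ∀ i, t.2.getD (i + 2) 0 = m i := by
  classical
  have h1 : ∀ᶠ θ in large, ∀ m ∈ F.support, ∃ c, cval θ c = coeff m F :=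
    (Finset.eventually_all _).mpr fun m _ => eventually_cval _
  filter_upwards [h1] with θ hθ
  suffices H : ∀ s ⊆ F.support, ∃ q, ev θ q = ∑ m ∈ s, monomial m (coeff m F) ∧
      ∀ t ∈ q, ∃ m ∈ F.support, ∀ i, t.2.getD (i + 2) 0 = m i by
    obtain ⟨q, hq, h⟩ := H F.support le_rfl
    exact ⟨q, by rw [hq]; exact F.support_sum_monomial_coeff, h⟩
  intro s
  induction s using Finset.induction_on with
  | empty => exact fun _ => ⟨[], by simp [ev_nil], by simp⟩
  | insert m s hm ih =>
    intro hs
    obtain ⟨q, hq, h⟩ := ih ((Finset.subset_insert _ _).trans hs)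
    have hmF := hs (Finset.mem_insert_self m s)
    obtain ⟨c, hc⟩ := hθ m hmF
    obtain ⟨q', hq', h'⟩ := exists_code_monomial θ m
    refine ⟨pmul (num c) q' ++ q, ?_, ?_⟩
    · rw [ev_append, ev_pmul, ev_num, hq', hq, Finset.sum_insert hm, hc, C_mul_monomial, mul_one]
    · intro t ht
      rcases List.mem_append.mp ht with ht | ht
      · refine ⟨m, hmF, fun i => ?_⟩
        have := ((hasExponent_num c).mul h') t ht i
        rwa [zero_add] at this
      · exact h t ht

lemma exists_specialize_monomial (θ : QBar) (e : ℕ →₀ ℕ) (c : ℚ) (m : ℕ →₀ ℕ)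
    (hm : ∀ i, e (i + 2) = m i) : ∃ a, specialize θ (monomial e c) = monomial m a := by
  induction e using Finsupp.induction_linear generalizing c m with
  | zero =>
    have : m = 0 := by ext i; rw [← hm]; rfl
    subst this
    exact ⟨algebraMap ℚ QBar c, by
      rw [show (monomial 0 c : MvPolynomial ℕ ℚ) = C c from rfl, specialize, aeval_C]; rfl⟩
  | add e e' h h' =>
    have hcd (e : ℕ →₀ ℕ) : ∃ m : ℕ →₀ ℕ, ∀ i, e (i + 2) = m i :=
      ⟨e.comapDomain (· + 2) (add_left_injective 2).injOn, fun i => rfl⟩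
    obtain ⟨m1, hm1⟩ := hcd e
    obtain ⟨m2, hm2⟩ := hcd e'
    obtain ⟨a, ha⟩ := h 1 m1 hm1
    obtain ⟨b, hb⟩ := h' c m2 hm2
    have : m = m1 + m2 := by ext i; rw [← hm]; simp [hm1, hm2]
    subst this
    exact ⟨a * b, by rw [← one_mul c, ← monomial_mul, map_mul, ha, hb, monomial_mul]⟩
  | single i k =>
    rw [← C_mul_X_pow_eq_monomial, map_mul, map_pow]
    have hC : specialize θ (C c) = C (algebraMap ℚ QBar c) := by rw [specialize, aeval_C]; rfl
    rw [hC]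
    rcases i with _ | _ | i
    · have : m = 0 := by ext i; rw [← hm]; simp
      subst this
      refine ⟨algebraMap ℚ QBar c * θ ^ k, ?_⟩
      rw [specialize, aeval_X]
      simp only [← map_pow, ← map_mul]
      rfl
    · have : m = 0 := by ext i; rw [← hm]; simp
      subst this
      refine ⟨algebraMap ℚ QBar c * imUnit ^ k, ?_⟩
      rw [specialize, aeval_X]
      simp only [← map_pow, ← map_mul]
      rfl
    · have : m = Finsupp.single i k := by ext j; rw [← hm]; simp [Finsupp.single_apply]
      subst this
      refine ⟨algebraMap ℚ QBar c, ?_⟩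
      rw [specialize, aeval_X]
      exact C_mul_X_pow_eq_monomial

/-- Cancellation can only shrink the support, so a condition checked on all terms holds on the
support. -/
lemma exists_term_of_mem_support (θ : QBar) (q : MPoly) :
    ∀ m ∈ (ev θ q).support, ∃ t ∈ q, ∀ i, t.2.getD (i + 2) 0 = m i := by
  classical
  induction q with
  | nil => simp [ev_nil]
  | cons t q ih =>
    intro m hm
    have h1 : ev θ (t :: q) = specialize θ (monomial (monO t.2) (toQ t.1)) + ev θ q := by
      rw [ev, sem_cons, map_add]; rfl
    rw [h1] at hm
    rcases Finset.mem_union.mp (support_add hm) with h | h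
    · obtain ⟨a, ha⟩ := exists_specialize_monomial θ (monO t.2) (toQ t.1)
        ((monO t.2).comapDomain (· + 2) (add_left_injective 2).injOn) fun _ => rfl
      rw [ha] at h
      have h2 := support_monomial_subset h
      rw [Finset.mem_singleton] at h2
      subst h2
      exact ⟨t, by simp, fun i => rfl⟩
    · obtain ⟨s, hs, h⟩ := ih m h
      exact ⟨s, by simp [hs], h⟩

/-! ### Lists as indexed families -/

lemma sum_map_range {M : Type} [AddCommMonoid M] (n : ℕ) (f : ℕ → M) :
    ((List.range n).map f).sum = ∑ i : Fin n, f i := by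
  induction n with
  | zero => simp
  | succ n ih => simp [List.range_succ, Fin.sum_univ_castSucc, ih]

lemma prod_map_range {M : Type} [CommMonoid M] (n : ℕ) (f : ℕ → M) :
    ((List.range n).map f).prod = ∏ i : Fin n, f i := by
  induction n with
  | zero => simp
  | succ n ih => simp [List.range_succ, Fin.prod_univ_castSucc, ih]

lemma getD_map_range {β : Type} (n : ℕ) (f : ℕ → β) (d : β) {i : ℕ} (hi : i < n) :
    ((List.range n).map f).getD i d = f i := by
  simp [List.getD_eq_getElem?_getD, hi]

lemma ev_psum_range (θ : QBar) (n : ℕ) (f : ℕ → MPoly) :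
    ev θ (psum ((List.range n).map f)) = ∑ i : Fin n, ev θ (f i) := by
  rw [ev_psum, List.map_map, ← sum_map_range n fun i => ev θ (f i)]
  rfl

lemma ev_pprod_range (θ : QBar) (n : ℕ) (f : ℕ → MPoly) :
    ev θ (pprod ((List.range n).map f)) = ∏ i : Fin n, ev θ (f i) := by
  rw [ev_pprod, List.map_map, ← prod_map_range n fun i => ev θ (f i)]
  rfl

/-! ### Annotated input -/

/-- The code of `(n + 1) ^ 2` times the squared distance from the centre of the disc. -/
def distCode (c : NumberCode) (z : CNum) : MPoly :=
  ppow (psub (pmul (pconst (qnat (c.2.2.2 + 1))) (rp z.1)) (pconst (qint c.2.1))) 2 ++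
  ppow (psub (pmul (pconst (qnat (c.2.2.2 + 1))) (rp z.2)) (pconst (qint c.2.2.1))) 2

/-- A term together with the number which occurs in it, and with a positive square root and its
inverse which show that the number lies in the disc. -/
abbrev AnnTerm : Type := TermCode × CNum × RealCode × RealCode

/-- The equations of a number which is a root in the disc. -/
def numberEqs (c : NumberCode) (d : CNum × RealCode × RealCode) : List MPoly :=
  [cev c.1 (num d.1),
    psub (psub (pconst (qnat 1)) (distCode c d.1)) (ppow (rp d.2.1) 2),
    psub (pmul (rp d.2.1) (rp d.2.2)) (pconst (qnat 1))]

def systemEqs (A : List (List AnnTerm)) : List MPoly :=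
  A.flatten.flatMap fun a => numberEqs a.1.1 a.2

/-- Removal of the annotations. -/
def forget (A : List (List AnnTerm)) : SchemeCode := A.map fun l => l.map fun a => a.1

noncomputable def termVal (θ : QBar) (r : ℕ) (a : AnnTerm) : MvPolynomial (Fin r) QBar :=
  C (cval θ a.2.1) * ∏ i : Fin r, X i ^ a.1.2.getD i 0

noncomputable def polyVal (θ : QBar) (r : ℕ) (l : List AnnTerm) : MvPolynomial (Fin r) QBar :=
  (l.map (termVal θ r)).sum

noncomputable def sysVal (θ : QBar) (r : ℕ) (A : List (List AnnTerm)) :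
    List (MvPolynomial (Fin r) QBar) := A.map (polyVal θ r)

/-- The code of the value of an annotated polynomial at given arguments. -/
def annPoly (r : ℕ) (args : List MPoly) (l : List AnnTerm) : MPoly :=
  psum (l.map fun a => pmul (num a.2.1)
    (pprod ((List.range r).map fun j => ppow (args.getD j []) (a.1.2.getD j 0))))

lemma ev_annPoly (θ : QBar) (r : ℕ) (args : List MPoly) (l : List AnnTerm) :
    ev θ (annPoly r args l) =
      aeval (fun i : Fin r => ev θ (args.getD i [])) (polyVal θ r l) := by
  rw [annPoly, ev_psum, polyVal, map_list_sum, List.map_map, List.map_map]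
  congr 1
  refine List.map_congr_left fun a _ => ?_
  simp only [Function.comp_apply, termVal, map_mul, ev_pmul, ev_num, ev_pprod_range, ev_ppow,
    map_prod, map_pow, aeval_X, algHom_C, algebraMap_eq]

lemma IsRealAlg.coe_eq {z : QBar} (hz : IsRealAlg z) : (z : ℂ) = (((z : ℂ).re : ℝ) : ℂ) :=
  Complex.ext rfl (by simpa [IsRealAlg] using hz)

/-- Clearing the denominator and squaring makes the condition polynomial in the real and imaginary
part. -/
lemma norm_sub_center_lt_iff (x y : ℝ) (a b : ℤ) (n : ℕ) :
    ‖((x : ℂ) + Complex.I * y) - (a + b * Complex.I) / (n + 1)‖ < 1 / (n + 1) ↔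
      ((n + 1) * x - a) ^ 2 + ((n + 1) * y - b) ^ 2 < 1 := by
  have hn : (0 : ℝ) < (n : ℝ) + 1 := by positivity
  have hn' : ((n : ℂ) + 1) ≠ 0 := by exact_mod_cast hn.ne'
  have h1 : ((x : ℂ) + Complex.I * y) - (a + b * Complex.I) / (n + 1) =
      ((((n + 1) * x - a : ℝ) : ℂ) + (((n + 1) * y - b : ℝ) : ℂ) * Complex.I) /
        (((n : ℝ) + 1 : ℝ) : ℂ) := by
    push_cast
    field_simp
    ring
  rw [h1, norm_div, Complex.norm_real, Real.norm_of_nonneg hn.le, div_lt_div_iff_of_pos_right hn,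
    Complex.norm_add_mul_I, Real.sqrt_lt' one_pos, one_pow]

lemma ev_distCode (θ : QBar) (c : NumberCode) (z : CNum) : ev θ (distCode c z) =
    C (((c.2.2.2 + 1) * rval θ z.1 - c.2.1) ^ 2 + ((c.2.2.2 + 1) * rval θ z.2 - c.2.2.1) ^ 2) := by
  simp only [distCode, ev_append, ev_ppow, ev_psub, ev_pmul, ev_pconst, ev_rp, toQ_qnat, toQ_qint]
  simp

/-- `z` is a root in the disc given by `c`. -/
def IsDiscRoot (c : NumberCode) (z : ℂ) : Prop :=
  Polynomial.aeval z (polyOfList c.1) = 0 ∧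
    ‖z - (c.2.1 + c.2.2.1 * Complex.I) / (c.2.2.2 + 1)‖ < 1 / (c.2.2.2 + 1)

lemma NumberCode.Represents.eq {c : NumberCode} {z : QBar} (h : c.Represents z) {w : QBar}
    (hw : IsDiscRoot c w) : w = z :=
  Subtype.ext ((h.2 w).mp hw)

lemma NumberCode.Represents.isDiscRoot {c : NumberCode} {z : QBar} (h : c.Represents z) :
    IsDiscRoot c z := (h.2 z).mpr rfl

lemma aeval_coe_polyOfList (z : QBar) (c : List ℤ) :
    Polynomial.aeval (z : ℂ) (polyOfList c) =
      ((Polynomial.aeval z (polyOfList c) : QBar) : ℂ) :=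
  Polynomial.aeval_algebraMap_apply ℂ z _

lemma coe_cval (θ : QBar) (hθ : IsRealAlg θ) (z : CNum) : ((cval θ z : QBar) : ℂ) =
    (((rval θ z.1 : ℂ).re : ℝ) : ℂ) + Complex.I * (((rval θ z.2 : ℂ).re : ℝ) : ℂ) := by
  rw [← (isRealAlg_rval hθ z.1).coe_eq, ← (isRealAlg_rval hθ z.2).coe_eq]
  rfl

lemma coe_dist {x y : QBar} (hx : IsRealAlg x) (hy : IsRealAlg y) (a b : ℤ) (n : ℕ) :
    (((((n : QBar) + 1) * x - a) ^ 2 + ((n + 1) * y - b) ^ 2 : QBar) : ℂ) =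
      ((((n + 1) * (x : ℂ).re - a) ^ 2 + ((n + 1) * (y : ℂ).re - b) ^ 2 : ℝ) : ℂ) := by
  have h1 : (((((n : QBar) + 1) * x - a) ^ 2 + ((n + 1) * y - b) ^ 2 : QBar) : ℂ) =
    (((n : ℂ) + 1) * x - a) ^ 2 + ((n + 1) * y - b) ^ 2 := by
    push_cast; rfl
  rw [h1]
  conv_lhs => rw [hx.coe_eq, hy.coe_eq]
  push_cast
  rfl
-- The second equation says `1 - dist = s ^ 2` and the third that `s` is invertible. As `θ` is real,
-- so is `s`, hence `s ^ 2 > 0` and the point is strictly inside the disc.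
lemma isDiscRoot_of_numberEqs {θ : QBar} (hθ : IsRealAlg θ) {c : NumberCode}
    {d : CNum × RealCode × RealCode} (h : ∀ e ∈ numberEqs c d, ev θ e = 0) :
    IsDiscRoot c (cval θ d.1) := by
  simp only [numberEqs, List.mem_cons, List.not_mem_nil, or_false, forall_eq_or_imp, forall_eq,
    ev_cev, ev_psub, ev_num, ev_pconst, toQ_qnat, ev_distCode, ev_ppow, ev_pmul, ev_rp] at h
  obtain ⟨h1, h2, h3⟩ := h
  rw [← algebraMap_eq, Polynomial.aeval_algebraMap_apply, algebraMap_eq, C_eq_zero] at h1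
  refine ⟨by rw [aeval_coe_polyOfList, h1]; rfl, ?_⟩
  rw [coe_cval θ hθ, norm_sub_center_lt_iff]
  have h4 : (((c.2.2.2 : QBar) + 1) * rval θ d.1.1 - c.2.1) ^ 2 +
      ((c.2.2.2 + 1) * rval θ d.1.2 - c.2.2.1) ^ 2 = 1 - rval θ d.2.1 ^ 2 := by
    rw [← map_pow, ← map_sub, ← map_sub, C_eq_zero] at h2
    push_cast at h2
    linear_combination -h2
  have h5 : rval θ d.2.1 ≠ 0 := by
    intro h0
    rw [h0] at h3
    simp at h3
  have h6 : ((_ : QBar) : ℂ) = ((_ : QBar) : ℂ) := congrArg (fun z : QBar => (z : ℂ)) h4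
  have hs := isRealAlg_rval hθ d.2.1
  rw [coe_dist (isRealAlg_rval hθ _) (isRealAlg_rval hθ _)] at h6
  have h7 : ((1 - rval θ d.2.1 ^ 2 : QBar) : ℂ) =
      ((1 - ((rval θ d.2.1 : ℂ).re) ^ 2 : ℝ) : ℂ) := by
    push_cast
    rw [← hs.coe_eq]
  rw [h7, Complex.ofReal_inj] at h6
  rw [h6]
  have h8 : (rval θ d.2.1 : ℂ).re ≠ 0 := by
    intro h0
    refine h5 (Subtype.ext ?_)
    rw [hs.coe_eq, h0]
    simp
  have := pow_pos (abs_pos.mpr h8) 2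
  rw [sq_abs] at this
  linarith

/-- Real and imaginary parts as algebraic numbers. -/
lemma exists_re_im (z : QBar) : ∃ x y : QBar, IsRealAlg x ∧ IsRealAlg y ∧ z = x + imUnit * y := by
  obtain ⟨h1, h2⟩ := isAlgebraic_re_im z
  refine ⟨⟨(((z : ℂ).re : ℝ) : ℂ), mem_algebraicClosure_iff.mpr (h1.algebraMap (A := ℂ))⟩,
    ⟨(((z : ℂ).im : ℝ) : ℂ), mem_algebraicClosure_iff.mpr (h2.algebraMap (A := ℂ))⟩,
    Complex.ofReal_im _, Complex.ofReal_im _, Subtype.ext ?_⟩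
  refine (Complex.re_add_im (z : ℂ)).symm.trans ?_
  rw [mul_comm]
  rfl

/-- Square roots of nonnegative real algebraic numbers. -/
lemma exists_sqrt {x : QBar} (hx : IsRealAlg x) (h0 : 0 ≤ (x : ℂ).re) :
    ∃ s : QBar, IsRealAlg s ∧ s ^ 2 = x := by
  have h1 : ((Real.sqrt (x : ℂ).re : ℝ) : ℂ) ^ 2 = (x : ℂ) := by
    rw [← Complex.ofReal_pow, Real.sq_sqrt h0]
    exact hx.coe_eq.symm
  have h2 : IsAlgebraic ℚ ((Real.sqrt (x : ℂ).re : ℝ) : ℂ) := by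
    refine IsAlgebraic.of_pow two_pos ?_
    rw [h1]
    exact mem_algebraicClosure_iff.mp x.2
  exact ⟨⟨_, mem_algebraicClosure_iff.mpr h2⟩, Complex.ofReal_im _, Subtype.ext h1⟩

/-- `(n + 1) ^ 2` times the squared distance from the centre of the disc. -/
noncomputable def discDist (c : NumberCode) (x y : QBar) : QBar :=
  ((c.2.2.2 + 1) * x - c.2.1) ^ 2 + ((c.2.2.2 + 1) * y - c.2.2.1) ^ 2

lemma discDist_re {x y : QBar} (hx : IsRealAlg x) (hy : IsRealAlg y) (c : NumberCode) :
    IsRealAlg (discDist c x y) ∧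
    ((‖((x + imUnit * y : QBar) : ℂ) - (c.2.1 + c.2.2.1 * Complex.I) / (c.2.2.2 + 1)‖ <
      1 / (c.2.2.2 + 1)) ↔ (discDist c x y : ℂ).re < 1) := by
  have h1 := coe_dist hx hy c.2.1 c.2.2.1 c.2.2.2
  have h2 : ((x + imUnit * y : QBar) : ℂ) =
      (((x : ℂ).re : ℝ) : ℂ) + Complex.I * (((y : ℂ).re : ℝ) : ℂ) := by
    rw [← hx.coe_eq, ← hy.coe_eq]
    rfl
  constructor
  · rw [IsRealAlg, discDist, h1, Complex.ofReal_im]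
  · rw [h2, norm_sub_center_lt_iff, discDist, h1, Complex.ofReal_re]

/-- The auxiliary number is the square root of the positive algebraic number `1 - dist`; a
sufficiently large field contains it and its inverse. -/
lemma eventually_numberEqs {c : NumberCode} {z : QBar} (hz : IsDiscRoot c z) :
    ∀ᶠ θ in large, ∃ d, cval θ d.1 = z ∧ ∀ e ∈ numberEqs c d, ev θ e = 0 := by
  obtain ⟨x, y, hx, hy, rfl⟩ := exists_re_im z
  obtain ⟨hr, hd⟩ := discDist_re hx hy c
  have hlt := hd.mp hz.2
  have hre : IsRealAlg (1 - discDist c x y) := by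
    simp only [IsRealAlg] at hr ⊢
    simp [hr]
  have hpos : 0 < ((1 - discDist c x y : QBar) : ℂ).re := by
    simpa using hlt
  obtain ⟨s, hs, hsq⟩ := exists_sqrt hre hpos.le
  have hs0 : s ≠ 0 := by
    rintro rfl
    rw [← hsq] at hpos
    simp at hpos
  have hs' : IsRealAlg s⁻¹ := by
    have h1 : ((s⁻¹ : QBar) : ℂ) = (s : ℂ)⁻¹ := rfl
    rw [IsRealAlg, h1, hs.coe_eq, ← Complex.ofReal_inv, Complex.ofReal_im]
  filter_upwards [eventually_rval hx, eventually_rval hy, eventually_rval hs,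
    eventually_rval hs'] with θ h1 h2 h3 h4
  obtain ⟨α, rfl⟩ := h1
  obtain ⟨β, rfl⟩ := h2
  obtain ⟨σ, rfl⟩ := h3
  obtain ⟨τ, hτ⟩ := h4
  refine ⟨((α, β), σ, τ), rfl, ?_⟩
  simp only [numberEqs, List.mem_cons, List.not_mem_nil, or_false, forall_eq_or_imp, forall_eq,
    ev_cev, ev_psub, ev_num, ev_pconst, toQ_qnat, ev_distCode, ev_ppow, ev_pmul, ev_rp]
  refine ⟨?_, ?_, ?_⟩
  · rw [← algebraMap_eq, Polynomial.aeval_algebraMap_apply, algebraMap_eq, C_eq_zero]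
    refine Subtype.ext ?_
    rw [← aeval_coe_polyOfList]
    exact hz.1
  · rw [← map_pow, ← map_sub, ← map_sub, C_eq_zero, hsq, discDist]
    push_cast
    ring
  · rw [hτ, ← map_mul, ← map_sub, C_eq_zero, mul_inv_cancel₀ hs0]
    simp

/-! ### Codes without a root in the disc -/

/-- The equations which show that the roots of a polynomial are outside the disc. -/
def noRootEqs (c : NumberCode) (d : RatCode × List (CNum × RealCode)) : List MPoly :=
  psub (cev c.1 (pvar 2)) (pmul (pconst d.1)
    (pprod (d.2.map fun z => psub (pvar 2) (num z.1)))) ::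
  d.2.map fun z => psub (psub (distCode c z.1) (pconst (qnat 1))) (ppow (rp z.2) 2)

/-- The equations split the polynomial into linear factors and put every root at squared distance `1
+ s ^ 2 ≥ 1` from the centre, in the scale of the disc. -/
lemma not_represents_of_noRootEqs {θ : QBar} (hθ : IsRealAlg θ) {c : NumberCode}
    {d : RatCode × List (CNum × RealCode)} (h : ∀ e ∈ noRootEqs c d, ev θ e = 0) (z : QBar) :
    ¬ c.Represents z := by
  intro hc
  have hroot := hc.isDiscRoot
  simp only [noRootEqs, List.mem_cons, List.mem_map, forall_eq_or_imp, forall_exists_index,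
    and_imp, forall_apply_eq_imp_iff₂] at h
  obtain ⟨h1, h2⟩ := h
  rw [ev_psub, ev_cev, ev_pmul, ev_pconst, ev_pprod, List.map_map,
    show ev θ (pvar 2) = X 0 from ev_pvar_add_two θ 0] at h1
  -- The code variable `2` is the first free one and plays the part of the indeterminate; it is now
  -- replaced by `w`.
  have key (w : QBar) : Polynomial.aeval w (polyOfList c.1) =
      (toQ d.1 : QBar) * (d.2.map fun z => w - cval θ z.1).prod := by
    have h3 := congrArg (aeval fun _ : ℕ => w) h1
    have h4 (f : Polynomial ℤ) : aeval (fun _ : ℕ => w)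
        (Polynomial.aeval (X 0 : MvPolynomial ℕ QBar) f) = Polynomial.aeval w f := by
      have h5 := Polynomial.aeval_algHom_apply
        (aeval fun _ : ℕ => w : MvPolynomial ℕ QBar →ₐ[QBar] QBar).toRingHom.toIntAlgHom (X 0) f
      have h6 : (aeval fun _ : ℕ => w : MvPolynomial ℕ QBar →ₐ[QBar] QBar).toRingHom.toIntAlgHom
        (X 0) = w := aeval_X _ _
      rw [h6] at h5
      exact h5.symm
    rw [map_zero, map_sub, map_mul, h4, map_list_prod, List.map_map, sub_eq_zero, aeval_C] at h3
    rw [h3]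
    congr 2
    refine List.map_congr_left fun z _ => ?_
    simp only [Function.comp_apply, ev_psub, ev_num, map_sub, aeval_C,
      show ev θ (pvar 2) = X 0 from ev_pvar_add_two θ 0, aeval_X]
    rfl
  have hz0 : Polynomial.aeval z (polyOfList c.1) = 0 := by
    refine Subtype.ext ?_
    rw [← aeval_coe_polyOfList]
    exact hroot.1
  -- A zero leading coefficient would make the polynomial vanish identically, which a represented
  -- number excludes.
  have hlc : (toQ d.1 : QBar) ≠ 0 := by
    intro h0
    refine hc.1 ?_
    have h3 : (polyOfList c.1).map (Int.castRingHom QBar) = 0 := by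
      refine Polynomial.funext fun w => ?_
      have := key w
      rw [h0, zero_mul, Polynomial.aeval_def] at this
      rw [Polynomial.eval_map, Polynomial.eval_zero]
      exact this
    exact (Polynomial.map_eq_zero_iff (RingHom.injective_int _)).mp h3
  rw [key, mul_eq_zero, or_iff_right hlc, List.prod_eq_zero_iff, List.mem_map] at hz0
  obtain ⟨y, hy, hyz⟩ := hz0
  have hzy : z = rval θ y.1.1 + imUnit * rval θ y.1.2 := sub_eq_zero.mp hyz
  obtain ⟨hr, hd⟩ := discDist_re (isRealAlg_rval hθ y.1.1) (isRealAlg_rval hθ y.1.2) c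
  rw [← hzy] at hd
  have hlt := hd.mp hroot.2
  have h3 := h2 y hy
  rw [ev_psub, ev_psub, ev_distCode, ev_pconst, ev_ppow, ev_rp, ← map_pow, ← map_sub, ← map_sub,
    C_eq_zero, toQ_qnat] at h3
  have h4 : discDist c (rval θ y.1.1) (rval θ y.1.2) = 1 + rval θ y.2 ^ 2 := by
    rw [discDist]
    push_cast at h3
    linear_combination h3
  have h5 : (discDist c (rval θ y.1.1) (rval θ y.1.2) : ℂ) =
      ((1 + ((rval θ y.2 : ℂ).re) ^ 2 : ℝ) : ℂ) := by
    rw [h4]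
    push_cast
    rw [← (isRealAlg_rval hθ y.2).coe_eq]
  rw [h5, Complex.ofReal_re] at hlt
  nlinarith [sq_nonneg (rval θ y.2 : ℂ).re]

lemma eventually_all_mem_list {β : Type} (L : List β) {P : β → QBar → Prop}
    (h : ∀ b ∈ L, ∀ᶠ θ in large, P b θ) : ∀ᶠ θ in large, ∀ b ∈ L, P b θ := by
  induction L with
  | nil => simp
  | cons a L ih =>
    filter_upwards [h a (by simp), ih fun b hb => h b (by simp [hb])] with θ h1 h2
    simpa using ⟨h1, h2⟩

lemma eventually_noRootEqs {c : NumberCode} (hc : ∀ z : QBar, ¬ IsDiscRoot c z) :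
    ∀ᶠ θ in large, ∃ d, ∀ e ∈ noRootEqs c d, ev θ e = 0 := by
  let p : Polynomial QBar := (polyOfList c.1).map (Int.castRingHom QBar)
  -- For the zero polynomial the centre of the disc would be a root in the disc.
  have hp : p ≠ 0 := by
    intro h0
    have hn : ((c.2.2.2 : QBar) + 1) ≠ 0 := by
      have : (((c.2.2.2 + 1 : ℕ) : ℕ) : QBar) ≠ 0 := Nat.cast_ne_zero.mpr (by omega)
      simpa using this
    refine hc ((c.2.1 + c.2.2.1 * imUnit) / (c.2.2.2 + 1)) ⟨?_, ?_⟩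
    · rw [(Polynomial.map_eq_zero_iff (RingHom.injective_int _)).mp h0, map_zero]
    · have : (((c.2.1 + c.2.2.1 * imUnit) / (c.2.2.2 + 1) : QBar) : ℂ) =
        (c.2.1 + c.2.2.1 * Complex.I) / (c.2.2.2 + 1) := by
        rw [← coe_imUnit]; push_cast; rfl
      rw [this, sub_self, norm_zero]
      positivity
  have hcl : IsAlgClosed QBar := (algebraicClosure.isAlgClosure ℚ ℂ).isAlgClosed
  have hroots := (IsAlgClosed.splits p).eq_prod_roots
  obtain ⟨L, hL⟩ := Quotient.exists_rep p.roots
  have hL : (L : Multiset QBar) = p.roots := hL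
  have h1 : ∀ z ∈ L, ∀ᶠ θ in large, ∃ y : CNum × RealCode, cval θ y.1 = z ∧
      ev θ (psub (psub (distCode c y.1) (pconst (qnat 1))) (ppow (rp y.2) 2)) = 0 := by
    intro z hz
    have hz0 : p.eval z = 0 := by
      have : z ∈ p.roots := by rw [← hL]; exact hz
      exact (Polynomial.mem_roots hp).mp this
    have hz1 : Polynomial.aeval (z : ℂ) (polyOfList c.1) = 0 := by
      rw [aeval_coe_polyOfList, Polynomial.aeval_def]
      rw [Polynomial.eval_map] at hz0
      exact congrArg (fun z : QBar => (z : ℂ)) hz0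
    obtain ⟨x, y, hx, hy, rfl⟩ := exists_re_im z
    obtain ⟨hr, hd⟩ := discDist_re hx hy c
    have hge : 1 ≤ (discDist c x y : ℂ).re := by
      by_contra hcon
      exact hc _ ⟨hz1, hd.mpr (not_le.mp hcon)⟩
    have hre : IsRealAlg (discDist c x y - 1) := by
      simp only [IsRealAlg] at hr ⊢
      simp [hr]
    obtain ⟨s, hs, hsq⟩ := exists_sqrt hre (by simpa using hge)
    filter_upwards [eventually_rval hx, eventually_rval hy, eventually_rval hs] with θ h1 h2 h3
    obtain ⟨α, rfl⟩ := h1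
    obtain ⟨β, rfl⟩ := h2
    obtain ⟨σ, rfl⟩ := h3
    refine ⟨((α, β), σ), rfl, ?_⟩
    rw [ev_psub, ev_psub, ev_distCode, ev_pconst, ev_ppow, ev_rp, ← map_pow, ← map_sub, ← map_sub,
      C_eq_zero, toQ_qnat, hsq, discDist]
    push_cast
    ring
  obtain ⟨q, hq⟩ : ∃ q : ℚ, (q : QBar) = p.leadingCoeff := by
    refine ⟨((polyOfList c.1).leadingCoeff : ℤ), ?_⟩
    rw [Polynomial.leadingCoeff_map_of_injective (RingHom.injective_int _)]
    simp
  obtain ⟨lc, rfl⟩ := toQ_surjective q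
  filter_upwards [eventually_all_mem_list L h1] with θ hθ
  choose! f hf using hθ
  refine ⟨(lc, L.map f), ?_⟩
  simp only [noRootEqs, List.mem_cons, List.mem_map, forall_eq_or_imp, forall_exists_index,
    and_imp, forall_apply_eq_imp_iff₂]
  refine ⟨?_, fun z hz => (hf z hz).2⟩
  rw [ev_psub, ev_cev, ev_pmul, ev_pconst, ev_pprod, List.map_map, List.map_map,
    show ev θ (pvar 2) = X 0 from ev_pvar_add_two θ 0, sub_eq_zero]
  have h2 := congrArg (Polynomial.aeval (X 0 : MvPolynomial ℕ QBar)) hroots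
  have h3 : Polynomial.aeval (X 0 : MvPolynomial ℕ QBar) p =
      Polynomial.aeval (X 0) (polyOfList c.1) :=
    Polynomial.aeval_map_algebraMap QBar (X 0) (polyOfList c.1)
  rw [← h3, h2, map_mul, Polynomial.aeval_C, hq, ← hL, Multiset.map_coe, Multiset.prod_coe,
    map_list_prod, List.map_map]
  congr 2
  refine List.map_congr_left fun z hz => ?_
  simp only [Function.comp_apply, ev_psub, ev_num, (hf z hz).1,
    show ev θ (pvar 2) = X 0 from ev_pvar_add_two θ 0, map_sub, Polynomial.aeval_X,
    Polynomial.aeval_C, algebraMap_eq]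

end ProjEquiv

namespace ProjEquiv
open MvPolynomial Filter

/-! ### Matrices of codes -/

/-- An entry of a matrix of codes. -/
def ent (M : List (List MPoly)) (j l : ℕ) : MPoly := (M.getD j []).getD l []

/-- The codes of the coordinates. -/
def coordCodes (r : ℕ) : List MPoly := (List.range r).map fun j => pvar (3 * j + 2)

/-- The codes of the translated coordinates. -/
def shiftCodes (r : ℕ) (p : List CNum) : List MPoly :=
  (List.range r).map fun l => num (p.getD l ([], [])) ++ pvar (3 * l + 2)

/-- The code of a generic matrix. -/
def genericMatrix (o r : ℕ) : List (List MPoly) :=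
  (List.range r).map fun j => (List.range r).map fun l => pvar (gvar o j l + 2)

/-- The code of a matrix of numbers. -/
def constMatrix (G : List (List CNum)) : List (List MPoly) := G.map fun l => l.map num

/-- The codes of the image of a vector under a matrix. -/
def mulVecCodes (r : ℕ) (M : List (List MPoly)) (args : List MPoly) : List MPoly :=
  (List.range r).map fun j => psum ((List.range r).map fun l => pmul (ent M j l) (args.getD l []))

/-- The code of an entry of `M * M' - 1`. -/
def relationCode (r : ℕ) (M M' : List (List MPoly)) (i j : ℕ) : MPoly :=
  psub (psum ((List.range r).map fun l => pmul (ent M i l) (ent M' l j)))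
    (pconst (bif decide (i = j) then qnat 1 else qnat 0))

section
variable (θ : QBar) {r : ℕ}

lemma ev_coordCodes (j : Fin r) :
    ev θ ((coordCodes r).getD j []) = X (3 * (j : ℕ)) := by
  rw [coordCodes, getD_map_range _ _ _ j.2, ev_pvar_add_two]

lemma ev_shiftCodes (p : List CNum) :
    (fun l : Fin r => ev θ ((shiftCodes r p).getD l [])) =
      shiftArgs fun l : Fin r => cval θ (p.getD l ([], [])) := by
  funext l
  rw [shiftCodes, getD_map_range _ _ _ l.2, ev_append, ev_num, ev_pvar_add_two, shiftArgs]

lemma ent_genericMatrix (o : ℕ) (j l : Fin r) :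
    ent (genericMatrix o r) j l = pvar (gvar o j l + 2) := by
  rw [ent, genericMatrix, getD_map_range _ _ _ j.2, getD_map_range _ _ _ l.2]

lemma ent_constMatrix (G : List (List CNum)) (j l : ℕ) :
    ent (constMatrix G) j l = num ((G.getD j []).getD l ([], [])) := by
  have h1 : (constMatrix G).getD j [] = (G.getD j []).map num := by
    rw [constMatrix]
    exact List.getD_map G [] fun l : List CNum => l.map num
  rw [ent, h1]
  exact List.getD_map (G.getD j []) ([], []) num

lemma ev_mulVecCodes (M : List (List MPoly)) (args : List MPoly) (j : Fin r) :
    ev θ ((mulVecCodes r M args).getD j []) =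
      ∑ l : Fin r, ev θ (ent M j l) * ev θ (args.getD l []) := by
  rw [mulVecCodes, getD_map_range _ _ _ j.2, ev_psum_range]
  simp only [ev_pmul]

lemma ev_mulVecCodes_genericMatrix (o : ℕ) (p : List CNum) :
    (fun j : Fin r => ev θ ((mulVecCodes r (genericMatrix o r) (shiftCodes r p)).getD j [])) =
      linArgs o (shiftArgs fun l : Fin r => cval θ (p.getD l ([], []))) := by
  funext j
  rw [ev_mulVecCodes, linArgs, ← ev_shiftCodes]
  simp only [ent_genericMatrix, ev_pvar_add_two]

lemma ev_relationCode (M M' : List (List MPoly)) (i j : Fin r) :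
    ev θ (relationCode r M M' i j) = ∑ l : Fin r, ev θ (ent M i l) * ev θ (ent M' l j) -
      C ((1 : Matrix (Fin r) (Fin r) QBar) i j) := by
  rw [relationCode, ev_psub, ev_psum_range, ev_pconst]
  simp only [ev_pmul]
  congr 2
  by_cases h : i = j
  · subst h
    simp [toQ_qnat]
  · have : (i : ℕ) ≠ j := fun h' => h (Fin.ext h')
    simp [toQ_qnat, h, this]

lemma ev_relationCode_genericMatrix (i j : Fin r) :
    ev θ (relationCode r (genericMatrix 0 r) (genericMatrix 1 r) i j) = relation r QBar i j := by
  rw [ev_relationCode, relation]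
  simp only [ent_genericMatrix, ev_pvar_add_two]

lemma vhom_coordinates (g : ℕ → Matrix (Fin r) (Fin r) QBar) (f : MvPolynomial (Fin r) QBar) :
    vhom g (aeval (fun i : Fin r => X (3 * (i : ℕ))) f) = f := by
  suffices H : (vhom g).comp (aeval fun i : Fin r => X (3 * (i : ℕ))) = AlgHom.id QBar _ from
    DFunLike.congr_fun H f
  ext1 i
  rw [AlgHom.comp_apply, aeval_X, vhom_X]
  rfl

lemma vhom_linear (v : ℕ → Matrix (Fin r) (Fin r) QBar) (g : Matrix (Fin r) (Fin r) QBar)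
    (f : MvPolynomial (Fin r) QBar) :
    vhom v (aeval (fun j : Fin r => ∑ l : Fin r, C (g j l) * X (3 * (l : ℕ))) f) =
      substHom g f := by
  suffices H : (vhom v).comp (aeval fun j : Fin r => ∑ l : Fin r, C (g j l) * X (3 * (l : ℕ))) =
    substHom g from DFunLike.congr_fun H f
  ext1 i
  rw [AlgHom.comp_apply, aeval_X, map_sum, substHom_X]
  refine Finset.sum_congr rfl fun l _ => ?_
  rw [map_mul, vhom_X, algHom_C, algebraMap_eq]

lemma rename_coordinates (f : MvPolynomial (Fin r) QBar) :
    rename (fun j : Fin r => 3 * (j : ℕ)) f = aeval (fun i : Fin r => X (3 * (i : ℕ))) f := by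
  suffices H : rename (fun j : Fin r => 3 * (j : ℕ)) =
    (aeval (fun i : Fin r => X (3 * (i : ℕ))) : MvPolynomial (Fin r) QBar →ₐ[QBar] _) from
    DFunLike.congr_fun H f
  ext1 i
  simp

lemma rename_substHom (g : Matrix (Fin r) (Fin r) QBar) (f : MvPolynomial (Fin r) QBar) :
    rename (fun j : Fin r => 3 * (j : ℕ)) (substHom g f) =
      aeval (fun j : Fin r => ∑ l : Fin r, C (g j l) * X (3 * (l : ℕ))) f := by
  suffices H : (rename (fun j : Fin r => 3 * (j : ℕ))).comp (substHom g) =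
    aeval fun j : Fin r => ∑ l : Fin r, C (g j l) * X (3 * (l : ℕ)) from DFunLike.congr_fun H f
  ext1 i
  rw [AlgHom.comp_apply, aeval_X, substHom_X, map_sum]
  simp
end

/-! ### Certificates of the existence of a linear equivalence -/

/-- The equation `x_k ^ N * f(M x) = ∑ a_j h_j`. -/
def memEq (r : ℕ) (f : List AnnTerm) (B : List (List AnnTerm)) (M : List (List MPoly)) (k : ℕ)
    (d : ℕ × List MPoly) : MPoly :=
  psub (pmul (ppow (pvar (3 * k + 2)) d.1) (annPoly r (mulVecCodes r M (coordCodes r)) f))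
    (psum ((List.range B.length).map fun j =>
      pmul (d.2.getD j []) (annPoly r (coordCodes r) (B.getD j []))))

def memEqs (r : ℕ) (A B : List (List AnnTerm)) (M : List (List MPoly))
    (a : List (List (ℕ × List MPoly))) : List MPoly :=
  (List.range A.length).flatMap fun i => (List.range r).map fun k =>
    memEq r (A.getD i []) B M k ((a.getD i []).getD k (0, []))

/-- The equations of a matrix and its inverse. -/
def relationEqs (r : ℕ) (M M' : List (List MPoly)) : List MPoly :=
  (List.range r).flatMap fun i => (List.range r).map fun j => relationCode r M M' i j

section
variable {θ : QBar} {r : ℕ}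

lemma sysVal_getD (A : List (List AnnTerm)) (i : ℕ) :
    (sysVal θ r A).getD i 0 = polyVal θ r (A.getD i []) :=
  List.getD_map A [] (polyVal θ r)

lemma length_sysVal (A : List (List AnnTerm)) : (sysVal θ r A).length = A.length :=
  List.length_map _

lemma mem_span_list_iff {R : Type} [CommRing R] (hs : List R) (x : R) :
    x ∈ Ideal.span {h | h ∈ hs} ↔
      ∃ c : ℕ → R, ∑ j : Fin hs.length, c j * hs.getD j 0 = x := by
  have h1 : {h | h ∈ hs} = Set.range fun j : Fin hs.length => hs.getD j 0 := by
    ext h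
    simp [List.mem_iff_get]
  rw [h1, Ideal.span, Submodule.mem_span_range_iff_exists_fun]
  constructor
  · rintro ⟨c, hc⟩
    refine ⟨fun j => if h : j < hs.length then c ⟨j, h⟩ else 0, ?_⟩
    rw [← hc]
    simp
  · rintro ⟨c, hc⟩
    exact ⟨fun j => c j, by simpa using hc⟩

lemma mem_memEqs {A B : List (List AnnTerm)} {M : List (List MPoly)}
    {a : List (List (ℕ × List MPoly))} (e : MPoly) : e ∈ memEqs r A B M a ↔
      ∃ i < A.length, ∃ k < r, memEq r (A.getD i []) B M k ((a.getD i []).getD k (0, [])) = e := by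
  simp [memEqs]

lemma ev_memEq (f : List AnnTerm) (B : List (List AnnTerm)) (M : List (List MPoly)) (k : ℕ)
    (d : ℕ × List MPoly) (g : Matrix (Fin r) (Fin r) QBar)
    (hM : ∀ j l : Fin r, ev θ (ent M j l) = C (g j l)) : ev θ (memEq r f B M k d) =
      X (3 * k) ^ d.1 * aeval (fun j : Fin r => ∑ l : Fin r, C (g j l) * X (3 * (l : ℕ)))
        (polyVal θ r f) - ∑ j : Fin B.length, ev θ (d.2.getD j []) *
          aeval (fun i : Fin r => X (3 * (i : ℕ))) ((sysVal θ r B).getD j 0) := by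
  rw [memEq, ev_psub, ev_pmul, ev_ppow, ev_pvar_add_two, ev_annPoly, ev_psum_range]
  simp only [ev_pmul, ev_annPoly, ev_mulVecCodes, hM, ev_coordCodes, sysVal_getD]

/-- The cofactors of a certificate may involve any variables. -/
lemma memSat_of_memEqs {A B : List (List AnnTerm)} {M : List (List MPoly)}
    {a : List (List (ℕ × List MPoly))} {g : Matrix (Fin r) (Fin r) QBar}
    (hM : ∀ j l : Fin r, ev θ (ent M j l) = C (g j l))
    (h : ∀ e ∈ memEqs r A B M a, ev θ e = 0) :
    ∀ f ∈ sysVal θ r A, MemSat (Ideal.span {h | h ∈ sysVal θ r B}) (substHom g f) := by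
  intro f hf k
  obtain ⟨i, hi, rfl⟩ := List.getElem_of_mem hf
  rw [length_sysVal] at hi
  have h1 := h _ ((mem_memEqs _).mpr ⟨i, hi, k, k.2, rfl⟩)
  rw [ev_memEq _ _ _ _ _ g hM, sub_eq_zero] at h1
  -- Setting all matrix variables and superfluous coordinates to zero moves the identity to the
  -- polynomial ring in the `r` coordinates.
  have h2 := congrArg (vhom (0 : ℕ → Matrix (Fin r) (Fin r) QBar)) h1
  rw [map_mul, map_pow, vhom_X, vhom_linear, map_sum] at h2
  simp only [map_mul, vhom_coordinates] at h2
  refine ⟨((a.getD i []).getD k (0, [])).1, ?_⟩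
  rw [← List.getD_eq_getElem (d := 0), sysVal_getD, h2]
  refine Ideal.sum_mem _ fun j _ => Ideal.mul_mem_left _ _ (Ideal.subset_span ?_)
  rw [List.getD_eq_getElem _ _ (by rw [length_sysVal]; exact j.2)]
  exact List.getElem_mem _

/-- The cofactors depend on the polynomials `fs`, `hs` and on `g` alone. Annotated codes depend on
`θ`, so they are quantified after the cofactors and enter through their values. -/
lemma eventually_memEqs {fs hs : List (MvPolynomial (Fin r) QBar)}
    {g : Matrix (Fin r) (Fin r) QBar}
    (h : ∀ f ∈ fs, MemSat (Ideal.span {h | h ∈ hs}) (substHom g f)) :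
    ∀ᶠ θ in large, ∃ a, ∀ A B M, sysVal θ r A = fs → sysVal θ r B = hs →
      (∀ j l : Fin r, ev θ (ent M j l) = C (g j l)) → ∀ e ∈ memEqs r A B M a, ev θ e = 0 := by
  have h1 : ∀ i < fs.length, ∀ k (hk : k < r), ∃ (N : ℕ) (c : ℕ → MvPolynomial (Fin r) QBar),
      ∑ j : Fin hs.length, c j * hs.getD j 0 = X ⟨k, hk⟩ ^ N * substHom g (fs.getD i 0) := by
    intro i hi k hk
    rw [List.getD_eq_getElem _ _ hi]
    obtain ⟨N, hN⟩ := h _ (List.getElem_mem hi) ⟨k, hk⟩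
    exact ⟨N, (mem_span_list_iff _ _).mp hN⟩
  choose! N c hc using h1
  have h2 : ∀ᶠ θ in large, ∀ i ∈ List.range fs.length, ∀ k ∈ List.range r,
      ∀ j ∈ List.range hs.length,
        ∃ q, ev θ q = rename (fun j : Fin r => 3 * (j : ℕ)) (c i k j) :=
    eventually_all_mem_list _ fun i _ => eventually_all_mem_list _ fun k _ =>
      eventually_all_mem_list _ fun j _ => (eventually_ev _).mono fun _ h => h.imp fun _ h => h.1
  filter_upwards [h2] with θ hθ
  simp only [List.mem_range] at hθ
  choose! q hq using hθ
  refine ⟨(List.range fs.length).map fun i => (List.range r).map fun k =>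
    (N i k, (List.range hs.length).map fun j => q i k j), ?_⟩
  rintro A B M rfl rfl hM e he
  obtain ⟨i, hi, k, hk, rfl⟩ := (mem_memEqs _).mp he
  have hi' : i < (sysVal θ r A).length := by rwa [length_sysVal]
  rw [ev_memEq _ _ _ _ _ g hM, sub_eq_zero, getD_map_range _ _ _ hi', getD_map_range _ _ _ hk,
    ← rename_substHom, ← sysVal_getD]
  have h3 := congrArg (rename fun j : Fin r => 3 * (j : ℕ)) (hc i hi' k hk)
  rw [map_mul, map_pow, rename_X] at h3
  refine h3.symm.trans ?_
  rw [map_sum, ← Fin.sum_congr' _ (length_sysVal B)]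
  refine Finset.sum_congr rfl fun j _ => ?_
  have hj : ((Fin.cast (length_sysVal B) j : Fin B.length) : ℕ) = j := rfl
  rw [hj, map_mul, getD_map_range _ _ _ j.2, hq i hi' k hk j j.2, rename_coordinates,
    rename_coordinates]
end

end ProjEquiv

namespace ProjEquiv
open MvPolynomial Filter

/-! ### Certificates of the absence of a linear equivalence -/

/-- The data of an element `b * c` with a witness for `c`: the index of the polynomial, the
index of a coordinate of the point, the bound of the exponents and the exponents; the point and the
inverse of its coordinate; `Λ`, `Z`, `c`, `b`; the results of the test. -/
abbrev WitnessData : Type :=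
  (ℕ × ℕ × ℕ × List ℕ) × (List CNum × CNum) × (MPoly × MPoly × MPoly × MPoly) × List MPoly

/-- Every term has an exponent different from `γ`. -/
def avoids (r : ℕ) (γ : List ℕ) (Z : MPoly) : Bool :=
  lall Z fun t => !(lall (List.range r) fun j => decide (t.2.getD (3 * j + 2) 0 = γ.getD j 0))

/-- Every term has an exponent greater than `n`. -/
def exceeds (r n : ℕ) (Z : MPoly) : Bool :=
  lall Z fun t => !(lall (List.range r) fun j => decide (t.2.getD (3 * j + 2) 0 ≤ n))

def witnessSide (r len : ℕ) (w : WitnessData) : Bool :=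
  (decide (w.1.1 < len) && decide (w.1.2.1 < r)) &&
  ((lall (List.range r) fun j => decide (w.1.2.2.2.getD j 0 ≤ w.1.2.2.1)) &&
  (avoids r w.1.2.2.2 w.2.2.1.2.1 && lall w.2.2.2 fun Z => exceeds r w.1.2.2.1 Z))

/-- An inverse of one coordinate turns the condition that the point is nonzero into an equation. -/
def pointEq (w : WitnessData) : MPoly :=
  psub (pmul (num (w.2.1.1.getD w.1.2.1 ([], []))) (num w.2.1.2)) (pconst (qnat 1))

/-- `c * x ^ γ + Z`. -/
def remainderCode (r : ℕ) (w : WitnessData) : MPoly :=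
  pmul w.2.2.1.2.2.1
    (pprod ((List.range r).map fun j => ppow (pvar (3 * j + 2)) (w.1.2.2.2.getD j 0))) ++
    w.2.2.1.2.1

def substEq (r o : ℕ) (A : List (List AnnTerm)) (w : WitnessData) : MPoly :=
  psub (pmul w.2.2.1.1 (annPoly r (mulVecCodes r (genericMatrix o r) (shiftCodes r w.2.1.1))
    (A.getD w.1.1 []))) (remainderCode r w)

def testEqs (r : ℕ) (B : List (List AnnTerm)) (w : WitnessData) : List MPoly :=
  (List.range B.length).map fun j =>
    psub (pmul w.2.2.1.1 (annPoly r (shiftCodes r w.2.1.1) (B.getD j []))) (w.2.2.2.getD j [])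

def witnessEqs (r o : ℕ) (A B : List (List AnnTerm)) (w : WitnessData) : List MPoly :=
  pointEq w :: substEq r o A w :: testEqs r B w

section
variable {θ : QBar} {r : ℕ}

lemma avoids_iff (γ : List ℕ) (Z : MPoly) : avoids r γ Z = true ↔
    ∀ t ∈ Z, ∃ j : Fin r, t.2.getD (3 * (j : ℕ) + 2) 0 ≠ γ.getD j 0 := by
  simp only [avoids, lall_iff, Bool.not_eq_true', ← Bool.not_eq_true, List.mem_range,
    decide_eq_true_iff, not_forall, Fin.exists_iff]

lemma exceeds_iff (n : ℕ) (Z : MPoly) : exceeds r n Z = true ↔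
    ∀ t ∈ Z, ∃ j : Fin r, n < t.2.getD (3 * (j : ℕ) + 2) 0 := by
  simp only [exceeds, lall_iff, Bool.not_eq_true', ← Bool.not_eq_true, List.mem_range,
    decide_eq_true_iff, not_forall, Fin.exists_iff, not_le]

lemma ev_pointEq (w : WitnessData) : ev θ (pointEq w) =
    C (cval θ (w.2.1.1.getD w.1.2.1 ([], [])) * cval θ w.2.1.2 - 1) := by
  rw [pointEq, ev_psub, ev_pmul, ev_num, ev_num, ev_pconst, toQ_qnat]
  simp

lemma ev_substEq (o : ℕ) (A : List (List AnnTerm)) (w : WitnessData) : ev θ (substEq r o A w) =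
    ev θ w.2.2.1.1 * aeval (linArgs o (shiftArgs fun l : Fin r => cval θ (w.2.1.1.getD l ([], []))))
      ((sysVal θ r A).getD w.1.1 0) -
    (ev θ w.2.2.1.2.2.1 * ∏ j : Fin r, X (3 * (j : ℕ)) ^ w.1.2.2.2.getD j 0 +
      ev θ w.2.2.1.2.1) := by
  rw [substEq, ev_psub, ev_pmul, ev_annPoly, ev_mulVecCodes_genericMatrix, sysVal_getD,
    remainderCode, ev_append, ev_pmul, ev_pprod_range]
  simp only [ev_ppow, ev_pvar_add_two]

lemma mem_testEqs {B : List (List AnnTerm)} {w : WitnessData} {e : MPoly} : e ∈ testEqs r B w ↔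
    ∃ j < B.length, psub (pmul w.2.2.1.1 (annPoly r (shiftCodes r w.2.1.1) (B.getD j [])))
      (w.2.2.2.getD j []) = e := by
  simp [testEqs]

lemma ev_testEq (B : List (List AnnTerm)) (w : WitnessData) (j : ℕ) :
    ev θ (psub (pmul w.2.2.1.1 (annPoly r (shiftCodes r w.2.1.1) (B.getD j [])))
      (w.2.2.2.getD j [])) =
    ev θ w.2.2.1.1 * aeval (shiftArgs fun l : Fin r => cval θ (w.2.1.1.getD l ([], [])))
      ((sysVal θ r B).getD j 0) - ev θ (w.2.2.2.getD j []) := by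
  rw [ev_psub, ev_pmul, ev_annPoly, ev_shiftCodes, sysVal_getD]

lemma witness_of_witnessEqs {o : ℕ} {A B : List (List AnnTerm)} {w : WitnessData}
    (hs : witnessSide r A.length w = true) (h : ∀ e ∈ witnessEqs r o A B w, ev θ e = 0) :
    Witness (sysVal θ r A) (sysVal θ r B) o (ev θ w.2.2.1.2.2.1) := by
  simp only [witnessSide, Bool.and_eq_true, decide_eq_true_iff, lall_iff, List.mem_range,
    avoids_iff, exceeds_iff] at hs
  obtain ⟨⟨hi, hk⟩, hγ, hZ, htest⟩ := hs
  simp only [witnessEqs, List.mem_cons, forall_eq_or_imp, mem_testEqs] at h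
  obtain ⟨h1, h2, h3⟩ := h
  rw [ev_pointEq, C_eq_zero, sub_eq_zero] at h1
  rw [ev_substEq, sub_eq_zero] at h2
  refine ⟨_, w.1.2.2.1, ev θ w.2.2.1.1, fun j => w.1.2.2.2.getD j 0, ev θ w.2.2.1.2.1,
    ⟨⟨w.1.2.1, hk⟩, left_ne_zero_of_mul_eq_one h1⟩, ?_, fun j => hγ j j.2,
    ⟨_, ?_, h2⟩, fun m hm => ?_⟩
  · intro q hq m hm
    obtain ⟨j, hj, rfl⟩ := List.getElem_of_mem hq
    rw [length_sysVal] at hj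
    have h4 := h3 _ ⟨j, hj, rfl⟩
    rw [ev_testEq, sub_eq_zero, List.getD_eq_getElem _ _ (by rwa [length_sysVal])] at h4
    rw [h4] at hm
    obtain ⟨t, ht, htm⟩ := exists_term_of_mem_support θ _ m hm
    -- An entry missing from the list is read as the empty code, which has no terms; so the term `t`
    -- shows that the entry is present.
    have h5 : w.2.2.2.getD j [] ∈ w.2.2.2 := by
      by_cases hlt : j < w.2.2.2.length
      · rw [List.getD_eq_getElem _ _ hlt]
        exact List.getElem_mem _
      · rw [List.getD_eq_default _ _ (not_lt.mp hlt)] at ht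
        simp at ht
    obtain ⟨l, hl⟩ := htest _ h5 t ht
    exact ⟨l, by rwa [← htm]⟩
  · rw [List.getD_eq_getElem _ _ (by rwa [length_sysVal])]
    exact List.getElem_mem _
  · obtain ⟨t, ht, htm⟩ := exists_term_of_mem_support θ _ m hm
    obtain ⟨j, hj⟩ := hZ t ht
    exact ⟨j, by rwa [← htm]⟩

/-- The codes of `Z` and of the test results come from `eventually_ev`, so their terms inherit the
exponent conditions from the supports. -/
lemma eventually_witnessEqs {fs hs : List (MvPolynomial (Fin r) QBar)} {o : ℕ}
    {c : MvPolynomial ℕ QBar} (hc : Witness fs hs o c) (b : MvPolynomial ℕ QBar) :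
    ∀ᶠ θ in large, ∃ w : WitnessData, ev θ w.2.2.1.2.2.1 = c ∧ ev θ w.2.2.1.2.2.2 = b ∧
      ∀ A B, sysVal θ r A = fs → sysVal θ r B = hs →
        witnessSide r A.length w = true ∧ ∀ e ∈ witnessEqs r o A B w, ev θ e = 0 := by
  obtain ⟨p, n, Λ, γ, Z, ⟨k, hk⟩, htest, hγ, ⟨f, hf, heq⟩, hZ⟩ := hc
  obtain ⟨i, hi, rfl⟩ := List.getElem_of_mem hf
  have h1 : ∀ᶠ θ in large, ∀ l ∈ List.range r, ∃ y, ∀ hl : l < r, cval θ y = p ⟨l, hl⟩ := by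
    refine eventually_all_mem_list _ fun l hl => ?_
    exact (eventually_cval (p ⟨l, List.mem_range.mp hl⟩)).mono fun θ h => h.imp fun y hy _ => hy
  have h2 : ∀ᶠ θ in large, ∀ j ∈ List.range hs.length, ∃ q : MPoly,
      ev θ q = Λ * aeval (shiftArgs p) (hs.getD j 0) ∧
      ∀ t ∈ q, ∃ l : Fin r, n < t.2.getD (3 * (l : ℕ) + 2) 0 := by
    refine eventually_all_mem_list _ fun j hj => ?_
    rw [List.mem_range] at hj
    filter_upwards [eventually_ev (Λ * aeval (shiftArgs p) (hs.getD j 0))] with θ h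
    obtain ⟨q, hq, ht⟩ := h
    refine ⟨q, hq, fun t htq => ?_⟩
    obtain ⟨m, hm, hmt⟩ := ht t htq
    obtain ⟨l, hl⟩ := htest (hs.getD j 0) (by
      rw [List.getD_eq_getElem _ _ hj]; exact List.getElem_mem _) m hm
    exact ⟨l, by rwa [hmt]⟩
  filter_upwards [h1, h2, eventually_cval (p k)⁻¹, eventually_ev Λ, eventually_ev Z,
    eventually_ev c, eventually_ev b] with θ h1 h2 h3 h4 h5 h6 h7
  simp only [List.mem_range] at h1 h2
  choose! y hy using h1
  choose! q hq using h2
  obtain ⟨u, hu⟩ := h3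
  obtain ⟨Λ, rfl, -⟩ := h4
  obtain ⟨Z, rfl, hZ'⟩ := h5
  obtain ⟨c, rfl, -⟩ := h6
  obtain ⟨b, rfl, -⟩ := h7
  have hp : (fun l : Fin r => cval θ (((List.range r).map y).getD l ([], []))) = p := by
    funext l
    rw [getD_map_range _ _ _ l.2, hy l l.2 l.2]
  have hγ' (j : Fin r) : (List.ofFn γ).getD j 0 = γ j := by simp [List.getD_eq_getElem?_getD]
  refine ⟨((i, k, n, List.ofFn γ), ((List.range r).map y, u), (Λ, Z, c, b),
    (List.range hs.length).map q), rfl, rfl, ?_⟩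
  rintro A B rfl rfl
  rw [length_sysVal] at hi
  constructor
  · simp only [witnessSide, Bool.and_eq_true, decide_eq_true_iff, lall_iff, List.mem_range,
      avoids_iff, exceeds_iff]
    refine ⟨⟨hi, k.2⟩, fun j hj => ?_, fun t ht => ?_, fun Q hQ => ?_⟩
    · have := hγ' ⟨j, hj⟩
      simp only at this
      rw [this]
      exact hγ _
    · obtain ⟨m, hm, hmt⟩ := hZ' t ht
      obtain ⟨j, hj⟩ := hZ m hm
      exact ⟨j, by rwa [hmt, hγ']⟩
    · obtain ⟨j, hj, rfl⟩ := List.mem_map.mp hQ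
      exact (hq j (List.mem_range.mp hj)).2
  · simp only [witnessEqs, List.mem_cons, forall_eq_or_imp, mem_testEqs]
    refine ⟨?_, ?_, ?_⟩
    · rw [ev_pointEq]
      simp only
      rw [getD_map_range _ _ _ k.2, hy k k.2 k.2, hu, mul_inv_cancel₀ hk, sub_self, map_zero]
    · rw [ev_substEq, sub_eq_zero]
      simp only
      rw [hp, List.getD_eq_getElem _ _ (by rwa [length_sysVal]), heq]
      simp only [hγ']
    · rintro _ ⟨j, hj, rfl⟩
      have hj' : j < (sysVal θ r B).length := by rwa [length_sysVal]
      refine (ev_testEq B ((i, k, n, List.ofFn γ), ((List.range r).map y, u), (Λ, Z, c, b),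
        (List.range (sysVal θ r B).length).map q) j).trans ?_
      rw [sub_eq_zero]
      simp only
      rw [hp, getD_map_range _ _ _ hj', (hq j hj').1]

/-- Lists of cofactors and generators are the form in which an ideal membership can be coded. -/
lemma mem_span_iff_exists_list {R : Type} [CommRing R] {S : Set R} {x : R} :
    x ∈ Ideal.span S ↔ ∃ L : List (R × R), (∀ p ∈ L, p.2 ∈ S) ∧
      (L.map fun p => p.1 * p.2).sum = x := by
  constructor
  · intro hx
    induction hx using Submodule.span_induction with
    | mem x h => exact ⟨[(1, x)], by simpa using h, by simp⟩
    | zero => exact ⟨[], by simp, by simp⟩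
    | add x y _ _ hx hy =>
      obtain ⟨L, hL, rfl⟩ := hx
      obtain ⟨L', hL', rfl⟩ := hy
      refine ⟨L ++ L', fun p hp => ?_, by simp⟩
      rcases List.mem_append.mp hp with h | h
      · exact hL p h
      · exact hL' p h
    | smul a x _ hx =>
      obtain ⟨L, hL, rfl⟩ := hx
      refine ⟨L.map fun p => (a * p.1, p.2), ?_, ?_⟩
      · simp only [List.mem_map, forall_exists_index, and_imp, forall_apply_eq_imp_iff₂]
        exact hL
      · rw [smul_eq_mul, List.map_map, ← List.sum_map_mul_left]
        simp only [Function.comp_def, mul_assoc]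
  · rintro ⟨L, hL, rfl⟩
    refine list_sum_mem fun y hy => ?_
    obtain ⟨p, hp, rfl⟩ := List.mem_map.mp hy
    exact Ideal.mul_mem_left _ _ (Ideal.subset_span (hL p hp))

/-- The data of a certificate: multiples of relations and of the two kinds of witnesses. -/
abbrev Refutation : Type := List (MPoly × ℕ × ℕ) × List WitnessData × List WitnessData

def refutationSide (r len len' : ℕ) (d : Refutation) : Bool :=
  (lall d.1 fun t => decide (t.2.1 < r) && decide (t.2.2 < r)) &&
  ((lall d.2.1 fun w => witnessSide r len w) && lall d.2.2 fun w => witnessSide r len' w)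

def relationMultiple (r : ℕ) (t : MPoly × ℕ × ℕ) : MPoly :=
  pmul t.1 (relationCode r (genericMatrix 0 r) (genericMatrix 1 r) t.2.1 t.2.2)

def witnessMultiple (w : WitnessData) : MPoly := pmul w.2.2.1.2.2.2 w.2.2.1.2.2.1

def combinationEq (r : ℕ) (d : Refutation) : MPoly :=
  psub (psum (d.1.map fun t => relationMultiple r t) ++
    (psum (d.2.1.map fun w => witnessMultiple w) ++ psum (d.2.2.map fun w => witnessMultiple w)))
    (pconst (qnat 1))

def refutationEqs (r : ℕ) (A B : List (List AnnTerm)) (d : Refutation) : List MPoly :=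
  combinationEq r d :: ((d.2.1.flatMap fun w => witnessEqs r 0 A B w) ++
    d.2.2.flatMap fun w => witnessEqs r 1 B A w)

lemma ev_combinationEq (d : Refutation) : ev θ (combinationEq r d) =
    (d.1.map fun t => ev θ (relationMultiple r t)).sum +
    ((d.2.1.map fun w => ev θ w.2.2.1.2.2.2 * ev θ w.2.2.1.2.2.1).sum +
      (d.2.2.map fun w => ev θ w.2.2.1.2.2.2 * ev θ w.2.2.1.2.2.1).sum) - 1 := by
  rw [combinationEq, ev_psub, ev_append, ev_append, ev_psum, ev_psum, ev_psum, ev_pconst,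
    List.map_map, List.map_map, List.map_map, toQ_qnat, Nat.cast_one]
  simp only [Function.comp_def, witnessMultiple, ev_pmul]
  simp

lemma ev_relationMultiple (t : MPoly × ℕ × ℕ) (h1 : t.2.1 < r) (h2 : t.2.2 < r) :
    ev θ (relationMultiple r t) = ev θ t.1 * relation r QBar ⟨t.2.1, h1⟩ ⟨t.2.2, h2⟩ := by
  rw [relationMultiple, ev_pmul, ← ev_relationCode_genericMatrix]

lemma not_good_of_refutationEqs {A B : List (List AnnTerm)} {d : Refutation}
    (hs : refutationSide r A.length B.length d = true)
    (h : ∀ e ∈ refutationEqs r A B d, ev θ e = 0) :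
    ¬ Good (sysVal θ r A) (sysVal θ r B) := by
  simp only [refutationSide, Bool.and_eq_true, decide_eq_true_iff, lall_iff] at hs
  obtain ⟨hs0, hs1, hs2⟩ := hs
  simp only [refutationEqs, List.mem_cons, List.mem_append, List.mem_flatMap,
    forall_eq_or_imp] at h
  obtain ⟨h0, h1⟩ := h
  rw [ev_combinationEq, sub_eq_zero] at h0
  refine not_good_of_one_mem ?_
  rw [← h0]
  refine Ideal.add_mem _ ?_ (Ideal.add_mem _ ?_ ?_)
  · refine list_sum_mem fun x hx => ?_
    obtain ⟨t, ht, rfl⟩ := List.mem_map.mp hx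
    rw [ev_relationMultiple t (hs0 t ht).1 (hs0 t ht).2]
    exact Ideal.mul_mem_left _ _ (Ideal.subset_span (Or.inl ⟨_, _, rfl⟩))
  · refine list_sum_mem fun x hx => ?_
    obtain ⟨w, hw, rfl⟩ := List.mem_map.mp hx
    exact Ideal.mul_mem_left _ _ (Ideal.subset_span (Or.inr (Or.inl
      (witness_of_witnessEqs (hs1 w hw) fun e he => h1 e (Or.inl ⟨w, hw, he⟩)))))
  · refine list_sum_mem fun x hx => ?_
    obtain ⟨w, hw, rfl⟩ := List.mem_map.mp hx
    exact Ideal.mul_mem_left _ _ (Ideal.subset_span (Or.inr (Or.inr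
      (witness_of_witnessEqs (hs2 w hw) fun e he => h1 e (Or.inr ⟨w, hw, he⟩)))))

lemma eventually_witnessList {fs hs : List (MvPolynomial (Fin r) QBar)} {o : ℕ}
    {L : List (MvPolynomial ℕ QBar × MvPolynomial ℕ QBar)}
    (hL : ∀ p ∈ L, Witness fs hs o p.2) :
    ∀ᶠ θ in large, ∃ L' : List WitnessData,
      (L'.map fun w => ev θ w.2.2.1.2.2.2 * ev θ w.2.2.1.2.2.1).sum =
        (L.map fun p => p.1 * p.2).sum ∧
      ∀ A B, sysVal θ r A = fs → sysVal θ r B = hs → ∀ w ∈ L',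
        witnessSide r A.length w = true ∧ ∀ e ∈ witnessEqs r o A B w, ev θ e = 0 := by
  filter_upwards [eventually_all_mem_list L fun p hp => eventually_witnessEqs (hL p hp) p.1]
    with θ hθ
  choose! f hf using hθ
  refine ⟨L.map f, ?_, fun A B hA hB w hw => ?_⟩
  · rw [List.map_map]
    congr 1
    refine List.map_congr_left fun p hp => ?_
    rw [Function.comp_apply, (hf p hp).1, (hf p hp).2.1]
  · obtain ⟨p, hp, rfl⟩ := List.mem_map.mp hw
    exact (hf p hp).2.2 A B hA hB

lemma eventually_refutationEqs {fs hs : List (MvPolynomial (Fin r) QBar)} (h : ¬ Good fs hs) :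
    ∀ᶠ θ in large, ∃ d, ∀ A B, sysVal θ r A = fs → sysVal θ r B = hs →
      refutationSide r A.length B.length d = true ∧
        ∀ e ∈ refutationEqs r A B d, ev θ e = 0 := by
  have hcl : IsAlgClosed QBar := (algebraicClosure.isAlgClosure ℚ ℂ).isAlgClosed
  have h1 := one_mem_of_not_good h
  -- The combination is sorted by the three kinds of generators, which are coded separately:
  -- relations of the matrices, witnesses in one direction and in the other.
  rw [obstruction, Ideal.span_union, Ideal.span_union] at h1
  obtain ⟨x, hx, yz, hyz, hxyz⟩ := Submodule.mem_sup.mp h1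
  obtain ⟨y, hy, z, hz, rfl⟩ := Submodule.mem_sup.mp hyz
  obtain ⟨L0, hL0, rfl⟩ := mem_span_iff_exists_list.mp hx
  obtain ⟨L1, hL1, rfl⟩ := mem_span_iff_exists_list.mp hy
  obtain ⟨L2, hL2, rfl⟩ := mem_span_iff_exists_list.mp hz
  have h2 : ∀ᶠ θ in large, ∀ p ∈ L0, ∃ t : MPoly × ℕ × ℕ, (t.2.1 < r ∧ t.2.2 < r) ∧
      ev θ (relationMultiple r t) = p.1 * p.2 := by
    refine eventually_all_mem_list _ fun p hp => ?_
    filter_upwards [eventually_ev p.1] with θ hθ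
    obtain ⟨q, hq, -⟩ := hθ
    obtain ⟨i, j, hij⟩ := hL0 p hp
    exact ⟨(q, i, j), ⟨i.2, j.2⟩, by rw [ev_relationMultiple _ i.2 j.2, hq, hij]⟩
  filter_upwards [h2, eventually_witnessList hL1, eventually_witnessList hL2] with θ h2 h3 h4
  choose! f hf using h2
  obtain ⟨M1, hM1, hM1'⟩ := h3
  obtain ⟨M2, hM2, hM2'⟩ := h4
  refine ⟨(L0.map f, M1, M2), fun A B hA hB => ⟨?_, ?_⟩⟩
  · simp only [refutationSide, Bool.and_eq_true, decide_eq_true_iff, lall_iff, List.mem_map,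
      forall_exists_index, and_imp, forall_apply_eq_imp_iff₂]
    exact ⟨fun p hp => (hf p hp).1, fun w hw => (hM1' A B hA hB w hw).1,
      fun w hw => (hM2' B A hB hA w hw).1⟩
  · simp only [refutationEqs, List.mem_cons, List.mem_append, List.mem_flatMap, forall_eq_or_imp]
    constructor
    · rw [ev_combinationEq, sub_eq_zero, hM1, hM2, ← hxyz, List.map_map]
      congr 2
      exact List.map_congr_left fun p hp => (hf p hp).2
    · rintro e (⟨w, hw, he⟩ | ⟨w, hw, he⟩)
      · exact (hM1' A B hA hB w hw).2 e he
      · exact (hM2' B A hB hA w hw).2 e he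
end

end ProjEquiv

namespace ProjEquiv

/-! ### Primitive recursiveness of the certificates -/

section
set_option synthInstance.maxSize 1000
set_option synthInstance.maxHeartbeats 200000
variable {α : Type} [Primcodable α]

@[fun_prop] theorem pr_not {f : α → Bool} (hf : Primrec f) : Primrec (fun a => !(f a)) :=
  Primrec.not.comp hf

@[fun_prop] theorem pr_distCode {f : α → NumberCode} {g : α → CNum}
    (hf : Primrec f) (hg : Primrec g) :
    Primrec (fun a => distCode (f a) (g a)) := by
  have hp : Primrec (fun p : NumberCode × CNum => distCode p.1 p.2) := by
    unfold distCode; fun_prop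
  have hc := hp.comp (hf.pair hg)
  exact hc

@[fun_prop] theorem pr_numberEqs {f : α → NumberCode} {g : α → CNum × RealCode × RealCode}
    (hf : Primrec f) (hg : Primrec g) :
    Primrec (fun a => numberEqs (f a) (g a)) := by
  have hp : Primrec (fun p : NumberCode × CNum × RealCode × RealCode => numberEqs p.1 p.2) := by
    unfold numberEqs; fun_prop
  have hc := hp.comp (hf.pair hg)
  exact hc

@[fun_prop] theorem pr_systemEqs {f : α → List (List AnnTerm)}
    (hf : Primrec f) :
    Primrec (fun a => systemEqs (f a)) := by
  have hp : Primrec (fun p : List (List AnnTerm) => systemEqs p) := by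
    unfold systemEqs; fun_prop
  have hc := hp.comp hf
  exact hc

@[fun_prop] theorem pr_forget {f : α → List (List AnnTerm)}
    (hf : Primrec f) :
    Primrec (fun a => forget (f a)) := by
  have hp : Primrec (fun p : List (List AnnTerm) => forget p) := by
    unfold forget; fun_prop
  have hc := hp.comp hf
  exact hc

@[fun_prop] theorem pr_annPoly {f : α → ℕ} {g : α → List MPoly} {h : α → List AnnTerm}
    (hf : Primrec f) (hg : Primrec g) (hh : Primrec h) :
    Primrec (fun a => annPoly (f a) (g a) (h a)) := by
  have hp : Primrec (fun p : ℕ × List MPoly × List AnnTerm => annPoly p.1 p.2.1 p.2.2) := by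
    unfold annPoly; fun_prop
  have hc := hp.comp (hf.pair (hg.pair hh))
  exact hc

@[fun_prop] theorem pr_noRootEqs {f : α → NumberCode} {g : α → RatCode × List (CNum × RealCode)}
    (hf : Primrec f) (hg : Primrec g) :
    Primrec (fun a => noRootEqs (f a) (g a)) := by
  have hp : Primrec (fun p : NumberCode × RatCode × List (CNum × RealCode) => noRootEqs p.1 p.2) := by
    unfold noRootEqs; fun_prop
  have hc := hp.comp (hf.pair hg)
  exact hc

@[fun_prop] theorem pr_ent {f : α → List (List MPoly)} {g : α → ℕ} {h : α → ℕ}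
    (hf : Primrec f) (hg : Primrec g) (hh : Primrec h) :
    Primrec (fun a => ent (f a) (g a) (h a)) := by
  have hp : Primrec (fun p : List (List MPoly) × ℕ × ℕ => ent p.1 p.2.1 p.2.2) := by
    unfold ent; fun_prop
  have hc := hp.comp (hf.pair (hg.pair hh))
  exact hc

@[fun_prop] theorem pr_coordCodes {f : α → ℕ}
    (hf : Primrec f) :
    Primrec (fun a => coordCodes (f a)) := by
  have hp : Primrec (fun p : ℕ => coordCodes p) := by
    unfold coordCodes; fun_prop
  have hc := hp.comp hf
  exact hc

@[fun_prop] theorem pr_shiftCodes {f : α → ℕ} {g : α → List CNum}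
    (hf : Primrec f) (hg : Primrec g) :
    Primrec (fun a => shiftCodes (f a) (g a)) := by
  have hp : Primrec (fun p : ℕ × List CNum => shiftCodes p.1 p.2) := by
    unfold shiftCodes; fun_prop
  have hc := hp.comp (hf.pair hg)
  exact hc

@[fun_prop] theorem pr_gvar {f : α → ℕ} {g : α → ℕ} {h : α → ℕ}
    (hf : Primrec f) (hg : Primrec g) (hh : Primrec h) :
    Primrec (fun a => gvar (f a) (g a) (h a)) := by
  have hp : Primrec (fun p : ℕ × ℕ × ℕ => gvar p.1 p.2.1 p.2.2) := by
    unfold gvar; fun_prop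
  have hc := hp.comp (hf.pair (hg.pair hh))
  exact hc

@[fun_prop] theorem pr_genericMatrix {f : α → ℕ} {g : α → ℕ}
    (hf : Primrec f) (hg : Primrec g) :
    Primrec (fun a => genericMatrix (f a) (g a)) := by
  have hp : Primrec (fun p : ℕ × ℕ => genericMatrix p.1 p.2) := by
    unfold genericMatrix; fun_prop
  have hc := hp.comp (hf.pair hg)
  exact hc

@[fun_prop] theorem pr_constMatrix {f : α → List (List CNum)}
    (hf : Primrec f) :
    Primrec (fun a => constMatrix (f a)) := by
  have hp : Primrec (fun p : List (List CNum) => constMatrix p) := by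
    unfold constMatrix; fun_prop
  have hc := hp.comp hf
  exact hc

@[fun_prop] theorem pr_mulVecCodes {f : α → ℕ} {g : α → List (List MPoly)} {h : α → List MPoly}
    (hf : Primrec f) (hg : Primrec g) (hh : Primrec h) :
    Primrec (fun a => mulVecCodes (f a) (g a) (h a)) := by
  have hp : Primrec (fun p : ℕ × List (List MPoly) × List MPoly => mulVecCodes p.1 p.2.1 p.2.2) := by
    unfold mulVecCodes; fun_prop
  have hc := hp.comp (hf.pair (hg.pair hh))
  exact hc

@[fun_prop] theorem pr_relationCode {f : α → ℕ} {g : α → List (List MPoly)} {h : α → List (List MPoly)} {k : α → ℕ} {l : α → ℕ}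
    (hf : Primrec f) (hg : Primrec g) (hh : Primrec h) (hk : Primrec k) (hl : Primrec l) :
    Primrec (fun a => relationCode (f a) (g a) (h a) (k a) (l a)) := by
  have hp : Primrec (fun p : ℕ × List (List MPoly) × List (List MPoly) × ℕ × ℕ => relationCode p.1 p.2.1 p.2.2.1 p.2.2.2.1 p.2.2.2.2) := by
    unfold relationCode; fun_prop
  have hc := hp.comp (hf.pair (hg.pair (hh.pair (hk.pair hl))))
  exact hc

@[fun_prop] theorem pr_memEq {f : α → ℕ} {g : α → List AnnTerm} {h : α → List (List AnnTerm)} {k : α → List (List MPoly)} {l : α → ℕ} {m : α → ℕ × List MPoly}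
    (hf : Primrec f) (hg : Primrec g) (hh : Primrec h) (hk : Primrec k) (hl : Primrec l) (hm : Primrec m) :
    Primrec (fun a => memEq (f a) (g a) (h a) (k a) (l a) (m a)) := by
  have hp : Primrec (fun p : ℕ × List AnnTerm × List (List AnnTerm) × List (List MPoly) × ℕ × ℕ × List MPoly => memEq p.1 p.2.1 p.2.2.1 p.2.2.2.1 p.2.2.2.2.1 p.2.2.2.2.2) := by
    unfold memEq; fun_prop
  have hc := hp.comp (hf.pair (hg.pair (hh.pair (hk.pair (hl.pair hm)))))
  exact hc

@[fun_prop] theorem pr_memEqs {f : α → ℕ} {g : α → List (List AnnTerm)} {h : α → List (List AnnTerm)} {k : α → List (List MPoly)} {l : α → List (List (ℕ × List MPoly))}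
    (hf : Primrec f) (hg : Primrec g) (hh : Primrec h) (hk : Primrec k) (hl : Primrec l) :
    Primrec (fun a => memEqs (f a) (g a) (h a) (k a) (l a)) := by
  have hp : Primrec (fun p : ℕ × List (List AnnTerm) × List (List AnnTerm) × List (List MPoly) × List (List (ℕ × List MPoly)) => memEqs p.1 p.2.1 p.2.2.1 p.2.2.2.1 p.2.2.2.2) := by
    unfold memEqs; fun_prop
  have hc := hp.comp (hf.pair (hg.pair (hh.pair (hk.pair hl))))
  exact hc

@[fun_prop] theorem pr_relationEqs {f : α → ℕ} {g : α → List (List MPoly)} {h : α → List (List MPoly)}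
    (hf : Primrec f) (hg : Primrec g) (hh : Primrec h) :
    Primrec (fun a => relationEqs (f a) (g a) (h a)) := by
  have hp : Primrec (fun p : ℕ × List (List MPoly) × List (List MPoly) => relationEqs p.1 p.2.1 p.2.2) := by
    unfold relationEqs; fun_prop
  have hc := hp.comp (hf.pair (hg.pair hh))
  exact hc

@[fun_prop] theorem pr_avoids {f : α → ℕ} {g : α → List ℕ} {h : α → MPoly}
    (hf : Primrec f) (hg : Primrec g) (hh : Primrec h) :
    Primrec (fun a => avoids (f a) (g a) (h a)) := by
  have hp : Primrec (fun p : ℕ × List ℕ × MPoly => avoids p.1 p.2.1 p.2.2) := by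
    unfold avoids; fun_prop
  have hc := hp.comp (hf.pair (hg.pair hh))
  exact hc

@[fun_prop] theorem pr_exceeds {f : α → ℕ} {g : α → ℕ} {h : α → MPoly}
    (hf : Primrec f) (hg : Primrec g) (hh : Primrec h) :
    Primrec (fun a => exceeds (f a) (g a) (h a)) := by
  have hp : Primrec (fun p : ℕ × ℕ × MPoly => exceeds p.1 p.2.1 p.2.2) := by
    unfold exceeds; fun_prop
  have hc := hp.comp (hf.pair (hg.pair hh))
  exact hc

@[fun_prop] theorem pr_witnessSide {f : α → ℕ} {g : α → ℕ} {h : α → WitnessData}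
    (hf : Primrec f) (hg : Primrec g) (hh : Primrec h) :
    Primrec (fun a => witnessSide (f a) (g a) (h a)) := by
  have hp : Primrec (fun p : ℕ × ℕ × WitnessData => witnessSide p.1 p.2.1 p.2.2) := by
    have hw : Primrec (fun p : ℕ × ℕ × WitnessData => p.2.2) := by fun_prop
    have h1 : Primrec (fun p : ℕ × ℕ × WitnessData =>
        decide (p.2.2.1.1 < p.2.1) && decide (p.2.2.1.2.1 < p.1)) :=
      pr_and (pr_decide_lt (by fun_prop) (by fun_prop)) (pr_decide_lt (by fun_prop) (by fun_prop))
    have h2 : Primrec (fun p : ℕ × ℕ × WitnessData =>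
        lall (List.range p.1) fun j => decide (p.2.2.1.2.2.2.getD j 0 ≤ p.2.2.1.2.2.1)) :=
      pr_lall (by fun_prop) (pr_decide_le (by fun_prop) (by fun_prop))
    have h3 : Primrec (fun p : ℕ × ℕ × WitnessData =>
        avoids p.1 p.2.2.1.2.2.2 p.2.2.2.2.1.2.1) := by fun_prop
    have h4 : Primrec (fun p : ℕ × ℕ × WitnessData =>
        lall p.2.2.2.2.2 fun Z => exceeds p.1 p.2.2.1.2.2.1 Z) := by fun_prop
    exact pr_and h1 (pr_and h2 (pr_and h3 h4))
  have hc := hp.comp (hf.pair (hg.pair hh))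
  exact hc

@[fun_prop] theorem pr_pointEq {f : α → WitnessData}
    (hf : Primrec f) :
    Primrec (fun a => pointEq (f a)) := by
  have hp : Primrec (fun p : WitnessData => pointEq p) := by
    unfold pointEq; fun_prop
  have hc := hp.comp hf
  exact hc

@[fun_prop] theorem pr_remainderCode {f : α → ℕ} {g : α → WitnessData}
    (hf : Primrec f) (hg : Primrec g) :
    Primrec (fun a => remainderCode (f a) (g a)) := by
  have hp : Primrec (fun p : ℕ × WitnessData => remainderCode p.1 p.2) := by
    unfold remainderCode; fun_prop
  have hc := hp.comp (hf.pair hg)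
  exact hc

@[fun_prop] theorem pr_substEq {f : α → ℕ} {g : α → ℕ} {h : α → List (List AnnTerm)} {k : α → WitnessData}
    (hf : Primrec f) (hg : Primrec g) (hh : Primrec h) (hk : Primrec k) :
    Primrec (fun a => substEq (f a) (g a) (h a) (k a)) := by
  have hp : Primrec (fun p : ℕ × ℕ × List (List AnnTerm) × WitnessData => substEq p.1 p.2.1 p.2.2.1 p.2.2.2) := by
    unfold substEq; fun_prop
  have hc := hp.comp (hf.pair (hg.pair (hh.pair hk)))
  exact hc

@[fun_prop] theorem pr_testEqs {f : α → ℕ} {g : α → List (List AnnTerm)} {h : α → WitnessData}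
    (hf : Primrec f) (hg : Primrec g) (hh : Primrec h) :
    Primrec (fun a => testEqs (f a) (g a) (h a)) := by
  have hp : Primrec (fun p : ℕ × List (List AnnTerm) × WitnessData => testEqs p.1 p.2.1 p.2.2) := by
    unfold testEqs; fun_prop
  have hc := hp.comp (hf.pair (hg.pair hh))
  exact hc

@[fun_prop] theorem pr_witnessEqs {f : α → ℕ} {g : α → ℕ} {h : α → List (List AnnTerm)} {k : α → List (List AnnTerm)} {l : α → WitnessData}
    (hf : Primrec f) (hg : Primrec g) (hh : Primrec h) (hk : Primrec k) (hl : Primrec l) :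
    Primrec (fun a => witnessEqs (f a) (g a) (h a) (k a) (l a)) := by
  have hp : Primrec (fun p : ℕ × ℕ × List (List AnnTerm) × List (List AnnTerm) × WitnessData => witnessEqs p.1 p.2.1 p.2.2.1 p.2.2.2.1 p.2.2.2.2) := by
    have h1 : Primrec (fun p : ℕ × ℕ × List (List AnnTerm) × List (List AnnTerm) × WitnessData =>
        pointEq p.2.2.2.2) := by fun_prop
    have h2 : Primrec (fun p : ℕ × ℕ × List (List AnnTerm) × List (List AnnTerm) × WitnessData =>
        substEq p.1 p.2.1 p.2.2.1 p.2.2.2.2) := by fun_prop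
    have h3 : Primrec (fun p : ℕ × ℕ × List (List AnnTerm) × List (List AnnTerm) × WitnessData =>
        testEqs p.1 p.2.2.2.1 p.2.2.2.2) := by fun_prop
    exact pr_cons h1 (pr_cons h2 h3)
  have hc := hp.comp (hf.pair (hg.pair (hh.pair (hk.pair hl))))
  exact hc

@[fun_prop] theorem pr_refutationSide {f : α → ℕ} {g : α → ℕ} {h : α → ℕ} {k : α → Refutation}
    (hf : Primrec f) (hg : Primrec g) (hh : Primrec h) (hk : Primrec k) :
    Primrec (fun a => refutationSide (f a) (g a) (h a) (k a)) := by
  have hp : Primrec (fun p : ℕ × ℕ × ℕ × Refutation => refutationSide p.1 p.2.1 p.2.2.1 p.2.2.2) := by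
    have h1 : Primrec (fun p : ℕ × ℕ × ℕ × Refutation =>
        lall p.2.2.2.1 fun t => decide (t.2.1 < p.1) && decide (t.2.2 < p.1)) :=
      pr_lall (by fun_prop) (pr_and (pr_decide_lt (by fun_prop) (by fun_prop))
        (pr_decide_lt (by fun_prop) (by fun_prop)))
    have h2 : Primrec (fun p : ℕ × ℕ × ℕ × Refutation =>
        lall p.2.2.2.2.1 fun w => witnessSide p.1 p.2.1 w) := by fun_prop
    have h3 : Primrec (fun p : ℕ × ℕ × ℕ × Refutation =>
        lall p.2.2.2.2.2 fun w => witnessSide p.1 p.2.2.1 w) := by fun_prop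
    exact pr_and h1 (pr_and h2 h3)
  have hc := hp.comp (hf.pair (hg.pair (hh.pair hk)))
  exact hc

@[fun_prop] theorem pr_relationMultiple {f : α → ℕ} {g : α → MPoly × ℕ × ℕ}
    (hf : Primrec f) (hg : Primrec g) :
    Primrec (fun a => relationMultiple (f a) (g a)) := by
  have hp : Primrec (fun p : ℕ × MPoly × ℕ × ℕ => relationMultiple p.1 p.2) := by
    unfold relationMultiple; fun_prop
  have hc := hp.comp (hf.pair hg)
  exact hc

@[fun_prop] theorem pr_witnessMultiple {f : α → WitnessData}
    (hf : Primrec f) :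
    Primrec (fun a => witnessMultiple (f a)) := by
  have hp : Primrec (fun p : WitnessData => witnessMultiple p) := by
    unfold witnessMultiple; fun_prop
  have hc := hp.comp hf
  exact hc

@[fun_prop] theorem pr_combinationEq {f : α → ℕ} {g : α → Refutation}
    (hf : Primrec f) (hg : Primrec g) :
    Primrec (fun a => combinationEq (f a) (g a)) := by
  have hp : Primrec (fun p : ℕ × Refutation => combinationEq p.1 p.2) := by
    unfold combinationEq; fun_prop
  have hc := hp.comp (hf.pair hg)
  exact hc

@[fun_prop] theorem pr_refutationEqs {f : α → ℕ} {g : α → List (List AnnTerm)} {h : α → List (List AnnTerm)} {k : α → Refutation}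
    (hf : Primrec f) (hg : Primrec g) (hh : Primrec h) (hk : Primrec k) :
    Primrec (fun a => refutationEqs (f a) (g a) (h a) (k a)) := by
  have hp : Primrec (fun p : ℕ × List (List AnnTerm) × List (List AnnTerm) × Refutation => refutationEqs p.1 p.2.1 p.2.2.1 p.2.2.2) := by
    unfold refutationEqs; fun_prop
  have hc := hp.comp (hf.pair (hg.pair (hh.pair hk)))
  exact hc

end
end ProjEquiv

namespace ProjEquiv
open MvPolynomial Filter

/-! ### The decision procedure -/

section
variable {r : ℕ}

/-- The data of a linear equivalence: the matrix and its inverse, and the cofactors which show that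
they carry one scheme to the other. -/
abbrev Equivalence : Type :=
  (List (List CNum) × List (List CNum)) ×
    (List (List (ℕ × List MPoly)) × List (List (ℕ × List MPoly)))

def equivalenceEqs (r : ℕ) (A B : List (List AnnTerm)) (d : Equivalence) : List MPoly :=
  relationEqs r (constMatrix d.1.1) (constMatrix d.1.2) ++
    (memEqs r A B (constMatrix d.1.1) d.2.1 ++ memEqs r B A (constMatrix d.1.2) d.2.2)

lemma good_of_equivalenceEqs {θ : QBar} {A B : List (List AnnTerm)} {d : Equivalence}
    (h : ∀ e ∈ equivalenceEqs r A B d, ev θ e = 0) : Good (sysVal θ r A) (sysVal θ r B) := by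
  simp only [equivalenceEqs, List.mem_append] at h
  let g (G : List (List CNum)) : Matrix (Fin r) (Fin r) QBar :=
    Matrix.of fun j l => cval θ ((G.getD j []).getD l ([], []))
  have hg (G : List (List CNum)) (j l : Fin r) : ev θ (ent (constMatrix G) j l) = C (g G j l) := by
    rw [ent_constMatrix, ev_num]
    rfl
  have h1 : g d.1.1 * g d.1.2 = 1 := by
    refine Matrix.ext fun i j => ?_
    have h2 := h (relationCode r (constMatrix d.1.1) (constMatrix d.1.2) i j)
      (Or.inl (by simp [relationEqs, -Fin.val_fin_lt]; exact ⟨i, i.2, j, j.2, rfl⟩))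
    rw [ev_relationCode, sub_eq_zero] at h2
    simp only [hg, ← map_mul, ← map_sum] at h2
    rw [Matrix.mul_apply]
    exact C_injective ℕ QBar h2
  -- For square matrices a right inverse is a left inverse, so one set of relations suffices.
  exact ⟨g d.1.1, g d.1.2, h1, mul_eq_one_comm.mp h1,
    memSat_of_memEqs (hg _) fun e he => h e (Or.inr (Or.inl he)),
    memSat_of_memEqs (hg _) fun e he => h e (Or.inr (Or.inr he))⟩

lemma eventually_constMatrix (g : Matrix (Fin r) (Fin r) QBar) : ∀ᶠ θ in large,
    ∃ G, ∀ j l : Fin r, ev θ (ent (constMatrix G) j l) = C (g j l) := by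
  have h1 : ∀ᶠ θ in large, ∀ j ∈ List.range r, ∀ l ∈ List.range r,
      ∃ y, ∀ (hj : j < r) (hl : l < r), cval θ y = g ⟨j, hj⟩ ⟨l, hl⟩ := by
    refine eventually_all_mem_list _ fun j hj => eventually_all_mem_list _ fun l hl => ?_
    exact (eventually_cval (g ⟨j, List.mem_range.mp hj⟩ ⟨l, List.mem_range.mp hl⟩)).mono
      fun θ h => h.imp fun y hy _ _ => hy
  filter_upwards [h1] with θ hθ
  simp only [List.mem_range] at hθ
  choose! y hy using hθ
  refine ⟨(List.range r).map fun j => (List.range r).map fun l => y j l, fun j l => ?_⟩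
  rw [ent_constMatrix, ev_num, getD_map_range _ _ _ j.2, getD_map_range _ _ _ l.2,
    hy j j.2 l l.2 j.2 l.2]

lemma eventually_equivalenceEqs {fs hs : List (MvPolynomial (Fin r) QBar)} (h : Good fs hs) :
    ∀ᶠ θ in large, ∃ d, ∀ A B, sysVal θ r A = fs → sysVal θ r B = hs →
      ∀ e ∈ equivalenceEqs r A B d, ev θ e = 0 := by
  obtain ⟨g, g', hgg', -, hfs, hhs⟩ := h
  filter_upwards [eventually_constMatrix g, eventually_constMatrix g', eventually_memEqs hfs,
    eventually_memEqs hhs] with θ h1 h2 h3 h4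
  obtain ⟨G, hG⟩ := h1
  obtain ⟨G', hG'⟩ := h2
  obtain ⟨a, ha⟩ := h3
  obtain ⟨a', ha'⟩ := h4
  refine ⟨((G, G'), (a, a')), fun A B hA hB e he => ?_⟩
  simp only [equivalenceEqs, List.mem_append] at he
  rcases he with he | he | he
  · simp only [relationEqs, List.mem_flatMap, List.mem_map, List.mem_range] at he
    obtain ⟨i, hi, j, hj, rfl⟩ := he
    obtain ⟨i, rfl⟩ : ∃ i' : Fin r, (i' : ℕ) = i := ⟨⟨i, hi⟩, rfl⟩
    obtain ⟨j, rfl⟩ : ∃ j' : Fin r, (j' : ℕ) = j := ⟨⟨j, hj⟩, rfl⟩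
    have h5 := ev_relationCode θ (constMatrix G) (constMatrix G') i j
    simp only [hG, hG', ← map_mul, ← map_sum] at h5
    rw [h5, ← Matrix.mul_apply, hgg', sub_self]
  · exact ha A B _ hA hB hG e he
  · exact ha' B A _ hB hA hG' e he

/-! ### Annotation of the input -/

lemma exists_of_forall₂ {α β : Type} {R : α → β → Prop} {L : List α} {L' : List β}
    (h : List.Forall₂ R L L') : ∀ a ∈ L, ∃ b, R a b := by
  induction h with
  | nil => simp
  | cons h _ ih =>
    intro a ha
    rcases List.mem_cons.mp ha with rfl | ha
    · exact ⟨_, h⟩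
    · exact ih a ha

lemma exists_number_of_represents {C : SchemeCode} {I : HomogeneousIdeal (polyGrading r)}
    (h : C.Represents I) : ∀ l ∈ C, ∀ t ∈ l, ∃ z, NumberCode.Represents t.1 z := by
  obtain ⟨fs, hfs, -, -⟩ := h
  intro l hl t ht
  obtain ⟨f, ms, hms, -⟩ := exists_of_forall₂ hfs l hl
  obtain ⟨m, -, z, hz, -⟩ := exists_of_forall₂ hms t ht
  exact ⟨z, hz⟩

lemma forall₂_map_left_eq {α β γ : Type} {R : β → γ → Prop} {f : α → β} {g : α → γ}
    {L : List α} {L' : List γ} (h : List.Forall₂ R (L.map f) L')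
    (hR : ∀ a ∈ L, ∀ c, R (f a) c → c = g a) : L' = L.map g := by
  induction L generalizing L' with
  | nil => simpa using h
  | cons a L ih =>
    rw [List.map_cons, List.forall₂_cons_left_iff] at h
    obtain ⟨c, L'', hc, hL, rfl⟩ := h
    rw [List.map_cons, ← hR a (by simp) c hc, ← ih hL fun a ha => hR a (by simp [ha])]

/-- The equations make every annotated number a root in its disc, and the represented number is the
only such root. Hence the annotated values are the given polynomials, whichever real `θ` the
certificate produced. -/
lemma span_sysVal {θ : QBar} (hθ : IsRealAlg θ) {I : HomogeneousIdeal (polyGrading r)}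
    {A : List (List AnnTerm)} (h : (forget A).Represents I)
    (hA : ∀ e ∈ systemEqs A, ev θ e = 0) :
    I.toIdeal = Ideal.span {f | f ∈ sysVal θ r A} := by
  obtain ⟨fs, hfs, -, hI⟩ := h
  have h1 : fs = sysVal θ r A := by
    refine forall₂_map_left_eq hfs fun l hl f hf => ?_
    obtain ⟨ms, hms, rfl⟩ := hf
    rw [polyVal]
    congr 1
    refine forall₂_map_left_eq hms fun a ha m hm => ?_
    obtain ⟨-, z, hz, rfl⟩ := hm
    have h2 : IsDiscRoot a.1.1 (cval θ a.2.1) := isDiscRoot_of_numberEqs hθ fun e he => hA e (by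
      rw [systemEqs, List.mem_flatMap]
      exact ⟨a, List.mem_flatten.mpr ⟨l, hl, ha⟩, he⟩)
    rw [termVal, hz.eq h2]
  rw [hI, h1]

/-- Each disc is assumed to contain some root, not a unique one, so that input which represents
nothing is covered as well. The polynomials `fs` are fixed before `θ`. -/
lemma eventually_annotated (r : ℕ) {C : SchemeCode}
    (h : ∀ l ∈ C, ∀ t ∈ l, ∃ z : QBar, IsDiscRoot t.1 z) :
    ∃ fs, ∀ᶠ θ in large, ∃ A, forget A = C ∧ sysVal θ r A = fs ∧
      ∀ e ∈ systemEqs A, ev θ e = 0 := by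
  have h0 : ∀ t ∈ C.flatten, ∃ z : QBar, IsDiscRoot t.1 z := by
    intro t ht
    obtain ⟨l, hl, htl⟩ := List.mem_flatten.mp ht
    exact h l hl t htl
  choose! z hz using h0
  refine ⟨C.map fun l => (l.map fun t =>
    MvPolynomial.C (z t) * ∏ i : Fin r, X i ^ t.2.getD i 0).sum, ?_⟩
  filter_upwards [eventually_all_mem_list C.flatten fun t ht => eventually_numberEqs (hz t ht)]
    with θ hθ
  choose! d hd using hθ
  refine ⟨C.map fun l => l.map fun t => (t, d t), ?_, ?_, ?_⟩
  · simp [forget, Function.comp_def]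
  · rw [sysVal, List.map_map]
    refine List.map_congr_left fun l hl => ?_
    rw [Function.comp_apply, polyVal, List.map_map]
    congr 1
    refine List.map_congr_left fun t ht => ?_
    rw [Function.comp_apply, termVal, (hd t (List.mem_flatten.mpr ⟨l, hl, ht⟩)).1]
  · intro e he
    rw [systemEqs, List.mem_flatMap] at he
    obtain ⟨a, ha, hae⟩ := he
    obtain ⟨l', hl', ha⟩ := List.mem_flatten.mp ha
    obtain ⟨l, hl, rfl⟩ := List.mem_map.mp hl'
    obtain ⟨t, ht, rfl⟩ := List.mem_map.mp ha
    exact (hd t (List.mem_flatten.mpr ⟨l, hl, ht⟩)).2 e hae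

lemma projectivelyEquivalent_iff_good {I J : HomogeneousIdeal (polyGrading r)}
    {fs hs : List (MvPolynomial (Fin r) QBar)} (hI : I.toIdeal = Ideal.span {f | f ∈ fs})
    (hJ : J.toIdeal = Ideal.span {f | f ∈ hs}) : ProjectivelyEquivalent I J ↔ Good fs hs := by
  have key (L M : Ideal (MvPolynomial (Fin r) QBar)) (fs : List (MvPolynomial (Fin r) QBar))
      (g : Matrix (Fin r) (Fin r) QBar) (hL : L = Ideal.span {f | f ∈ fs}) :
      (∀ f ∈ L, MemSat M (substHom g f)) ↔ ∀ f ∈ fs, MemSat M (substHom g f) := by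
    have h1 : (∀ f ∈ L, MemSat M (substHom g f)) ↔ L ≤ (satIdeal M).comap (substHom g) := Iff.rfl
    rw [h1, hL, Ideal.span_le]
    rfl
  rw [projectivelyEquivalent_iff]
  constructor
  · rintro ⟨g, g', h1, h2, h3, h4⟩
    -- The matrices trade places: `Good` substitutes its first matrix in the equations of the first
    -- scheme, which amounts to moving points by the inverse.
    refine ⟨g', g, h2, h1, ?_, ?_⟩
    · rw [← hJ]; exact (key _ _ _ _ hI).mp h3
    · rw [← hI]; exact (key _ _ _ _ hJ).mp h4
  · rintro ⟨g, g', h1, h2, h3, h4⟩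
    rw [← hJ] at h3
    rw [← hI] at h4
    exact ⟨g', g, h2, h1, (key _ _ _ _ hI).mpr h3, (key _ _ _ _ hJ).mpr h4⟩
end

/-! ### The three searches and their combination. -/

/-- All codes of numbers in the input. -/
def numberCodes (a : ℕ × SchemeCode × SchemeCode) : List NumberCode :=
  (a.2.1 ++ a.2.2).flatten.map fun t => t.1

lemma mem_numberCodes {a : ℕ × SchemeCode × SchemeCode} {c : NumberCode} :
    c ∈ numberCodes a ↔ ∃ l, (l ∈ a.2.1 ∨ l ∈ a.2.2) ∧ ∃ t ∈ l, t.1 = c := by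
  simp only [numberCodes, List.mem_map, List.mem_flatten, List.mem_append]
  constructor
  · rintro ⟨t, ⟨l, hl, ht⟩, rfl⟩
    exact ⟨l, hl, t, ht, rfl⟩
  · rintro ⟨l, hl, t, ht, rfl⟩
    exact ⟨t, ⟨l, hl, ht⟩, rfl⟩

/-- The annotations belong to the input. -/
def fits (a : ℕ × SchemeCode × SchemeCode) (A B : List (List AnnTerm)) : Bool :=
  decide (forget A = a.2.1) && decide (forget B = a.2.2)

section
set_option synthInstance.maxSize 1000
set_option synthInstance.maxHeartbeats 200000
variable {α : Type} [Primcodable α]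

@[fun_prop] theorem pr_equivalenceEqs {f : α → ℕ} {g h : α → List (List AnnTerm)}
    {k : α → Equivalence} (hf : Primrec f) (hg : Primrec g) (hh : Primrec h) (hk : Primrec k) :
    Primrec (fun a => equivalenceEqs (f a) (g a) (h a) (k a)) := by
  have hp : Primrec (fun p : ℕ × List (List AnnTerm) × List (List AnnTerm) × Equivalence =>
      equivalenceEqs p.1 p.2.1 p.2.2.1 p.2.2.2) := by
    unfold equivalenceEqs; fun_prop
  have hc := hp.comp (hf.pair (hg.pair (hh.pair hk)))
  exact hc

@[fun_prop] theorem pr_fits {f : α → ℕ × SchemeCode × SchemeCode}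
    {g h : α → List (List AnnTerm)} (hf : Primrec f) (hg : Primrec g) (hh : Primrec h) :
    Primrec (fun a => fits (f a) (g a) (h a)) :=
  pr_and (pr_decide_eq (by fun_prop) (by fun_prop)) (pr_decide_eq (by fun_prop) (by fun_prop))

@[fun_prop] theorem pr_numberCodes {f : α → ℕ × SchemeCode × SchemeCode} (hf : Primrec f) :
    Primrec (fun a => numberCodes (f a)) := by
  unfold numberCodes; fun_prop

lemma exists_check_equivalence : ∃ chk : (ℕ × SchemeCode × SchemeCode) × ℕ → Bool, Primrec chk ∧
    ∀ a, (∃ k, chk (a, k) = true) ↔ ∃ θ, IsRealAlg θ ∧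
      ∃ d : (List (List AnnTerm) × List (List AnnTerm)) × Equivalence,
        fits a d.1.1 d.1.2 = true ∧
        ∀ e ∈ systemEqs d.1.1 ++ (systemEqs d.1.2 ++ equivalenceEqs a.1 d.1.1 d.1.2 d.2),
          ev θ e = 0 :=
  exists_primrec_semidecision
    (α := ℕ × SchemeCode × SchemeCode)
    (β := (List (List AnnTerm) × List (List AnnTerm)) × Equivalence)
    (side := fun p => fits p.1 p.2.1.1 p.2.1.2)
    (eqs := fun p => systemEqs p.2.1.1 ++
      (systemEqs p.2.1.2 ++ equivalenceEqs p.1.1 p.2.1.1 p.2.1.2 p.2.2))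
    (by fun_prop) (by fun_prop)

lemma exists_check_refutation : ∃ chk : (ℕ × SchemeCode × SchemeCode) × ℕ → Bool, Primrec chk ∧
    ∀ a, (∃ k, chk (a, k) = true) ↔ ∃ θ, IsRealAlg θ ∧
      ∃ d : (List (List AnnTerm) × List (List AnnTerm)) × Refutation,
        (fits a d.1.1 d.1.2 && refutationSide a.1 d.1.1.length d.1.2.length d.2) = true ∧
        ∀ e ∈ systemEqs d.1.1 ++ (systemEqs d.1.2 ++ refutationEqs a.1 d.1.1 d.1.2 d.2),
          ev θ e = 0 :=
  exists_primrec_semidecision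
    (α := ℕ × SchemeCode × SchemeCode)
    (β := (List (List AnnTerm) × List (List AnnTerm)) × Refutation)
    (side := fun p => fits p.1 p.2.1.1 p.2.1.2 &&
      refutationSide p.1.1 p.2.1.1.length p.2.1.2.length p.2.2)
    (eqs := fun p => systemEqs p.2.1.1 ++
      (systemEqs p.2.1.2 ++ refutationEqs p.1.1 p.2.1.1 p.2.1.2 p.2.2))
    (by fun_prop) (by fun_prop)

lemma exists_check_noRoot : ∃ chk : (ℕ × SchemeCode × SchemeCode) × ℕ → Bool, Primrec chk ∧
    ∀ a, (∃ k, chk (a, k) = true) ↔ ∃ θ, IsRealAlg θ ∧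
      ∃ d : ℕ × RatCode × List (CNum × RealCode),
        decide (d.1 < (numberCodes a).length) = true ∧
        ∀ e ∈ noRootEqs ((numberCodes a).getD d.1 ([], 0, 0, 0)) d.2, ev θ e = 0 :=
  exists_primrec_semidecision
    (α := ℕ × SchemeCode × SchemeCode)
    (β := ℕ × RatCode × List (CNum × RealCode))
    (side := fun p => decide (p.2.1 < (numberCodes p.1).length))
    (eqs := fun p => noRootEqs ((numberCodes p.1).getD p.2.1 ([], 0, 0, 0)) p.2.2)
    (pr_decide_lt (by fun_prop) (by fun_prop)) (by fun_prop)
end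

/-- This is the termination of the search on every input, meaningful or not. Either some code has no
root in its disc, or roots can be chosen for all codes, and then the resulting systems are `Good` or
not. -/
lemma exists_noRoot_or_equivalence_or_refutation (a : ℕ × SchemeCode × SchemeCode) :
    (∃ θ, IsRealAlg θ ∧ ∃ d : (List (List AnnTerm) × List (List AnnTerm)) × Equivalence,
        fits a d.1.1 d.1.2 = true ∧
        ∀ e ∈ systemEqs d.1.1 ++ (systemEqs d.1.2 ++ equivalenceEqs a.1 d.1.1 d.1.2 d.2),
          ev θ e = 0) ∨
    (∃ θ, IsRealAlg θ ∧ ∃ d : (List (List AnnTerm) × List (List AnnTerm)) × Refutation,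
        (fits a d.1.1 d.1.2 && refutationSide a.1 d.1.1.length d.1.2.length d.2) = true ∧
        ∀ e ∈ systemEqs d.1.1 ++ (systemEqs d.1.2 ++ refutationEqs a.1 d.1.1 d.1.2 d.2),
          ev θ e = 0) ∨
    (∃ θ, IsRealAlg θ ∧ ∃ d : ℕ × RatCode × List (CNum × RealCode),
        decide (d.1 < (numberCodes a).length) = true ∧
        ∀ e ∈ noRootEqs ((numberCodes a).getD d.1 ([], 0, 0, 0)) d.2, ev θ e = 0) := by
  by_cases h : ∀ c ∈ numberCodes a, ∃ z : QBar, IsDiscRoot c z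
  · obtain ⟨fs, hfs⟩ := eventually_annotated a.1 (C := a.2.1) fun l hl t ht =>
      h _ (mem_numberCodes.mpr ⟨l, Or.inl hl, t, ht, rfl⟩)
    obtain ⟨hs, hhs⟩ := eventually_annotated a.1 (C := a.2.2) fun l hl t ht =>
      h _ (mem_numberCodes.mpr ⟨l, Or.inr hl, t, ht, rfl⟩)
    by_cases hg : Good fs hs
    -- The annotations and the certificate exist for all sufficiently large `ℚ(θ, i)`; as the filter
    -- is proper, one `θ` serves for all of them.
    · obtain ⟨θ, hθ, ⟨A, hA, hAf, hAe⟩, ⟨B, hB, hBf, hBe⟩, d, hd⟩ :=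
        (eventually_isRealAlg.and (hfs.and (hhs.and (eventually_equivalenceEqs hg)))).exists
      refine Or.inl ⟨θ, hθ, ((A, B), d), by simp [fits, hA, hB], fun e he => ?_⟩
      rcases List.mem_append.mp he with he | he
      · exact hAe e he
      rcases List.mem_append.mp he with he | he
      · exact hBe e he
      · exact hd A B hAf hBf e he
    · obtain ⟨θ, hθ, ⟨A, hA, hAf, hAe⟩, ⟨B, hB, hBf, hBe⟩, d, hd⟩ :=
        (eventually_isRealAlg.and (hfs.and (hhs.and (eventually_refutationEqs hg)))).exists
      refine Or.inr (Or.inl ⟨θ, hθ, ((A, B), d), ?_, fun e he => ?_⟩)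
      · simp [fits, hA, hB, (hd A B hAf hBf).1]
      rcases List.mem_append.mp he with he | he
      · exact hAe e he
      rcases List.mem_append.mp he with he | he
      · exact hBe e he
      · exact (hd A B hAf hBf).2 e he
  · push Not at h
    obtain ⟨c, hc, hcz⟩ := h
    obtain ⟨k, hk, rfl⟩ := List.getElem_of_mem hc
    obtain ⟨θ, hθ, d, hd⟩ := (eventually_isRealAlg.and (eventually_noRootEqs hcz)).exists
    refine Or.inr (Or.inr ⟨θ, hθ, (k, d), decide_eq_true hk, ?_⟩)
    rwa [List.getD_eq_getElem _ _ hk]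

/-- The decision procedure for projective equivalence. -/
theorem exists_computable_decision : ∃ f : ℕ × SchemeCode × SchemeCode → Bool, Computable f ∧
    ∀ (r : ℕ) (I J : HomogeneousIdeal (polyGrading r)) (c d : SchemeCode), c.Represents I →
      d.Represents J → (f (r, c, d) = true ↔ ProjectivelyEquivalent I J) := by
  obtain ⟨chk1, h1, hc1⟩ := exists_check_equivalence
  obtain ⟨chk2, h2, hc2⟩ := exists_check_refutation
  obtain ⟨chk3, h3, hc3⟩ := exists_check_noRoot
  -- A code without a root in its disc is answered by `false`. On input which represents schemes
  -- this case cannot occur.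
  have h23 : Primrec fun p => chk2 p || chk3 p := pr_or h2 h3
  have hcover : ∀ a, (∃ k, chk1 (a, k) = true) ∨ ∃ k, (chk2 (a, k) || chk3 (a, k)) = true := by
    intro a
    rcases exists_noRoot_or_equivalence_or_refutation a with h | h | h
    · exact Or.inl ((hc1 a).mpr h)
    · obtain ⟨k, hk⟩ := (hc2 a).mpr h
      exact Or.inr ⟨k, by rw [hk, Bool.true_or]⟩
    · obtain ⟨k, hk⟩ := (hc3 a).mpr h
      exact Or.inr ⟨k, by rw [hk, Bool.or_true]⟩
  obtain ⟨f, hf, hspec⟩ := exists_computable_separation h1 h23 hcover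
  refine ⟨f, hf, fun r I J c d hI hJ => ⟨fun ht => ?_, fun hpe => ?_⟩⟩
  · obtain ⟨θ, hθ, D, hD, he⟩ := (hc1 _).mp ((hspec _).1 ht)
    simp only [fits, Bool.and_eq_true, decide_eq_true_iff] at hD
    obtain ⟨rfl, rfl⟩ := hD
    simp only [List.mem_append] at he
    exact (projectivelyEquivalent_iff_good
      (span_sysVal hθ hI fun e h => he e (Or.inl h))
      (span_sysVal hθ hJ fun e h => he e (Or.inr (Or.inl h)))).mpr
      (good_of_equivalenceEqs fun e h => he e (Or.inr (Or.inr h)))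
  · by_contra hne
    obtain ⟨k, hk⟩ := (hspec _).2 (Bool.eq_false_iff.mpr hne)
    rcases Bool.or_eq_true_iff.mp hk with hk | hk
    · obtain ⟨θ, hθ, D, hD, he⟩ := (hc2 _).mp ⟨k, hk⟩
      simp only [fits, Bool.and_eq_true, decide_eq_true_iff] at hD
      obtain ⟨⟨rfl, rfl⟩, hside⟩ := hD
      simp only [List.mem_append] at he
      exact not_good_of_refutationEqs hside (fun e h => he e (Or.inr (Or.inr h)))
        ((projectivelyEquivalent_iff_good
          (span_sysVal hθ hI fun e h => he e (Or.inl h))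
          (span_sysVal hθ hJ fun e h => he e (Or.inr (Or.inl h)))).mp hpe)
    · obtain ⟨θ, hθ, D, hD, he⟩ := (hc3 _).mp ⟨k, hk⟩
      have hD := of_decide_eq_true hD
      rw [List.getD_eq_getElem _ _ hD] at he
      obtain ⟨l, hl, t, ht, htc⟩ := mem_numberCodes.mp (List.getElem_mem hD)
      obtain ⟨z, hz⟩ : ∃ z, NumberCode.Represents t.1 z := by
        rcases hl with hl | hl
        · exact exists_number_of_represents hI l hl t ht
        · exact exists_number_of_represents hJ l hl t ht
      rw [htc] at hz
      exact not_represents_of_noRootEqs hθ he z hz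

end ProjEquiv

theorem proposition5p1 :
    ∃ decide : ℕ × ProjEquiv.SchemeCode × ProjEquiv.SchemeCode → Bool,
      Computable decide ∧
      ∀ (r : ℕ), 0 < r →
      ∀ (I J : HomogeneousIdeal (ProjEquiv.polyGrading r)) (c d : ProjEquiv.SchemeCode),
        c.Represents I → d.Represents J →
        (decide (r, c, d) = true ↔ ProjEquiv.ProjectivelyEquivalent I J) := by
  obtain ⟨f, hf, h⟩ := ProjEquiv.exists_computable_decision
  exact ⟨f, hf, fun r _ => h r⟩
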